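/- Let $0<c\le 1$ and let $p=(p_x)_{x\in\mathbb Z}$ be an environment, i.e. a sequence in $[c,1]$ with $c=\inf_x p_x$. Let $(N_x)_{x\in\mathbb Z}$ be independent Poisson processes with $\mathbf E N_x(t)=p_xt$. The totally asymmetric zero-range process $(\eta_t)_{t\ge0}$ in the environment $p$ is the Markov process on $\mathbf X=\mathbb N^{\mathbb Z}$ (with the product topology, $\mathbb N=\{0,1,\dots\}$) evolving by the rule: when $N_x$ jumps at time $t$ and $\eta_{t-}(x)>0$, one particle moves from $x$ to $x+1$. Write $S_p(t)$ for its semigroup, so that $\delta_\eta S_p(t)$ is the law of $\eta_t$ when $\eta_0=\eta$. For $0\le v$ with $v<p_x$ for all $x$, let $\nu_{p,v}$ be the product measure on $\mathbf X$ with marginals $\nu_{p,v}\{\xi:\xi(x)=k\}=(v/p_x)^k(1-v/p_x)$, $k\in\mathbb N$. Assume that the limits $$R(p,v)=\lim_{n\to\infty}\frac1n\sum_{x=-n+1}^{0}\frac{v}{p_x-v},\qquad 0\le v<c,$$ exist, and put $\rho^*(p)=\lim_{v\uparrow c}R(p,v)\in[0,\infty]$. For $\eta\in\mathbf X$ let $\underline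 D(\eta)=\liminf_{n\to\infty}\frac1n\sum_{x=-n+1}^{0}\eta(x)\in[0,\infty]$. **Theorem.** Suppose that $p_x>c$ for all $x\in\mathbb Z$, that $\liminf_{x\to-\infty}p_x=c$, and that $\rho^*(p)<\infty$. If $\eta\in\mathbf X$ satisfies $\underline D(\eta)>\rho^*(p)$, then $\delta_\eta S_p(t)$ converges weakly to $\nu_{p,c}$ as $t\to\infty$. -/

import Mathlib

open MeasureTheory ProbabilityTheory Filter Topology

noncomputable section

namespace ZeroRange

/-- An environment: jump rates `p_x ∈ [c, 1]`, `x ∈ ℤ`, with `c = inf_x p_x` and `0 < c ≤ 1`. -/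
structure Environment where
  rate : ℤ → ℝ
  c : ℝ
  c_pos : 0 < c
  rate_le_one : ∀ x, rate x ≤ 1
  isGLB_c : IsGLB (Set.range rate) c

namespace Environment

theorem c_le_rate (p : Environment) (x : ℤ) : p.c ≤ p.rate x := p.isGLB_c.1 ⟨x, rfl⟩

theorem rate_pos (p : Environment) (x : ℤ) : 0 < p.rate x := p.c_pos.trans_le (p.c_le_rate x)

end Environment

/-- Particle configurations: elements of `ℕ^ℤ`, with the product topology and σ-algebra. -/
abbrev Config : Type := ℤ → ℕ

/-! ### The Poisson clocks

A sample point `τ` gives, for each site `x`, the successive waiting times `τ x 0, τ x 1, …` between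
the rings of the clock at `x`. They are independent, those at `x` being exponential of rate `p_x`,
so that the counting processes `N_x(t) = rings τ x t` are independent Poisson processes with
`E N_x(t) = p_x t`. -/

/-- Waiting times of all clocks. -/
abbrev Clocks : Type := ℤ → ℕ → ℝ

instance (p : Environment) (x : ℤ) : IsProbabilityMeasure (expMeasure (p.rate x)) :=
  isProbabilityMeasure_expMeasure (p.rate_pos x)

/-- The law of the clocks: all waiting times independent, those at `x` exponential of rate
`p_x`. -/
def clockMeasure (p : Environment) : Measure Clocks :=
  Measure.infinitePi fun x : ℤ => Measure.infinitePi fun _ : ℕ => expMeasure (p.rate x)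

instance (p : Environment) : IsProbabilityMeasure (clockMeasure p) := by
  unfold clockMeasure; infer_instance

/-- The time of the ring number `k` (`k = 0, 1, …`) of the clock at `x`. -/
def ringTime (τ : Clocks) (x : ℤ) (k : ℕ) : ℝ := ∑ i ∈ Finset.range (k + 1), τ x i

/-- `N_x(t)`: the number of rings at `x` up to and including time `t`. -/
def rings (τ : Clocks) (x : ℤ) (t : ℝ) : ℕ := {k : ℕ | ringTime τ x k ≤ t}.ncard

/-- `N_x(s-)`: the number of rings at `x` strictly before time `s`. -/
def ringsBefore (τ : Clocks) (x : ℤ) (s : ℝ) : ℕ := {k : ℕ | ringTime τ x k < s}.ncard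

/-! ### The dynamics

When the clock at `x` rings at time `s` and `x` is occupied just before `s`, one particle moves
from `x` to `x + 1`. -/

/-- The number of particles that leave a site during the first `k` rings of its clock, if the site
holds `q` particles at time `0`, its clock rings at the times `T 0 < T 1 < …`, and `A s` particles
arrive before time `s`: the ring number `k` moves a particle precisely when the number
`q + A (T k) - (number of earlier departures)` of particles then present is positive. -/
def siteDepartures (q : ℕ) (T : ℕ → ℝ) (A : ℝ → ℕ) : ℕ → ℕ
  | 0 => 0
  | k + 1 =>
    if siteDepartures q T A k < q + A (T k) then siteDepartures q T A k + 1
    else siteDepartures q T A k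

/-- The number of particles that jump from `x` to `x + 1` strictly before time `s`, starting from
`η`, when only the `d` clocks at the sites `x - d + 1, …, x` are used. -/
def departuresBefore (η : Config) (τ : Clocks) : ℕ → ℤ → ℝ → ℕ
  | 0, _, _ => 0
  | d + 1, x, s =>
    siteDepartures (η x) (ringTime τ x) (departuresBefore η τ d (x - 1)) (ringsBefore τ x s)

/-- The number of particles that jump from `x` to `x + 1` in the time interval `[0, t]`, starting
from `η`, when only the `d + 1` clocks at the sites `x - d, …, x` are used. -/
def departuresUpTo (η : Config) (τ : Clocks) (d : ℕ) (x : ℤ) (t : ℝ) : ℕ :=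
  siteDepartures (η x) (ringTime τ x) (departuresBefore η τ d (x - 1)) (rings τ x t)

/-- The number of particles that jump from `x` to `x + 1` in `[0, t]`. Almost surely there is a site
`y < x` with `N_y(t) = 0`; no particle leaves such a `y` up to time `t`, so the sequence in `d` is
eventually constant and its limit is the number of jumps when all clocks are used. -/
def departures (η : Config) (τ : Clocks) (x : ℤ) (t : ℝ) : ℕ :=
  limUnder atTop fun d : ℕ => departuresUpTo η τ d x t

/-- The zero-range process `η_t` started from `η`: initial particles, plus arrivals, minus
departures. -/
def process (η : Config) (τ : Clocks) (t : ℝ) : Config :=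
  fun x => η x + departures η τ (x - 1) t - departures η τ x t

/-! ### Measurability of the process -/

theorem measurable_ringTime (x : ℤ) (k : ℕ) : Measurable fun τ : Clocks => ringTime τ x k := by
  unfold ringTime; fun_prop

theorem measurable_rings (x : ℤ) (t : ℝ) : Measurable fun τ : Clocks => rings τ x t :=
  measurable_ncard.comp (measurable_set_iff.2 fun k =>
    measurableSet_setOfPred.1 (measurableSet_le (measurable_ringTime x k) measurable_const))

theorem measurable_ringsBefore (x : ℤ) {s : Clocks → ℝ} (hs : Measurable s) :
    Measurable fun τ : Clocks => ringsBefore τ x (s τ) :=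
  measurable_ncard.comp (measurable_set_iff.2 fun k =>
    measurableSet_setOfPred.1 (measurableSet_lt (measurable_ringTime x k) hs))

theorem measurable_siteDepartures (q : ℕ) (x : ℤ) {A : Clocks → ℝ → ℕ} {n : Clocks → ℕ}
    (hA : ∀ s : Clocks → ℝ, Measurable s → Measurable fun τ => A τ (s τ)) (hn : Measurable n) :
    Measurable fun τ : Clocks => siteDepartures q (ringTime τ x) (A τ) (n τ) := by
  have h : ∀ k : ℕ, Measurable fun τ : Clocks => siteDepartures q (ringTime τ x) (A τ) k := by
    intro k
    induction k with
    | zero => exact measurable_const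
    | succ k ih =>
      simp only [siteDepartures]
      exact Measurable.ite
        (measurableSet_lt ih (measurable_const.add (hA _ (measurable_ringTime x k))))
        (ih.add measurable_const) ih
  exact (measurable_from_prod_countable_right (f := fun q' : ℕ × Clocks =>
    siteDepartures q (ringTime q'.2 x) (A q'.2) q'.1) h).comp (hn.prodMk measurable_id)

theorem measurable_departuresBefore (η : Config) (d : ℕ) (x : ℤ) {s : Clocks → ℝ}
    (hs : Measurable s) : Measurable fun τ : Clocks => departuresBefore η τ d x (s τ) := by
  induction d generalizing x s with
  | zero => simp only [departuresBefore]; exact measurable_const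
  | succ d ih =>
    simp only [departuresBefore]
    exact measurable_siteDepartures (η x) x (fun s hs => ih (x - 1) hs)
      (measurable_ringsBefore x hs)

theorem measurable_departures (η : Config) (x : ℤ) (t : ℝ) :
    Measurable fun τ : Clocks => departures η τ x t := by
  have h : ∀ d : ℕ, StronglyMeasurable fun τ : Clocks => departuresUpTo η τ d x t := fun d =>
    (measurable_siteDepartures (η x) x (fun s hs => measurable_departuresBefore η d (x - 1) hs)
      (measurable_rings x t)).stronglyMeasurable
  exact (StronglyMeasurable.limUnder (l := atTop) h).measurable

theorem measurable_process (η : Config) (t : ℝ) :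
    Measurable fun τ : Clocks => process η τ t :=
  measurable_pi_lambda _ fun x =>
    (measurable_const.add (measurable_departures η (x - 1) t)).sub (measurable_departures η x t)

/-- `δ_η S_p(t)`: the law at time `t` of the zero-range process in the environment `p` started from
the configuration `η`. -/
def law (p : Environment) (η : Config) (t : ℝ) : ProbabilityMeasure Config :=
  ⟨(clockMeasure p).map fun τ => process η τ t,
    Measure.isProbabilityMeasure_map (measurable_process η t).aemeasurable⟩

/-! ### Product measures and densities -/

/-- `ν_{p,v}`: the product measure on `ℕ^ℤ` under which `ξ(x) = k` has probability
`(v / p_x)^k (1 - v / p_x)`. Here `geometricMeasure s` gives `k` the mass `(1 - s)^k s`. -/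
def productGeometric (p : Environment) (v : ℝ) (hv₀ : 0 ≤ v) (hv : ∀ x, v < p.rate x) :
    ProbabilityMeasure Config :=
  ⟨Measure.infinitePi fun x : ℤ => geometricMeasure
      ⟨1 - v / p.rate x, sub_nonneg.2 ((div_le_one (p.rate_pos x)).2 (hv x).le),
        sub_le_self 1 (div_nonneg hv₀ (p.rate_pos x).le)⟩,
    inferInstance⟩

/-- `r = R(p, v)`: the averages of the `ν_{p,v}`-expected numbers of particles at the sites
`-n + 1, …, 0` converge to `r`. -/
def HasMeanLeftDensity (p : Environment) (v r : ℝ) : Prop :=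
  Tendsto (fun n : ℕ => (1 / (n : ℝ)) * ∑ x ∈ Finset.Icc (-(n : ℤ) + 1) 0, v / (p.rate x - v))
    atTop (𝓝 r)

/-- The lower asymptotic left density of a configuration, a number in `[0, ∞]`. -/
def lowerLeftDensity (η : Config) : EReal :=
  liminf (fun n : ℕ =>
    (((1 / (n : ℝ)) * ∑ x ∈ Finset.Icc (-(n : ℤ) + 1) 0, (η x : ℝ) : ℝ) : EReal)) atTop

end ZeroRange

end

namespace ZeroRange

open scoped ENNReal

/-! The argument is pathwise: the process and the auxiliary stationary systems use the same clocks,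
and `η_t` is squeezed between stationary systems with parameters close to `c`. Such a system has a
source at a site `y`, which emits a particle at every ring. If the source rings at rate `v`, below
all the rates to its right in the window, then the product of geometric laws with ratios `v / p_x`
is invariant (`map_evolve`), and the flux is `v t + o(t)` (`whp_current`).

The comparison rests on a recursion for departure counts that is linear over (min, +)
(`tandem_succ_succ`). By `current_cut`, cutting at `Y` makes the current through `x` the minimum of
two terms: the current created by a source at `Y + 1`, and the current of the particles that start
at or to the left of `Y` when the others are removed, plus the number of removed particles in `(Y,
x]`. Knowing which term attains the minimum gives an order of occupation numbers
(`occupation_le_source`, `source_occupation_le`). So a strict inequality between currents, visible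
at order `t`, yields an inequality at a single site.

Upper bound (`whp_process_le_evolve`): let `y` be a site whose rate `u` is close to `c` and below
all rates between `y` and the right end of the window. The current of the process is at most `u t +
o(t)`, because everything must pass `y`, while a source at `y + 1` would send strictly more through
empty sites. Hence the process lies below the stationary system of parameter `u`. The density of `η`
plays no role here.

Lower bound (`whp_evolve_le_process`): since the density of `η` exceeds `ρ*`, `η` has linearly more
particles than a stationary configuration of parameter `c - ε`. If the particles starting far to the
left were the binding constraint, this surplus would produce a current above the `(c + ε) t` allowed
by a slow site. So the process dominates a system with a source near `-a t`
(`whp_current_lt_truncate`). For small `a` that source sends more than `v t`, where `v < c`, and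
therefore dominates the stationary system of parameter `v`.

Letting `v ↑ c` and `u ↓ c` gives the limits of the probabilities of the increasing events
`atLeast`, which determine weak convergence. -/

/-- Clock realizations with positive waiting times and finitely many rings in bounded time. -/
def Regular (τ : Clocks) : Prop :=
  ∀ x, (∀ k, 0 < τ x k) ∧ Tendsto (ringTime τ x) atTop atTop

theorem ringTime_succ (τ : Clocks) (x : ℤ) (k : ℕ) :
    ringTime τ x (k + 1) = ringTime τ x k + τ x (k + 1) :=
  Finset.sum_range_succ _ _

theorem Regular.strictMono {τ : Clocks} (h : Regular τ) (x : ℤ) : StrictMono (ringTime τ x) :=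
  strictMono_nat_of_lt_succ fun k => by
    rw [ringTime_succ]; linarith [(h x).1 (k + 1)]

/-- The set is an initial segment of `ℕ`, and some `n` outside it is needed because `ncard` is `0`
on infinite sets. Ring counts enter the pathwise arguments through this equivalence. -/
theorem ncard_setOf_of_lt_iff {P : ℕ → Prop} (hmono : ∀ i j, i ≤ j → P j → P i)
    (hex : ∃ n, ¬ P n) (k : ℕ) : k < {n | P n}.ncard ↔ P k := by
  classical
  have h : {n | P n} = ((Finset.range (Nat.find hex) : Finset ℕ) : Set ℕ) := by
    ext n
    simp only [Set.mem_ofPred_eq, Finset.coe_range, Set.mem_Iio, Nat.lt_find_iff, not_not]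
    exact ⟨fun hn m hm => hmono m n hm hn, fun hn => hn n le_rfl⟩
  have h' : P k ↔ k ∈ {n | P n} := Iff.rfl
  rw [h', h, Set.ncard_coe_finset]
  simp

theorem Regular.lt_rings_iff {τ : Clocks} (h : Regular τ) (x : ℤ) (t : ℝ) (k : ℕ) :
    k < rings τ x t ↔ ringTime τ x k ≤ t := by
  refine ncard_setOf_of_lt_iff (fun i j hij hj => ((h.strictMono x).monotone hij).trans hj) ?_ k
  obtain ⟨n, hn⟩ := ((h x).2.eventually_gt_atTop t).exists
  exact ⟨n, not_le.2 hn⟩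

theorem Regular.lt_ringsBefore_iff {τ : Clocks} (h : Regular τ) (x : ℤ) (t : ℝ) (k : ℕ) :
    k < ringsBefore τ x t ↔ ringTime τ x k < t := by
  refine ncard_setOf_of_lt_iff
    (fun i j hij hj => ((h.strictMono x).monotone hij).trans_lt hj) ?_ k
  obtain ⟨n, hn⟩ := ((h x).2.eventually_ge_atTop t).exists
  exact ⟨n, not_lt.2 hn⟩

theorem Regular.ringsBefore_mono {τ : Clocks} (h : Regular τ) (x : ℤ) {s t : ℝ} (hst : s ≤ t) :
    ringsBefore τ x s ≤ ringsBefore τ x t :=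
  le_of_forall_lt fun k hk => by
    rw [h.lt_ringsBefore_iff] at hk ⊢; exact hk.trans_le hst

theorem Regular.ringsBefore_le_rings {τ : Clocks} (h : Regular τ) (x : ℤ) {s t : ℝ}
    (hst : s ≤ t) : ringsBefore τ x s ≤ rings τ x t :=
  le_of_forall_lt fun k hk => by
    rw [h.lt_ringsBefore_iff] at hk; rw [h.lt_rings_iff]; exact hk.le.trans hst

/-! ### Departure counts in a row of sites and their min-plus recursion. -/

/-- The number of particles that leave the site `y + n` during the first `k` rings of its clock,
when `b k` particles leave `y` during the first `k` rings at `y`, and the sites `y + 1, …, y + n`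
hold the particles of `η` at time `0`. -/
noncomputable def tandem (b : ℕ → ℕ) (η : Config) (τ : Clocks) (y : ℤ) : ℕ → ℕ → ℕ
  | 0, k => b k
  | n + 1, k =>
    siteDepartures (η (y + (n + 1 : ℕ))) (ringTime τ (y + (n + 1 : ℕ)))
      (fun s => tandem b η τ y n (ringsBefore τ (y + n) s)) k

theorem siteDepartures_congr {q q' : ℕ} {T T' : ℕ → ℝ} {A A' : ℝ → ℕ} (hq : q = q')
    (h : ∀ k, A (T k) = A' (T' k)) (k : ℕ) :
    siteDepartures q T A k = siteDepartures q' T' A' k := by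
  subst hq
  induction k with
  | zero => rfl
  | succ k ih => simp only [siteDepartures, ih, h]

theorem siteDepartures_step (q : ℕ) (T : ℕ → ℝ) (A : ℝ → ℕ) (k : ℕ) :
    siteDepartures q T A k ≤ siteDepartures q T A (k + 1) ∧
      siteDepartures q T A (k + 1) ≤ siteDepartures q T A k + 1 := by
  simp only [siteDepartures]; split_ifs <;> omega

/-- Departures never exceed `q + A (T k)`, so the test in the definition fails exactly at equality
and becomes a minimum. -/
theorem siteDepartures_succ {q : ℕ} {T : ℕ → ℝ} {A : ℝ → ℕ} (hA : Monotone fun k => A (T k))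
    (k : ℕ) : siteDepartures q T A (k + 1) = min (siteDepartures q T A k + 1) (q + A (T k)) := by
  have h : ∀ k, siteDepartures q T A k ≤ q + A (T k) := by
    intro k
    induction k with
    | zero => simp [siteDepartures]
    | succ k ih =>
      have := hA (Nat.le_succ k)
      simp only [siteDepartures, Nat.succ_eq_add_one] at this ⊢
      split_ifs <;> omega
  have := h k
  simp only [siteDepartures]
  split_ifs <;> omega

/-- A cumulative departure count: it starts at `0` and every ring moves at most one particle. -/
structure IsCount (b : ℕ → ℕ) : Prop where
  zero : b 0 = 0
  mono : Monotone b
  step : ∀ k, b (k + 1) ≤ b k + 1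

/-- The two base counts in use: `id` is a source, emitting at every ring, and `0` is a closed left
end. -/
theorem isCount_id : IsCount id := ⟨rfl, monotone_id, fun _ => le_rfl⟩

theorem isCount_zero : IsCount 0 := ⟨rfl, monotone_const, fun _ => by simp⟩

theorem isCount_siteDepartures (q : ℕ) (T : ℕ → ℝ) (A : ℝ → ℕ) :
    IsCount (siteDepartures q T A) :=
  ⟨rfl, monotone_nat_of_le_succ fun k => (siteDepartures_step q T A k).1,
    fun k => (siteDepartures_step q T A k).2⟩

theorem IsCount.le {b : ℕ → ℕ} (h : IsCount b) (k : ℕ) : b k ≤ k := by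
  induction k with
  | zero => exact h.zero.le
  | succ k ih => exact (h.step k).trans (by omega)

theorem IsCount.tandem {b : ℕ → ℕ} (h : IsCount b) (η : Config) (τ : Clocks) (y : ℤ) (n : ℕ) :
    IsCount (tandem b η τ y n) := by
  cases n with
  | zero => exact h
  | succ n => exact isCount_siteDepartures _ _ _

section Recursion

variable {b : ℕ → ℕ} {η : Config} {τ : Clocks} {y : ℤ}

theorem tandem_succ_zero (n : ℕ) : tandem b η τ y (n + 1) 0 = 0 := rfl

theorem tandem_succ_succ (hb : IsCount b) (hτ : Regular τ) (n k : ℕ) :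
    tandem b η τ y (n + 1) (k + 1) = min (tandem b η τ y (n + 1) k + 1)
      (η (y + (n + 1 : ℕ)) +
        tandem b η τ y n (ringsBefore τ (y + n) (ringTime τ (y + (n + 1 : ℕ)) k))) :=
  siteDepartures_succ (fun _ _ hij => (hb.tandem η τ y n).mono
    (hτ.ringsBefore_mono _ ((hτ.strictMono _).monotone hij))) k

theorem tandem_add (j n k : ℕ) :
    tandem b η τ y (j + n) k = tandem (tandem b η τ y j) η τ (y + j) n k := by
  induction n generalizing k with
  | zero => rfl
  | succ n ih =>
    have e1 : y + ((j + n + 1 : ℕ) : ℤ) = y + j + ((n + 1 : ℕ) : ℤ) := by push_cast; ring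
    have e2 : y + ((j + n : ℕ) : ℤ) = y + j + (n : ℤ) := by push_cast; ring
    rw [← add_assoc]
    simp only [tandem, e1, e2]
    exact siteDepartures_congr rfl (fun _ => ih _) k

theorem tandem_congr {b' : ℕ → ℕ} {η' : Config} {τ' : Clocks} {n : ℕ} (hb : ∀ k, b k = b' k)
    (hη : ∀ x, y < x → x ≤ y + n → η x = η' x) (hτ : ∀ x, y ≤ x → x ≤ y + n → τ x = τ' x)
    (k : ℕ) : tandem b η τ y n k = tandem b' η' τ' y n k := by
  induction n generalizing k with
  | zero => exact hb k
  | succ n ih =>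
    have hT : ringTime τ (y + (n + 1 : ℕ)) = ringTime τ' (y + (n + 1 : ℕ)) := by
      funext i; simp only [ringTime, hτ (y + (n + 1 : ℕ)) (by omega) le_rfl]
    have hT' : ringsBefore τ (y + n) = ringsBefore τ' (y + n) := by
      funext s; simp only [ringsBefore, ringTime, hτ (y + n) (by omega) (by push_cast; omega)]
    have ih' := fun k => ih (fun x h1 h2 => hη x h1 (h2.trans (by push_cast; omega)))
      (fun x h1 h2 => hτ x h1 (h2.trans (by push_cast; omega))) k
    simp only [tandem, hT, hT']
    exact siteDepartures_congr (hη _ (by push_cast; omega) le_rfl) (fun _ => ih' _) k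

theorem sum_Ioc_add_one (f : ℤ → ℕ) (y : ℤ) (n : ℕ) :
    ∑ z ∈ Finset.Ioc y (y + (n + 1 : ℕ)), f z =
      ∑ z ∈ Finset.Ioc y (y + n), f z + f (y + (n + 1 : ℕ)) := by
  have : Finset.Ioc y (y + (n + 1 : ℕ)) = insert (y + (n + 1 : ℕ)) (Finset.Ioc y (y + n)) := by
    ext z; simp only [Finset.mem_Ioc, Finset.mem_insert]; push_cast; omega
  rw [this, Finset.sum_insert (by simp), add_comm]

/-- Heights are monotone in the initial heights. -/
theorem tandem_height_le {b' : ℕ → ℕ} {η' : Config} (hb : IsCount b) (hb' : IsCount b')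
    (hτ : Regular τ) {N : ℕ} {C : ℤ} (h0 : ∀ k, (b k : ℤ) ≤ b' k + C)
    (h : ∀ i ≤ N, (∑ z ∈ Finset.Ioc y (y + i), η' z : ℕ) ≤
      C + (∑ z ∈ Finset.Ioc y (y + i), η z : ℕ)) {n : ℕ} (hn : n ≤ N) (k : ℕ) :
    (tandem b η τ y n k : ℤ) - (∑ z ∈ Finset.Ioc y (y + n), η z : ℕ) ≤
      tandem b' η' τ y n k + C - (∑ z ∈ Finset.Ioc y (y + n), η' z : ℕ) := by
  induction n generalizing k with
  | zero => simpa [tandem] using h0 k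
  | succ n ih =>
    induction k with
    | zero =>
      have := h (n + 1) hn
      rw [tandem_succ_zero, tandem_succ_zero]; push_cast at this ⊢; linarith
    | succ k ihk =>
      -- The clocks are shared, so both upstream counts are read at the same ring number, and the
      -- two arguments of the minimum are ordered separately.
      have ih' := ih (by omega)
        (ringsBefore τ (y + n) (ringTime τ (y + (n + 1 : ℕ)) k))
      rw [tandem_succ_succ hb hτ, tandem_succ_succ hb' hτ, sum_Ioc_add_one, sum_Ioc_add_one] at *
      omega

/-- With `η' = 0`, deleting the particles lowers the count by at most their number; with `η = 0`,
adding particles never lowers it. -/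
theorem tandem_le_add_sum {η' : Config} (hb : IsCount b) (hτ : Regular τ) (n k : ℕ) :
    tandem b η τ y n k ≤ tandem b η' τ y n k + ∑ z ∈ Finset.Ioc y (y + n), η z := by
  induction n generalizing k with
  | zero => simp [tandem]
  | succ n ih =>
    induction k with
    | zero => simp [tandem_succ_zero]
    | succ k ihk =>
      have ih' := ih (ringsBefore τ (y + n) (ringTime τ (y + (n + 1 : ℕ)) k))
      rw [tandem_succ_succ hb hτ, tandem_succ_succ hb hτ, sum_Ioc_add_one] at *
      omega

theorem tandem_mono_base {b' : ℕ → ℕ} (hb : IsCount b) (hb' : IsCount b') (hτ : Regular τ)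
    (h0 : ∀ k, b k ≤ b' k) (n k : ℕ) : tandem b η τ y n k ≤ tandem b' η τ y n k := by
  have := tandem_height_le (η := η) (η' := η) (y := y) hb hb' hτ (N := n) (C := 0)
    (fun k => by simpa using h0 k) (fun i _ => by simp) le_rfl k
  omega

/-- The configuration `η` with the particles to the right of `Y` removed. -/
def truncate (η : Config) (Y : ℤ) : Config := fun x => if x ≤ Y then η x else 0

/-- Min-plus linearity: the departures are the minimum of those obtained by putting a source at
`y + j + 1`, and of those obtained by counting first the particles to the right of `y + j`. -/
theorem tandem_cut (hb : IsCount b) (hτ : Regular τ) (j n k : ℕ) :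
    tandem b η τ y (j + 1 + n) k = min (tandem id η τ (y + (j + 1 : ℕ)) n k)
      (tandem b (truncate η (y + j)) τ y (j + 1 + n) k +
        ∑ z ∈ Finset.Ioc (y + j) (y + j + (n + 1 : ℕ)), η z) := by
  have htr : ∀ i : ℕ, truncate η (y + j) (y + (j + 1 + i : ℕ)) = 0 := fun i => by
    simp only [truncate]; rw [if_neg]; push_cast; omega
  induction n generalizing k with
  | zero =>
    -- Up to `y + j` the truncation changes nothing. At `y + j + 1` the source term is just `k`, the
    -- number of rings.
    have hF : ∀ k, tandem b (truncate η (y + j)) τ y j k = tandem b η τ y j k := fun k =>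
      tandem_congr (fun _ => rfl) (fun x _ h2 => by simp [truncate, h2]) (fun _ _ _ => rfl) k
    have hs : ∑ z ∈ Finset.Ioc (y + j) (y + j + (0 + 1 : ℕ)), η z = η (y + (j + 1 : ℕ)) := by
      rw [sum_Ioc_add_one]; simp [add_assoc]
    rw [hs]
    induction k with
    | zero => simp [tandem, siteDepartures]
    | succ k ihk =>
      have h0 := htr 0
      simp only [add_zero] at h0 ihk ⊢
      rw [tandem_succ_succ hb hτ, tandem_succ_succ hb hτ, hF, h0, ihk]
      simp only [tandem, id]
      omega
  | succ n ih =>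
    have e1 : y + ((j + 1 + n : ℕ) : ℤ) = y + ((j + 1 : ℕ) : ℤ) + n := by push_cast; ring
    have e2 : y + ((j + 1 + n + 1 : ℕ) : ℤ) = y + ((j + 1 : ℕ) : ℤ) + ((n + 1 : ℕ) : ℤ) := by
      push_cast; ring
    have e3 : y + (j : ℤ) + ((n + 1 + 1 : ℕ) : ℤ) = y + ((j + 1 : ℕ) : ℤ) + ((n + 1 : ℕ) : ℤ) := by
      push_cast; ring
    have h0 := htr (n + 1)
    have hs := sum_Ioc_add_one η (y + j) (n + 1)
    rw [e3] at hs ⊢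
    induction k with
    | zero => simp [tandem, siteDepartures, ← add_assoc]
    | succ k ihk =>
      rw [← add_assoc (j + 1)] at *
      -- The upstream identity is used at the number of upstream rings before the current ring.
      -- Adding constants distributes over `min`, so both sides obey the same recursion.
      have ih' := ih (ringsBefore τ (y + ((j + 1 : ℕ) : ℤ) + n)
        (ringTime τ (y + ((j + 1 : ℕ) : ℤ) + ((n + 1 : ℕ) : ℤ)) k))
      rw [e2] at h0
      rw [tandem_succ_succ hb hτ, tandem_succ_succ hb hτ, tandem_succ_succ isCount_id hτ, e1, e2,
        h0, ihk, ih', hs]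
      omega

/-- Attractiveness, in terms of departure counts: an ordering of the configurations and of the
increments of the base processes is preserved. -/
theorem siteDepartures_attractive {q q' : ℕ} {T : ℕ → ℝ} {A A' : ℝ → ℕ} (hq : q ≤ q')
    (hA : Monotone fun k => A (T k))
    (hAA' : Monotone fun k => (A' (T k) : ℤ) - A (T k)) (h0 : A (T 0) ≤ A' (T 0)) :
    Monotone (fun k => (siteDepartures q' T A' k : ℤ) - siteDepartures q T A k) ∧
      ∀ k, (q : ℤ) + A (T k) - siteDepartures q T A k ≤
        q' + A' (T k) - siteDepartures q' T A' k ∧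
      siteDepartures q T A k ≤ q + A (T k) := by
  have key : ∀ k, (q : ℤ) + A (T k) - siteDepartures q T A k ≤
        q' + A' (T k) - siteDepartures q' T A' k ∧
      siteDepartures q T A k ≤ q + A (T k) := by
    intro k
    induction k with
    | zero => simp only [siteDepartures]; omega
    | succ k ih =>
      have h1 := hA (Nat.le_succ k)
      have h2 := hAA' (Nat.le_succ k)
      simp only [siteDepartures, Nat.succ_eq_add_one] at h1 h2 ⊢
      split_ifs <;> omega
  -- Whenever the smaller queue is nonempty at a ring, so is the larger, hence no ring moves a
  -- particle in the smaller system alone.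
  refine ⟨monotone_nat_of_le_succ fun k => ?_, key⟩
  have := key k
  simp only [siteDepartures]
  split_ifs <;> omega

/-- Attractiveness: the ordering of departure increments is preserved. -/
theorem monotone_tandem_sub {b' : ℕ → ℕ} {η' : Config} (hb : IsCount b) (hb' : IsCount b')
    (hτ : Regular τ) (hbb' : Monotone fun k => (b' k : ℤ) - b k) {n : ℕ}
    (hη : ∀ x, y < x → x ≤ y + n → η x ≤ η' x) :
    Monotone fun k => (tandem b' η' τ y n k : ℤ) - tandem b η τ y n k := by
  induction n with
  | zero => exact hbb'
  | succ n ih =>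
    have ih := ih fun x h1 h2 => hη x h1 (h2.trans (by push_cast; omega))
    have hr : Monotone fun k => ringsBefore τ (y + n) (ringTime τ (y + (n + 1 : ℕ)) k) :=
      fun _ _ hij => hτ.ringsBefore_mono _ ((hτ.strictMono _).monotone hij)
    refine (siteDepartures_attractive (A := fun s => tandem b η τ y n (ringsBefore τ (y + n) s))
      (A' := fun s => tandem b' η' τ y n (ringsBefore τ (y + n) s))
      (hη _ (by push_cast; omega) le_rfl)
      ((hb.tandem η τ y n).mono.comp hr) (ih.comp hr) ?_).1
    have := ih (Nat.zero_le (ringsBefore τ (y + n) (ringTime τ (y + (n + 1 : ℕ)) 0)))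
    simp only [(hb.tandem η τ y n).zero, (hb'.tandem η' τ y n).zero] at this
    omega

/-- Attractiveness: the ordering of configurations is preserved. -/
theorem tandem_state_le {b' : ℕ → ℕ} {η' : Config} (hb : IsCount b) (hb' : IsCount b')
    (hτ : Regular τ) (hbb' : Monotone fun k => (b' k : ℤ) - b k) {n : ℕ}
    (hη : ∀ x, y < x → x ≤ y + (n + 1 : ℕ) → η x ≤ η' x) (t : ℝ) :
    (η (y + (n + 1 : ℕ)) : ℤ) + tandem b η τ y n (rings τ (y + n) t) -
        tandem b η τ y (n + 1) (rings τ (y + (n + 1 : ℕ)) t) ≤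
      (η' (y + (n + 1 : ℕ)) : ℤ) + tandem b' η' τ y n (rings τ (y + n) t) -
        tandem b' η' τ y (n + 1) (rings τ (y + (n + 1 : ℕ)) t) := by
  have ih := monotone_tandem_sub (n := n) hb hb' hτ hbb'
    fun x h1 h2 => hη x h1 (h2.trans (by push_cast; omega))
  have hr : Monotone fun k => ringsBefore τ (y + n) (ringTime τ (y + (n + 1 : ℕ)) k) :=
    fun _ _ hij => hτ.ringsBefore_mono _ ((hτ.strictMono _).monotone hij)
  have h0 : ∀ r, tandem b η τ y n r ≤ tandem b' η' τ y n r := fun r => by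
    have := ih (Nat.zero_le r)
    simp only [(hb.tandem η τ y n).zero, (hb'.tandem η' τ y n).zero] at this
    omega
  have hq := hη (y + (n + 1 : ℕ)) (by push_cast; omega) le_rfl
  obtain hK | ⟨k, hK⟩ : rings τ (y + (n + 1 : ℕ)) t = 0 ∨
      ∃ k, rings τ (y + (n + 1 : ℕ)) t = k + 1 := by
    rcases rings τ (y + (n + 1 : ℕ)) t with _ | k
    exacts [Or.inl rfl, Or.inr ⟨k, rfl⟩]
  · rw [hK, tandem_succ_zero, tandem_succ_zero]
    have := h0 (rings τ (y + n) t)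
    omega
  -- Here `k` is the last ring up to `t`. The queues are ordered at that ring, and afterwards there
  -- are only arrivals, whose increments are ordered by `h2`.
  · have hT : ringTime τ (y + (n + 1 : ℕ)) k ≤ t := (hτ.lt_rings_iff _ _ _).1 (by omega)
    have h1 := (siteDepartures_attractive (T := ringTime τ (y + (n + 1 : ℕ)))
      (A := fun s => tandem b η τ y n (ringsBefore τ (y + n) s))
      (A' := fun s => tandem b' η' τ y n (ringsBefore τ (y + n) s)) hq
      ((hb.tandem η τ y n).mono.comp hr) (ih.comp hr) (h0 _)).2 k
    have h2 := ih (hτ.ringsBefore_le_rings (y + n) hT)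
    have h3 := (hb.tandem η τ y n).mono (hτ.ringsBefore_le_rings (y + n) hT)
    rw [hK]
    simp only [tandem, siteDepartures] at h1 h2 h3 ⊢
    split_ifs <;> omega

/-- The current through the sites is controlled by the current at the base. -/
theorem tandem_rings_succ_le (hb : IsCount b) (hτ : Regular τ) (n : ℕ) (t : ℝ) :
    tandem b η τ y (n + 1) (rings τ (y + (n + 1 : ℕ)) t) ≤
      η (y + (n + 1 : ℕ)) + tandem b η τ y n (rings τ (y + n) t) := by
  rcases hK : rings τ (y + (n + 1 : ℕ)) t with _ | k
  · simp [tandem_succ_zero]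
  · have hT : ringTime τ (y + (n + 1 : ℕ)) k ≤ t := (hτ.lt_rings_iff _ _ _).1 (by omega)
    have h3 := (hb.tandem η τ y n).mono (hτ.ringsBefore_le_rings (y + n) hT)
    rw [tandem_succ_succ hb hτ]
    omega

theorem tandem_rings_le (hb : IsCount b) (hτ : Regular τ) (n : ℕ) (t : ℝ) :
    tandem b η τ y n (rings τ (y + n) t) ≤
      ∑ z ∈ Finset.Ioc y (y + n), η z + b (rings τ y t) := by
  induction n with
  | zero => simp [tandem]
  | succ n ih =>
    have := tandem_rings_succ_le (η := η) (y := y) hb hτ n t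
    rw [sum_Ioc_add_one]
    omega

end Recursion

/-! ### Currents and occupation numbers: comparison with sources. -/

/-- The number of particles that jump from `x` to `x + 1` in `[0, t]` when the sites
`y + 1, …, x` start from `η` and the departures from `y` are given by `b`. -/
noncomputable def current (b : ℕ → ℕ) (η : Config) (τ : Clocks) (y x : ℤ) (t : ℝ) : ℕ :=
  tandem b η τ y (x - y).toNat (rings τ x t)

/-- The number of particles at `x` at time `t` in the system with base `y`. -/
noncomputable def occupation (b : ℕ → ℕ) (η : Config) (τ : Clocks) (y x : ℤ) (t : ℝ) : ℤ :=
  η x + current b η τ y (x - 1) t - current b η τ y x t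

theorem current_add (b : ℕ → ℕ) (η : Config) (τ : Clocks) (y : ℤ) (n : ℕ) (t : ℝ) :
    current b η τ y (y + n) t = tandem b η τ y n (rings τ (y + n) t) := by
  simp [current]

theorem rings_congr {τ τ' : Clocks} {x : ℤ} (h : τ x = τ' x) : rings τ x = rings τ' x := by
  funext t; simp only [rings, ringTime, h]

theorem current_congr {b : ℕ → ℕ} {η η' : Config} {τ τ' : Clocks} {y x : ℤ} (hyx : y ≤ x)
    (hη : ∀ z, y < z → z ≤ x → η z = η' z) (hτ : ∀ z, y ≤ z → z ≤ x → τ z = τ' z) (t : ℝ) :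
    current b η τ y x t = current b η' τ' y x t := by
  obtain ⟨n, rfl⟩ := Int.le.dest hyx
  rw [current_add, current_add, rings_congr (hτ _ hyx le_rfl)]
  exact tandem_congr (fun _ => rfl) hη hτ _

section

variable {b : ℕ → ℕ} {η : Config} {τ : Clocks} {y Y x : ℤ} {t : ℝ}

theorem current_self : current b η τ y y t = b (rings τ y t) := by
  simp [current, tandem]

theorem current_le_rings (hb : IsCount b) : current b η τ y x t ≤ rings τ x t :=
  (hb.tandem _ _ _ _).le _

theorem current_mono_config (hτ : Regular τ) (hb : IsCount b) :
    current b 0 τ y x t ≤ current b η τ y x t := by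
  have := tandem_le_add_sum (η := 0) (η' := η) (y := y) hb hτ (x - y).toNat (rings τ x t)
  simpa [current] using this

theorem current_le_add_sum (hτ : Regular τ) (hb : IsCount b) (hyx : y ≤ x) (η' : Config) :
    current b η τ y x t ≤ current b η' τ y x t + ∑ z ∈ Finset.Ioc y x, η z := by
  obtain ⟨n, rfl⟩ := Int.le.dest hyx
  rw [current_add, current_add]
  exact tandem_le_add_sum hb hτ n _

theorem current_rebase (hyY : y ≤ Y) (hYx : Y ≤ x) :
    current b η τ y x t = current (tandem b η τ y (Y - y).toNat) η τ Y x t := by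
  obtain ⟨j, rfl⟩ := Int.le.dest hyY
  obtain ⟨n, rfl⟩ := Int.le.dest hYx
  have h : y + (j : ℤ) + n = y + ((j + n : ℕ) : ℤ) := by push_cast; ring
  have e := tandem_add (b := b) (η := η) (τ := τ) (y := y) j n (rings τ (y + ((j + n : ℕ) : ℤ)) t)
  rw [current_add, h, current_add, e, add_sub_cancel_left, Int.toNat_natCast]

/-- No departure count from `Y` exceeds the number of rings, which is what a source emits. -/
theorem current_le_source (hτ : Regular τ) (hb : IsCount b) (hyY : y ≤ Y) (hYx : Y ≤ x) :
    current b η τ y x t ≤ current id η τ Y x t := by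
  rw [current_rebase hyY hYx]
  exact tandem_mono_base (hb.tandem _ _ _ _) isCount_id hτ (fun k => (hb.tandem _ _ _ _).le k) _ _

/-- This is how a single slow site `Y` limits the current at every site to its right. -/
theorem current_le_sum_add (hτ : Regular τ) (hb : IsCount b) (hyY : y ≤ Y) (hYx : Y ≤ x) :
    current b η τ y x t ≤ ∑ z ∈ Finset.Ioc Y x, η z + rings τ Y t := by
  refine (current_le_source hτ hb hyY hYx).trans ?_
  obtain ⟨n, rfl⟩ := Int.le.dest hYx
  rw [current_add]
  exact tandem_rings_le isCount_id hτ n t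

theorem current_le_sub_one_add (hτ : Regular τ) (hb : IsCount b) (hyx : y < x) :
    current b η τ y x t ≤ η x + current b η τ y (x - 1) t := by
  obtain ⟨n, rfl⟩ := Int.le.dest (show y + 1 ≤ x by omega)
  have e : y + 1 + (n : ℤ) = y + ((n + 1 : ℕ) : ℤ) := by push_cast; ring
  have e' : y + 1 + (n : ℤ) - 1 = y + n := by ring
  rw [e', e, current_add, current_add]
  exact tandem_rings_succ_le hb hτ n t

/-- Min-plus linearity for currents. -/
theorem current_cut (hτ : Regular τ) (hb : IsCount b) (hyY : y ≤ Y) (hYx : Y + 1 ≤ x) :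
    current b η τ y x t = min (current id η τ (Y + 1) x t)
      (current b (truncate η Y) τ y x t + ∑ z ∈ Finset.Ioc Y x, η z) := by
  obtain ⟨j, rfl⟩ := Int.le.dest hyY
  obtain ⟨n, rfl⟩ := Int.le.dest hYx
  have h := tandem_cut (η := η) (y := y) hb hτ j n (rings τ (y + j + 1 + n) t)
  have e1 : y + (j : ℤ) + 1 + n = y + ((j + 1 + n : ℕ) : ℤ) := by push_cast; ring
  have e2 : y + (j : ℤ) + 1 = y + ((j + 1 : ℕ) : ℤ) := by push_cast; ring
  have e3 : y + (j : ℤ) + ((n + 1 : ℕ) : ℤ) = y + (j : ℤ) + 1 + n := by push_cast; ring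
  have c1 : (y + (j : ℤ) + 1 + n - y).toNat = j + 1 + n := by omega
  have c2 : (y + (j : ℤ) + 1 + n - (y + (j : ℤ) + 1)).toNat = n := by omega
  rw [e3] at h
  rw [← e2] at h
  simp only [current, c1, c2]
  exact h

theorem current_le_truncate_add (hτ : Regular τ) (hb : IsCount b) (hyY : y ≤ Y) (hYx : Y ≤ x) :
    current b η τ y x t ≤
      current b (truncate η Y) τ y x t + ∑ z ∈ Finset.Ioc Y x, η z := by
  rcases hYx.eq_or_lt with rfl | hlt
  · rw [current_congr (η' := truncate η Y) hyY (fun z _ h => by simp [truncate, h])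
      (fun _ _ _ => rfl)]
    omega
  · rw [current_cut hτ hb hyY hlt]
    exact min_le_right _ _

theorem occupation_le_of_base {b' : ℕ → ℕ} {η' : Config} (hb : IsCount b) (hb' : IsCount b')
    (hτ : Regular τ) (hbb' : Monotone fun k => (b' k : ℤ) - b k) (hyx : y < x)
    (hη : ∀ z, y < z → z ≤ x → η z ≤ η' z) :
    occupation b η τ y x t ≤ occupation b' η' τ y x t := by
  obtain ⟨n, rfl⟩ := Int.le.dest (show y + 1 ≤ x by omega)
  have e : y + 1 + (n : ℤ) = y + ((n + 1 : ℕ) : ℤ) := by push_cast; ring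
  have e' : y + ((n + 1 : ℕ) : ℤ) - 1 = y + n := by push_cast; ring
  simp only [occupation]
  rw [e, e', current_add, current_add, current_add, current_add]
  exact tandem_state_le hb hb' hτ hbb' (fun z h1 h2 => hη z h1 (h2.trans e.ge)) t

theorem sum_Ioc_sub_one_add (f : ℤ → ℕ) (h : Y < x) :
    ∑ z ∈ Finset.Ioc Y x, f z = ∑ z ∈ Finset.Ioc Y (x - 1), f z + f x := by
  obtain ⟨n, rfl⟩ := Int.le.dest (show Y + 1 ≤ x by omega)
  have e : Y + 1 + (n : ℤ) = Y + ((n + 1 : ℕ) : ℤ) := by push_cast; ring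
  have e' : Y + ((n + 1 : ℕ) : ℤ) - 1 = Y + n := by push_cast; ring
  rw [e, sum_Ioc_add_one, e']

/-- If the current of `ζ` through `x` is not affected by the particles to the right of `Y`, then at
`x` this system is dominated by any system with a source at `Y`. -/
theorem occupation_le_source {ζ : Config} {σ : Clocks} (hτ : Regular τ) (hσ : Regular σ)
    (hb : IsCount b) (hyY : y ≤ Y) (hYx : Y < x) (hστ : ∀ z, Y ≤ z → σ z = τ z)
    (h : current b ζ σ y x t < current id 0 τ (Y + 1) x t) :
    occupation b ζ σ y x t ≤ occupation id η τ Y x t := by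
  -- By `h` the source term is not the minimum, so the current through `x` equals the truncated
  -- current plus all of `ζ` on `(Y, x]`. At `x - 1` the inequality of `h3` suffices.
  have h1 := current_cut (t := t) (η := ζ) hσ hb hyY (show Y + 1 ≤ x from hYx)
  have h2 : current id 0 τ (Y + 1) x t ≤ current id ζ σ (Y + 1) x t := by
    rw [current_congr (τ := σ) (τ' := τ) (show Y + 1 ≤ x from hYx) (fun _ _ _ => rfl)
      (fun z hz _ => hστ z (by omega))]
    exact current_mono_config hτ isCount_id
  have h3 := current_le_truncate_add (t := t) (η := ζ) hσ hb hyY (show Y ≤ x - 1 by omega)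
  have h4 := sum_Ioc_sub_one_add ζ hYx
  have hc : IsCount (tandem b (truncate ζ Y) σ y (Y - y).toNat) := hb.tandem _ _ _ _
  -- Seen from `Y`, the truncated system starts empty and its base count grows by at most one per
  -- ring, so attractiveness puts it below a source started from any configuration.
  have h5 := occupation_le_of_base (t := t) (η := truncate ζ Y) (η' := η) hc isCount_id hσ
    (monotone_nat_of_le_succ fun k => by
      have := hc.step k
      simp only [id] at *
      push_cast
      omega) hYx
    (fun z hz _ => by simp only [truncate]; rw [if_neg (by omega)]; exact Nat.zero_le _)
  have hz : truncate ζ Y x = 0 := by simp only [truncate]; rw [if_neg (by omega)]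
  simp only [occupation] at h5 ⊢
  rw [← current_rebase hyY (by omega), ← current_rebase hyY (by omega), hz,
    current_congr (τ := σ) (τ' := τ) (show Y ≤ x - 1 by omega) (fun _ _ _ => rfl)
      (fun z hz _ => hστ z (by omega)),
    current_congr (b := id) (τ := σ) (τ' := τ) (show Y ≤ x by omega) (fun _ _ _ => rfl)
      (fun z hz _ => hστ z (by omega))] at h5
  omega

/-- If the current of `η` through `x - 1` is not affected by the particles to the left of `Y`, then
at `x` the system dominates the one with a source at `Y`. -/
theorem source_occupation_le (hτ : Regular τ) (hb : IsCount b) (hyY : y < Y) (hYx : Y < x)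
    (h : current b η τ y (x - 1) t < current b (truncate η (Y - 1)) τ y (x - 1) t +
      ∑ z ∈ Finset.Ioc (Y - 1) (x - 1), η z) :
    occupation id η τ Y x t ≤ occupation b η τ y x t := by
  -- By `h` the minimum at `x - 1` is attained by the source at `Y`. At `x` only the upper bound by
  -- that source is needed.
  have h1 := current_cut (t := t) (η := η) (x := x - 1) (y := y) (Y := Y - 1) hτ hb
    (by omega) (by omega)
  have h2 := current_le_source (t := t) (η := η) hτ hb hyY.le hYx.le
  rw [sub_add_cancel] at h1
  simp only [occupation]
  omega

/-- Lower bound of the current of the particles to the left of `Y`, by comparison with a system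
with a source at `y`. -/
theorem le_truncate_current {ζ : Config} {σ : Clocks} {z w : ℤ} {M : ℕ} (hτ : Regular τ)
    (hσ : Regular σ) (hb : IsCount b) (hzy : z ≤ y) (hyY : y < Y) (hYw : Y ≤ w)
    (hστ : ∀ u, y < u → σ u = τ u)
    (h : ∀ u, y < u → u ≤ Y → ∑ v ∈ Finset.Ioc u w, ζ v + M ≤ ∑ v ∈ Finset.Ioc u w, η v) :
    min (∑ v ∈ Finset.Ioc y w, η v) (current id ζ σ y w t + M) ≤
      current b (truncate η Y) τ z w t + ∑ v ∈ Finset.Ioc Y w, η v := by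
  have hsplit : ∀ (f : Config) {u : ℤ}, u ≤ Y → ∑ v ∈ Finset.Ioc u w, f v =
      ∑ v ∈ Finset.Ioc u Y, f v + ∑ v ∈ Finset.Ioc Y w, f v := fun f u hu => by
    rw [← Finset.sum_union (Finset.disjoint_left.2 fun v h1 h2 => by
      simp only [Finset.mem_Ioc] at h1 h2; omega), Finset.Ioc_union_Ioc_eq_Ioc hu hYw]
  have htr : ∀ {u v : ℤ}, v ≤ Y →
      ∑ v ∈ Finset.Ioc u v, truncate η Y v = ∑ v ∈ Finset.Ioc u v, η v := fun {u v} hv =>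
    Finset.sum_congr rfl fun i hi => by
      simp only [Finset.mem_Ioc] at hi
      simp only [truncate]; rw [if_pos (by omega)]
  have htr' : ∀ {v : ℤ}, ∑ v ∈ Finset.Ioc Y v, truncate η Y v = 0 := fun {v} =>
    Finset.sum_eq_zero fun i hi => by
      simp only [Finset.mem_Ioc] at hi
      simp only [truncate]; rw [if_neg (by omega)]
  -- A second cut, at `y`: one term counts all of `η` on `(y, Y]`, the other is a source at `y + 1`.
  -- The latter is compared with the system started from `ζ`.
  rw [current_cut (η := truncate η Y) hτ hb hzy (show y + 1 ≤ w by omega), hsplit (truncate η Y)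
    hyY.le, htr le_rfl, htr', add_zero, hsplit η hyY.le, ← min_add_add_right, le_min_iff]
  refine ⟨(min_le_right _ _).trans ?_, (min_le_left _ _).trans (by omega)⟩
  have h1 : current id ζ σ y w t ≤ current id ζ τ (y + 1) w t := by
    rw [← current_congr (τ := σ) (τ' := τ) (show y + 1 ≤ w by omega) (fun _ _ _ => rfl)
      (fun z hz _ => hστ z (by omega))]
    exact current_le_source hσ isCount_id (by omega) (by omega)
  obtain ⟨n, hn⟩ := Int.le.dest (show y + 1 ≤ w by omega)
  set A := ∑ v ∈ Finset.Ioc (y + 1) w, ζ v with hA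
  set B := ∑ v ∈ Finset.Ioc (y + 1) Y, η v with hB
  have hsum : ∀ (f : Config) {u : ℤ}, y + 1 ≤ u → u ≤ w → ∑ v ∈ Finset.Ioc (y + 1) w, f v =
      ∑ v ∈ Finset.Ioc (y + 1) u, f v + ∑ v ∈ Finset.Ioc u w, f v := fun f u hu hu' => by
    rw [← Finset.sum_union (Finset.disjoint_left.2 fun v h1 h2 => by
      simp only [Finset.mem_Ioc] at h1 h2; omega), Finset.Ioc_union_Ioc_eq_Ioc hu hu']
  have h0 := h (y + 1) (by omega) (by omega)
  have hY := hsplit η (show y + 1 ≤ Y by omega)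
  have key := tandem_height_le (b := id) (b' := id) (y := y + 1) (η := ζ) (η' := truncate η Y)
    isCount_id isCount_id hτ (N := n)
    -- The surplus of `η` over `ζ` on `(y + 1, w]`, less `M`; nonnegative by `h0`. Passing to
    -- complements in `(y + 1, w]` turns the condition on initial heights into `h`.
    (C := (∑ v ∈ Finset.Ioc (y + 1) w, η v : ℕ) - (A : ℤ) - M)
    (fun k => by simp only [id]; omega) (fun i hi => by
      have g1 := hsum ζ (show y + 1 ≤ y + 1 + i by omega) (by omega)
      have g2 := hsum η (show y + 1 ≤ y + 1 + i by omega) (by omega)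
      rcases le_total (y + 1 + (i : ℤ)) Y with hiY | hiY
      · have g3 := h (y + 1 + i) (by omega) hiY
        rw [htr hiY]
        omega
      · have g3 := h Y hyY le_rfl
        have g4 := hsum (truncate η Y) (show y + 1 ≤ Y by omega) (by omega)
        have g5 := hsum ζ (show y + 1 ≤ Y by omega) (by omega)
        have g6 : ∑ v ∈ Finset.Ioc (y + 1) (y + 1 + (i : ℤ)), truncate η Y v =
            ∑ v ∈ Finset.Ioc (y + 1) Y, η v := by
          rw [← htr (u := y + 1) le_rfl,
            ← Finset.Ioc_union_Ioc_eq_Ioc (show y + 1 ≤ Y by omega) hiY, Finset.sum_union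
            (Finset.disjoint_left.2 fun v h1 h2 => by
              simp only [Finset.mem_Ioc] at h1 h2; omega), htr', add_zero]
        have g7 : ∑ v ∈ Finset.Ioc (y + 1) Y, ζ v ≤
            ∑ v ∈ Finset.Ioc (y + 1) (y + 1 + (i : ℤ)), ζ v :=
          Finset.sum_le_sum_of_subset (Finset.Ioc_subset_Ioc_right hiY)
        rw [g6]
        omega) le_rfl (rings τ w t)
  have g6 : ∑ v ∈ Finset.Ioc (y + 1) w, truncate η Y v = B := by
    rw [hsum (truncate η Y) (show y + 1 ≤ Y by omega) hYw, htr', add_zero, htr le_rfl]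
  have hc : (w - (y + 1)).toNat = n := by omega
  rw [hn, g6] at key
  simp only [current, hc] at h1 ⊢
  omega

/-- The current of the whole process is that of all sufficiently large finite systems. -/
theorem departures_eq (hτ : Regular τ) (η : Config) (x : ℤ) (t : ℝ) :
    ∃ z₀ < x, ∀ z ≤ z₀, departures η τ x t = current 0 η τ z x t := by
  have hB : ∀ (d : ℕ) (x : ℤ) (s : ℝ), departuresBefore η τ (d + 1) x s =
      tandem 0 η τ (x - (d + 1 : ℕ)) (d + 1) (ringsBefore τ x s) := by
    intro d
    induction d with
    | zero =>
      intro x s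
      simp only [departuresBefore, tandem]
      simp
    | succ d ih =>
      intro x s
      have e1 : x - ((d + 1 + 1 : ℕ) : ℤ) + ((d + 1 + 1 : ℕ) : ℤ) = x := by ring
      have e2 : x - ((d + 1 + 1 : ℕ) : ℤ) + ((d + 1 : ℕ) : ℤ) = x - 1 := by push_cast; ring
      have e3 : x - 1 - ((d + 1 : ℕ) : ℤ) = x - ((d + 1 + 1 : ℕ) : ℤ) := by push_cast; ring
      rw [departuresBefore, tandem, e1, e2]
      refine siteDepartures_congr rfl (fun k => ?_) _
      rw [ih, e3]
  have hU : ∀ d : ℕ, departuresUpTo η τ d x t = current 0 η τ (x - (d + 1 : ℕ)) x t := by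
    intro d
    have e1 : x - ((d + 1 : ℕ) : ℤ) + ((d + 1 : ℕ) : ℤ) = x := by ring
    have e2 : x - ((d + 1 : ℕ) : ℤ) + (d : ℤ) = x - 1 := by push_cast; ring
    have e4 : (x - (x - ((d + 1 : ℕ) : ℤ))).toNat = d + 1 := by omega
    rw [current, e4, departuresUpTo, tandem, e1, e2]
    refine siteDepartures_congr rfl (fun k => ?_) _
    cases d with
    | zero => simp [departuresBefore, tandem]
    | succ d =>
      have e3 : x - 1 - ((d + 1 : ℕ) : ℤ) = x - ((d + 1 + 1 : ℕ) : ℤ) := by push_cast; ring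
      rw [hB, e3]
  -- Using one more site on the left replaces the zero base count by an actual departure count.
  have hmono : Monotone fun d : ℕ => departuresUpTo η τ d x t := by
    refine monotone_nat_of_le_succ fun d => ?_
    rw [hU, hU, current_rebase (y := x - ((d + 1 + 1 : ℕ) : ℤ)) (Y := x - ((d + 1 : ℕ) : ℤ))
      (by push_cast; omega) (by push_cast; omega)]
    exact tandem_mono_base isCount_zero (isCount_zero.tandem _ _ _ _) hτ
      (fun k => Nat.zero_le _) _ _
  -- A monotone sequence of naturals bounded by the number of rings at `x` is eventually constant,
  -- so no silent site on the left has to be found.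
  obtain ⟨D, hD⟩ : ∃ D, ∀ d ≥ D, departuresUpTo η τ d x t = departuresUpTo η τ D x t := by
    have hbd : BddAbove (Set.range fun d : ℕ => departuresUpTo η τ d x t) :=
      ⟨rings τ x t, by
        rintro _ ⟨d, rfl⟩
        simp only [hU]
        exact current_le_rings isCount_zero⟩
    obtain ⟨D, hD⟩ := Nat.sSup_mem (Set.range_nonempty _) hbd
    refine ⟨D, fun d hd => le_antisymm ?_ (hmono hd)⟩
    exact (le_csSup hbd ⟨d, rfl⟩).trans hD.ge
  have hlim : departures η τ x t = departuresUpTo η τ D x t :=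
    (tendsto_atTop_of_eventually_const hD).limUnder_eq
  refine ⟨x - (D + 1 : ℕ), by push_cast; omega, fun z hz => ?_⟩
  obtain ⟨d, hd⟩ := Int.le.dest hz
  have e : z = x - ((D + d + 1 : ℕ) : ℤ) := by push_cast at hd ⊢; omega
  rw [hlim, e, ← hU, hD _ (Nat.le_add_right _ _)]

/-- The process agrees on each finite window with the occupation numbers of all sufficiently large
finite systems. -/
theorem process_eq (hτ : Regular τ) (η : Config) (x : ℤ) (t : ℝ) :
    ∃ z₀ < x, ∀ z ≤ z₀, (process η τ t x : ℤ) = occupation 0 η τ z x t := by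
  obtain ⟨z₁, h1, h1'⟩ := departures_eq hτ η x t
  obtain ⟨z₂, h2, h2'⟩ := departures_eq hτ η (x - 1) t
  refine ⟨min z₁ z₂, min_lt_of_left_lt h1, fun z hz => ?_⟩
  have h3 := h1' z (hz.trans (min_le_left _ _))
  have h4 := h2' z (hz.trans (min_le_right _ _))
  -- Departures do not exceed initial particles plus arrivals, so the subtraction in `process` is
  -- not truncated at `0`.
  have h5 := current_le_sub_one_add (t := t) (η := η) hτ isCount_zero
    (show z < x from (hz.trans (min_le_left _ _)).trans_lt h1)
  simp only [process, occupation, h3, h4]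
  omega

end

/-! ### Restarting a finite system at a positive time. -/

/-- The waiting times seen from time `h`, if the clock has rung `j` times up to time `h`. -/
def shiftWaits (h : ℝ) (j : ℕ) (w : ℕ → ℝ) : ℕ → ℝ :=
  fun k => if k = 0 then ∑ i ∈ Finset.range (j + 1), w i - h else w (k + j)

theorem sum_shiftWaits (h : ℝ) (j : ℕ) (w : ℕ → ℝ) (k : ℕ) :
    ∑ i ∈ Finset.range (k + 1), shiftWaits h j w i = ∑ i ∈ Finset.range (j + k + 1), w i - h := by
  induction k with
  | zero => simp [shiftWaits]
  | succ k ih =>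
    rw [Finset.sum_range_succ, ih, ← add_assoc, Finset.sum_range_succ _ (j + k + 1)]
    simp only [shiftWaits, Nat.succ_ne_zero, if_false]
    rw [show k + 1 + j = j + k + 1 by ring]
    ring

/-- The clocks seen from time `h`; only the clocks at the sites in `W` are shifted. -/
noncomputable def shiftClocks (W : Finset ℤ) (h : ℝ) (j : ℤ → ℕ) (τ : Clocks) : Clocks :=
  fun x => if x ∈ W then shiftWaits h (j x) (τ x) else τ x

/-- The clocks at the sites in `W` ring exactly `j` times up to time `h`. -/
def RingsExactly (W : Finset ℤ) (h : ℝ) (j : ℤ → ℕ) (τ : Clocks) : Prop :=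
  ∀ x ∈ W, (∀ i < j x, ringTime τ x i ≤ h) ∧ h < ringTime τ x (j x)

section Shift

variable {W : Finset ℤ} {h : ℝ} {j : ℤ → ℕ} {τ : Clocks}

theorem ringTime_shiftClocks {x : ℤ} (hx : x ∈ W) (k : ℕ) :
    ringTime (shiftClocks W h j τ) x k = ringTime τ x (j x + k) - h := by
  simp only [ringTime, shiftClocks, hx, if_true, sum_shiftWaits]

theorem Regular.shiftClocks (hτ : Regular τ) (hj : RingsExactly W h j τ) :
    Regular (shiftClocks W h j τ) := by
  intro x
  by_cases hx : x ∈ W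
  · constructor
    · intro k
      simp only [ZeroRange.shiftClocks, hx, if_true, shiftWaits]
      split_ifs with hk
      · exact sub_pos.2 (hj x hx).2
      · exact (hτ x).1 _
    · have : ringTime (ZeroRange.shiftClocks W h j τ) x = fun k => ringTime τ x (k + j x) + -h := by
        funext k; rw [ringTime_shiftClocks hx, add_comm, sub_eq_add_neg]
      rw [this]
      exact tendsto_atTop_add_const_right _ _ ((hτ x).2.comp (tendsto_add_atTop_nat _))
  · have hw : ZeroRange.shiftClocks W h j τ x = τ x := by simp [ZeroRange.shiftClocks, hx]
    refine ⟨fun k => by rw [hw]; exact (hτ x).1 k, ?_⟩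
    have : ringTime (ZeroRange.shiftClocks W h j τ) x = ringTime τ x := by
      funext k; simp only [ringTime, hw]
    rw [this]
    exact (hτ x).2

theorem ringsBefore_shiftClocks (hτ : Regular τ) (hj : RingsExactly W h j τ) {x : ℤ}
    (hx : x ∈ W) {s : ℝ} (hs : h < s) :
    ringsBefore τ x s = j x + ringsBefore (shiftClocks W h j τ) x (s - h) := by
  refine eq_of_forall_lt_iff fun k => ?_
  rw [hτ.lt_ringsBefore_iff]
  rcases lt_or_ge k (j x) with hk | hk
  · exact iff_of_true (((hj x hx).1 k hk).trans_lt hs) (by omega)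
  · obtain ⟨i, rfl⟩ := Nat.exists_eq_add_of_le hk
    rw [add_lt_add_iff_left, (hτ.shiftClocks hj).lt_ringsBefore_iff, ringTime_shiftClocks hx]
    exact (sub_lt_sub_iff_right h).symm

theorem rings_shiftClocks (hτ : Regular τ) (hj : RingsExactly W h j τ) {x : ℤ}
    (hx : x ∈ W) {s : ℝ} (hs : 0 ≤ s) :
    rings τ x (s + h) = j x + rings (shiftClocks W h j τ) x s := by
  refine eq_of_forall_lt_iff fun k => ?_
  rw [hτ.lt_rings_iff]
  rcases lt_or_ge k (j x) with hk | hk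
  · exact iff_of_true (((hj x hx).1 k hk).trans (by linarith)) (by omega)
  · obtain ⟨i, rfl⟩ := Nat.exists_eq_add_of_le hk
    rw [add_lt_add_iff_left, (hτ.shiftClocks hj).lt_rings_iff, ringTime_shiftClocks hx]
    exact sub_le_iff_le_add.symm

/-- The flow property of the dynamics. -/
theorem tandem_shiftClocks (hτ : Regular τ) (hj : RingsExactly W h j τ) {y : ℤ} {N : ℕ}
    (hW : ∀ x, x ∈ W ↔ y ≤ x ∧ x ≤ y + N) {ξ ξ' : Config} {D : ℕ → ℕ}
    (hD : ∀ n ≤ N, tandem id ξ τ y n (j (y + n)) = D n)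
    (hξ : ∀ n < N, ξ' (y + (n + 1 : ℕ)) + D (n + 1) = ξ (y + (n + 1 : ℕ)) + D n) {n : ℕ}
    (hn : n ≤ N) (k : ℕ) :
    tandem id ξ τ y n (j (y + n) + k) = D n + tandem id ξ' (shiftClocks W h j τ) y n k := by
  have hτ' := hτ.shiftClocks hj
  induction n generalizing k with
  | zero =>
    have := hD 0 (Nat.zero_le _)
    simp only [tandem, id] at this ⊢
    omega
  | succ n ih =>
    induction k with
    | zero => simpa [tandem_succ_zero] using hD (n + 1) hn
    | succ k ihk =>
      have hmem : y + (n : ℤ) ∈ W := (hW _).2 ⟨by omega, by omega⟩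
      have hmem' : y + ((n + 1 : ℕ) : ℤ) ∈ W := (hW _).2 ⟨by omega, by omega⟩
      -- This ring comes strictly after `h`, so the number of upstream rings before it splits into
      -- `j` rings up to `h` and those of the shifted clock.
      have hT : h < ringTime τ (y + ((n + 1 : ℕ) : ℤ)) (j (y + ((n + 1 : ℕ) : ℤ)) + k) :=
        (hj _ hmem').2.trans_le ((hτ.strictMono _).monotone (Nat.le_add_right _ _))
      have ih' := ih (by omega) (ringsBefore (shiftClocks W h j τ) (y + n)
        (ringTime τ (y + ((n + 1 : ℕ) : ℤ)) (j (y + ((n + 1 : ℕ) : ℤ)) + k) - h))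
      have hξ' := hξ n (by omega)
      rw [← add_assoc, tandem_succ_succ isCount_id hτ, tandem_succ_succ isCount_id hτ', ihk,
        ringsBefore_shiftClocks hτ hj hmem hT, ih', ringTime_shiftClocks hmem']
      omega

end Shift

/-! ### The finite system with a source, and the effect of at most one ring. -/

/-- The configuration at time `t` when there is a source at `y` and the sites `y + 1, …, y + N`
are used; the other sites do not change. -/
noncomputable def evolve (y : ℤ) (N : ℕ) (t : ℝ) (ξ : Config) (τ : Clocks) : Config :=
  fun z => if y < z ∧ z ≤ y + N then (occupation id ξ τ y z t).toNat else ξ z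

/-- The effect of a ring at `x` on the system with a source at `y` and sites `y + 1, …, y + N`. -/
def jump (y : ℤ) (N : ℕ) (x : ℤ) (ξ : Config) : Config := fun z =>
  if z = x then (if x = y then ξ z else ξ z - 1)
  else if z = x + 1 ∧ z ≤ y + N ∧ (x = y ∨ 0 < ξ x) then ξ z + 1 else ξ z

section Evolve

variable {τ : Clocks} {y : ℤ} {N : ℕ} {ξ : Config} {h s : ℝ}

theorem occupation_eq_evolve (hτ : Regular τ) {z : ℤ} (h1 : y < z) (h2 : z ≤ y + N) :
    (evolve y N s ξ τ z : ℤ) = occupation id ξ τ y z s := by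
  have h3 := current_le_sub_one_add (t := s) (η := ξ) hτ isCount_id h1
  have h4 : 0 ≤ occupation id ξ τ y z s := by
    simp only [occupation]; omega
  simp only [evolve, h1, h2, and_self, if_true]
  omega

theorem evolve_zero (hτ : Regular τ) : evolve y N 0 ξ τ = ξ := by
  have hr : ∀ x, rings τ x 0 = 0 := fun x => by
    by_contra hne
    have := (hτ.lt_rings_iff x 0 0).1 (Nat.pos_of_ne_zero hne)
    have h0 := (hτ x).1 0
    simp only [ringTime, zero_add, Finset.sum_range_one] at this
    linarith
  funext z
  simp only [evolve, occupation, current, hr, (isCount_id.tandem ξ τ y _).zero]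
  split_ifs <;> simp

/-- `D n` counts the departures from `y + n` up to time `h`, and `hξ` is conservation at each site,
so `ξ'` is the configuration at time `h`. The instances with no ring or one ring suffice for
invariance, since several rings have probability `O(h ^ 2)`. -/
theorem evolve_shift {W : Finset ℤ} {j : ℤ → ℕ} (hτ : Regular τ) (hj : RingsExactly W h j τ)
    (hW : ∀ x, x ∈ W ↔ y ≤ x ∧ x ≤ y + N) {ξ' : Config} {D : ℕ → ℕ}
    (hD : ∀ n ≤ N, tandem id ξ τ y n (j (y + n)) = D n)
    (hξ : ∀ n < N, ξ' (y + (n + 1 : ℕ)) + D (n + 1) = ξ (y + (n + 1 : ℕ)) + D n)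
    (hξ' : ∀ z, ¬ (y < z ∧ z ≤ y + N) → ξ' z = ξ z) (hs : 0 ≤ s) :
    evolve y N (s + h) ξ τ = evolve y N s ξ' (shiftClocks W h j τ) := by
  have hc : ∀ n ≤ N, current id ξ τ y (y + n) (s + h) =
      D n + current id ξ' (shiftClocks W h j τ) y (y + n) s := fun n hn => by
    rw [current_add, current_add, rings_shiftClocks hτ hj ((hW _).2 ⟨by omega, by omega⟩) hs,
      tandem_shiftClocks hτ hj hW hD hξ hn]
  funext z
  simp only [evolve]
  split_ifs with hz
  · obtain ⟨n, rfl⟩ := Int.le.dest (show y + 1 ≤ z by omega)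
    have e : y + 1 + (n : ℤ) = y + ((n + 1 : ℕ) : ℤ) := by push_cast; ring
    have e' : y + ((n + 1 : ℕ) : ℤ) - 1 = y + n := by push_cast; ring
    rw [e] at *
    have h1 := hξ n (by omega)
    simp only [occupation, e', hc n (by omega), hc (n + 1) (by omega)]
    congr 1
    omega
  · exact (hξ' z hz).symm

theorem evolve_shift_no_ring {W : Finset ℤ} (hτ : Regular τ)
    (hW : ∀ x, x ∈ W ↔ y ≤ x ∧ x ≤ y + N) (hj : RingsExactly W h 0 τ) (hs : 0 ≤ s) :
    evolve y N (s + h) ξ τ = evolve y N s ξ (shiftClocks W h 0 τ) :=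
  evolve_shift (D := 0) hτ hj hW (fun n _ => (isCount_id.tandem ξ τ y n).zero)
    (fun _ _ => rfl) (fun _ _ => rfl) hs

theorem evolve_shift_one_ring {W : Finset ℤ} {x : ℤ} (hτ : Regular τ)
    (hW : ∀ x, x ∈ W ↔ y ≤ x ∧ x ≤ y + N) (hx : x ∈ W)
    (hj : RingsExactly W h (Pi.single x 1) τ) (hs : 0 ≤ s) :
    evolve y N (s + h) ξ τ =
      evolve y N s (jump y N x ξ) (shiftClocks W h (Pi.single x 1) τ) := by
  have hx' := (hW x).1 hx
  -- Only the ringing site can lose a particle: the source always does, another site does when it is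
  -- occupied.
  refine evolve_shift (D := fun n => if y + n = x then (if x = y then 1 else min 1 (ξ x)) else 0)
    hτ hj hW (fun n hn => ?_) (fun n hn => ?_) (fun z hz => ?_) hs
  · by_cases hnx : y + (n : ℤ) = x
    · simp only [hnx, if_true, Pi.single_eq_same]
      cases n with
      | zero =>
        have : x = y := by simpa using hnx.symm
        simp [this, tandem]
      | succ n =>
        have hne : x ≠ y := by omega
        have hmem : y + (n : ℤ) ∈ W := (hW _).2 ⟨by omega, by omega⟩
        -- The upstream clock is silent up to `h`, so nothing has arrived before this ring.
        have hr : ringsBefore τ (y + n) (ringTime τ (y + ((n + 1 : ℕ) : ℤ)) 0) = 0 := by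
          by_contra hne'
          have h1 := (hτ.lt_ringsBefore_iff _ _ _).1 (Nat.pos_of_ne_zero hne')
          have h2 := (hj x hx).1 0 (by simp)
          have h3 := (hj _ hmem).2
          rw [Pi.single_eq_of_ne (by omega)] at h3
          rw [hnx] at h1
          linarith
        rw [tandem_succ_succ isCount_id hτ, tandem_succ_zero, hr,
          (isCount_id.tandem ξ τ y n).zero, hnx, if_neg hne]
        simp
    · rw [Pi.single_eq_of_ne hnx, (isCount_id.tandem ξ τ y n).zero, if_neg hnx]
  · simp only [jump]
    rcases lt_trichotomy (y + (n : ℤ) + 1) x with hlt | heq | hgt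
    · rw [if_neg (by omega), if_neg (by omega), if_neg (by omega), if_neg (by omega)]
    · subst heq
      have e : y + ((n + 1 : ℕ) : ℤ) = y + (n : ℤ) + 1 := by push_cast; ring
      rw [e, if_pos rfl, if_pos rfl, if_neg (by omega), if_neg (by omega), if_neg (by omega)]
      omega
    · by_cases hnx : y + (n : ℤ) = x
      · subst hnx
        rw [if_neg (by omega)]
        by_cases hn0 : n = 0
        · subst hn0
          simp
          omega
        · have hne : y + (n : ℤ) ≠ y := by omega
          simp only [hne, if_false, false_or, if_true]
          rcases Nat.eq_zero_or_pos (ξ (y + n)) with h0 | h0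
          · rw [h0, if_neg (by omega), if_neg (by omega)]; simp
          · rw [if_pos (by omega), if_neg (by omega)]; omega
      · rw [if_neg (by omega), if_neg (by omega), if_neg (by omega), if_neg (by omega)]
  · simp only [jump]
    by_cases hzx : z = x
    · subst hzx; rw [if_pos rfl, if_pos (by omega)]
    · rw [if_neg hzx, if_neg (by omega)]

/-- Conservation of particles. -/
theorem current_add_sum_evolve (hτ : Regular τ) {n : ℕ} (hn : n ≤ N) :
    current id ξ τ y (y + n) s + ∑ z ∈ Finset.Ioc y (y + n), evolve y N s ξ τ z =
      rings τ y s + ∑ z ∈ Finset.Ioc y (y + n), ξ z := by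
  induction n with
  | zero => simp [current_self]
  | succ n ih =>
    have ih := ih (by omega)
    have e' : y + ((n + 1 : ℕ) : ℤ) - 1 = y + n := by push_cast; ring
    have h1 := occupation_eq_evolve (ξ := ξ) (s := s) (N := N) hτ
      (show y < y + ((n + 1 : ℕ) : ℤ) by omega) (by omega)
    simp only [occupation, e'] at h1
    rw [sum_Ioc_add_one, sum_Ioc_add_one]
    omega

end Evolve

/-! ### Exponential waiting times: restriction, shift and scaling of product laws. -/

/-- Restriction to a finite-dimensional box and a coordinatewise map both factor over a product
measure. After division by the nonzero constant, uniqueness of the product measure concludes. It is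
applied to one clock, to all clocks, and to the geometric product measure. -/
theorem infinitePi_restrict_map {ι : Type*} {X Y : ι → Type*} [∀ i, MeasurableSpace (X i)]
    [∀ i, MeasurableSpace (Y i)] (μ : ∀ i, Measure (X i)) [∀ i, IsProbabilityMeasure (μ i)]
    (ν : ∀ i, Measure (Y i)) [∀ i, IsProbabilityMeasure (ν i)] (W : Finset ι)
    {S : ∀ i, Set (X i)} (hS : ∀ i, MeasurableSet (S i)) {g : ∀ i, X i → Y i}
    (hg : ∀ i, Measurable (g i)) {c : ι → ℝ≥0∞}
    (hW : ∀ i ∈ W, ((μ i).restrict (S i)).map (g i) = c i • ν i)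
    (hW' : ∀ i ∉ W, (μ i).map (g i) = ν i) (hc0 : ∀ i ∈ W, c i ≠ 0) :
    ((Measure.infinitePi μ).restrict (Set.pi W S)).map (fun τ i => g i (τ i)) =
      (∏ i ∈ W, c i) • Measure.infinitePi ν := by
  classical
  have hmS : MeasurableSet (Set.pi (W : Set ι) S) := .pi W.countable_toSet fun i _ => hS i
  have hmg : Measurable fun (τ : ∀ i, X i) i => g i (τ i) := by fun_prop
  have hctop : ∀ i ∈ W, c i ≠ ∞ := fun i hi h => by
    have := congrArg (fun m => m Set.univ) (hW i hi)
    rw [Measure.map_apply (hg i) .univ] at this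
    simp only [h, Measure.smul_apply, measure_univ, smul_eq_mul, mul_one] at this
    exact measure_ne_top _ _ this
  have hp0 : ∏ i ∈ W, c i ≠ 0 := Finset.prod_ne_zero_iff.2 hc0
  have hptop : ∏ i ∈ W, c i ≠ ∞ := ENNReal.prod_ne_top hctop
  have key : (∏ i ∈ W, c i)⁻¹ •
      ((Measure.infinitePi μ).restrict (Set.pi W S)).map (fun τ i => g i (τ i)) =
        Measure.infinitePi ν := by
    refine Measure.eq_infinitePi ν fun s t ht => ?_
    have hmt : MeasurableSet (Set.pi (s : Set ι) t) := .pi s.countable_toSet fun i _ => ht i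
    set t' : ∀ i, Set (Y i) := fun i => if i ∈ s then t i else Set.univ with ht'
    have hmt' : ∀ i, MeasurableSet (t' i) := fun i => by
      simp only [ht']; split_ifs; exacts [ht i, .univ]
    have hset : (fun (τ : ∀ i, X i) i => g i (τ i)) ⁻¹' (Set.pi s t) ∩ Set.pi W S =
        Set.pi ((s ∪ W : Finset ι) : Set ι)
          (fun i => g i ⁻¹' (t' i) ∩ (if i ∈ W then S i else Set.univ)) := by
      ext τ
      simp only [Set.mem_inter_iff, Set.mem_preimage, Set.mem_pi, Finset.mem_coe, ht',
        Finset.mem_union]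
      constructor
      · rintro ⟨h1, h2⟩ i -
        refine ⟨?_, ?_⟩
        · split_ifs with hi
          exacts [h1 i hi, trivial]
        · split_ifs with hi
          exacts [h2 i hi, trivial]
      · intro h
        refine ⟨fun i hi => ?_, fun i hi => ?_⟩
        · simpa [hi] using (h i (Or.inl hi)).1
        · simpa [hi] using (h i (Or.inr hi)).2
    have hfac : ∀ i, μ i (g i ⁻¹' (t' i) ∩ (if i ∈ W then S i else Set.univ)) =
        (if i ∈ W then c i else 1) * ν i (t' i) := fun i => by
      split_ifs with hi
      · have := congrArg (fun m => m (t' i)) (hW i hi)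
        rw [Measure.map_apply (hg i) (hmt' i), Measure.restrict_apply ((hg i) (hmt' i))] at this
        simpa using this
      · rw [← hW' i hi, Measure.map_apply (hg i) (hmt' i)]; simp
    rw [Measure.smul_apply, Measure.map_apply hmg hmt, Measure.restrict_apply (hmg hmt), hset,
      Measure.infinitePi_pi _ (fun i _ => ((hg i) (hmt' i)).inter (by
        split_ifs; exacts [hS i, .univ])), Finset.prod_congr rfl (fun i _ => hfac i),
      Finset.prod_mul_distrib]
    have e1 : ∏ i ∈ s ∪ W, (if i ∈ W then c i else 1) = ∏ i ∈ W, c i := by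
      rw [Finset.prod_ite_mem]
      congr 1
      ext i; simp
    have e2 : ∏ i ∈ s ∪ W, ν i (t' i) = ∏ i ∈ s, ν i (t i) := by
      have : ∀ i, ν i (t' i) = if i ∈ s then ν i (t i) else 1 := fun i => by
        simp only [ht']; split_ifs <;> simp
      simp only [this]
      rw [Finset.prod_ite_mem]
      congr 1
      ext i; simp
    rw [e1, e2, smul_eq_mul, ← mul_assoc, ENNReal.inv_mul_cancel hp0 hptop, one_mul]
  rw [← key, smul_smul, ENNReal.mul_inv_cancel hp0 hptop, one_smul]

theorem expMeasure_Ioi {r : ℝ} (hr : 0 < r) (a : ℝ) :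
    expMeasure r (Set.Ioi a) = ENNReal.ofReal (Real.exp (-(r * max a 0))) := by
  have := isProbabilityMeasure_expMeasure hr
  rw [← Set.compl_Iic, prob_compl_eq_one_sub measurableSet_Iic, ← ofReal_cdf,
    cdf_expMeasure_eq hr, ← ENNReal.ofReal_one, ← ENNReal.ofReal_sub]
  · congr 1
    split_ifs with h
    · rw [max_eq_left h]; ring
    · rw [max_eq_right (by linarith)]; simp
  · split_ifs with h
    · simp only [sub_nonneg, Real.exp_le_one_iff]
      nlinarith
    · exact le_rfl

theorem measure_eq_of_Ioi {μ ν : Measure ℝ} [IsFiniteMeasure μ] [IsFiniteMeasure ν]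
    (huniv : μ Set.univ = ν Set.univ) (h : ∀ a, μ (Set.Ioi a) = ν (Set.Ioi a)) : μ = ν := by
  refine ext_of_generate_finite _ (BorelSpace.measurable_eq.trans (borel_eq_generateFrom_Ioi ℝ))
    isPiSystem_Ioi ?_ huniv
  rintro _ ⟨a, rfl⟩
  exact h a

theorem expMeasure_restrict_map_sub {r h : ℝ} (hr : 0 < r) (hh : 0 ≤ h) :
    ((expMeasure r).restrict (Set.Ioi h)).map (fun x => x - h) =
      ENNReal.ofReal (Real.exp (-(r * h))) • expMeasure r := by
  have := isProbabilityMeasure_expMeasure hr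
  have hm : Measurable fun x : ℝ => x - h := by fun_prop
  have : IsFiniteMeasure (ENNReal.ofReal (Real.exp (-(r * h))) • expMeasure r) :=
    Measure.smul_finite _ ENNReal.ofReal_ne_top
  refine measure_eq_of_Ioi ?_ fun a => ?_
  · rw [Measure.map_apply hm .univ]
    simp [expMeasure_Ioi hr, max_eq_left hh]
  · rw [Measure.map_apply hm measurableSet_Ioi, Measure.restrict_apply (hm measurableSet_Ioi)]
    have : (fun x : ℝ => x - h) ⁻¹' Set.Ioi a ∩ Set.Ioi h = Set.Ioi (h + max a 0) := by
      ext x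
      simp only [Set.mem_inter_iff, Set.mem_preimage, Set.mem_Ioi]
      rcases le_total a 0 with ha | ha
      · rw [max_eq_right ha]; constructor
        · rintro ⟨h1, h2⟩; linarith
        · intro h1; constructor <;> linarith
      · rw [max_eq_left ha]; constructor
        · rintro ⟨h1, h2⟩; linarith
        · intro h1; constructor <;> linarith
    rw [this, expMeasure_Ioi hr, Measure.smul_apply, expMeasure_Ioi hr, smul_eq_mul,
      ← ENNReal.ofReal_mul (Real.exp_nonneg _), ← Real.exp_add,
      max_eq_left (add_nonneg hh (le_max_right a 0))]
    congr 2; ring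

/-- Rescaling turns the clock of one site into a source of any rate while the other clocks stay as
they are. -/
theorem expMeasure_map_mul {r s : ℝ} (hr : 0 < r) (hs : 0 < s) :
    (expMeasure r).map (fun x => r / s * x) = expMeasure s := by
  have := isProbabilityMeasure_expMeasure hr
  have := isProbabilityMeasure_expMeasure hs
  have hm : Measurable fun x : ℝ => r / s * x := by fun_prop
  have := Measure.isProbabilityMeasure_map (μ := expMeasure r) hm.aemeasurable
  refine measure_eq_of_Ioi (by simp) fun a => ?_
  rw [Measure.map_apply hm measurableSet_Ioi]
  have : (fun x : ℝ => r / s * x) ⁻¹' Set.Ioi a = Set.Ioi (a * s / r) := by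
    ext x
    simp only [Set.mem_preimage, Set.mem_Ioi]
    rw [div_lt_iff₀ hr, div_mul_eq_mul_div, lt_div_iff₀ hs, mul_comm x r]
  rw [this, expMeasure_Ioi hr, expMeasure_Ioi hs]
  congr 2
  rcases le_total a 0 with ha | ha
  · rw [max_eq_right ha, max_eq_right (div_nonpos_of_nonpos_of_nonneg
      (mul_nonpos_of_nonpos_of_nonneg ha hs.le) hr.le)]; simp
  · rw [max_eq_left ha, max_eq_left (by positivity)]; field_simp

/-- The law of a sequence of independent waiting times of rate `r`. -/
noncomputable def waitLaw (r : ℝ) : Measure (ℕ → ℝ) := Measure.infinitePi fun _ => expMeasure r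

theorem isProbabilityMeasure_waitLaw {r : ℝ} (hr : 0 < r) : IsProbabilityMeasure (waitLaw r) := by
  have := isProbabilityMeasure_expMeasure hr
  unfold waitLaw; infer_instance

theorem measurable_shiftWaits (h : ℝ) (j : ℕ) : Measurable (shiftWaits h j) := by
  refine measurable_pi_lambda _ fun k => ?_
  unfold shiftWaits
  split_ifs <;> fun_prop

theorem waitLaw_no_ring {r h : ℝ} (hr : 0 < r) (hh : 0 ≤ h) :
    ((waitLaw r).restrict {w | h < w 0}).map (shiftWaits h 0) =
      ENNReal.ofReal (Real.exp (-(r * h))) • waitLaw r := by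
  have := isProbabilityMeasure_expMeasure hr
  have key := infinitePi_restrict_map (fun _ : ℕ => expMeasure r) (fun _ : ℕ => expMeasure r) {0}
    (S := fun _ => Set.Ioi h) (fun _ => measurableSet_Ioi)
    (g := fun i x => if i = 0 then x - h else x)
    (fun i => by split_ifs <;> fun_prop) (c := fun _ => ENNReal.ofReal (Real.exp (-(r * h))))
    (fun i hi => by
      have : i = 0 := by simpa using hi
      simp only [this, if_true]
      exact expMeasure_restrict_map_sub hr hh)
    (fun i hi => by
      have : i ≠ 0 := by simpa using hi
      simp [this])
    (fun i _ => by simpa using Real.exp_pos _)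
  have e1 : Set.pi (({0} : Finset ℕ) : Set ℕ) (fun _ => Set.Ioi h) = {w : ℕ → ℝ | h < w 0} := by
    ext w; simp
  have e2 : (fun (w : ℕ → ℝ) i => if i = 0 then w i - h else w i) = shiftWaits h 0 := by
    funext w i
    simp only [shiftWaits]
    split_ifs with hi <;> simp [hi]
  rw [e1, e2, Finset.prod_singleton] at key
  exact key

/-- Prepend a waiting time. -/
def consWait (q : ℝ × (ℕ → ℝ)) : ℕ → ℝ := fun k => Nat.casesOn k q.1 q.2

theorem measurable_consWait : Measurable consWait := by
  refine measurable_pi_lambda _ fun k => ?_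
  cases k with
  | zero => exact measurable_fst
  | succ k => exact (measurable_pi_apply k).comp measurable_snd

/-- The first waiting time is independent of the rest, which permits conditioning on the first ring.
-/
theorem map_consWait {r : ℝ} (hr : 0 < r) :
    ((expMeasure r).prod (waitLaw r)).map consWait = waitLaw r := by
  classical
  have := isProbabilityMeasure_expMeasure hr
  have := isProbabilityMeasure_waitLaw hr
  refine Measure.eq_infinitePi _ fun s t ht => ?_
  obtain ⟨n, hn⟩ := s.exists_nat_subset_range
  set t' : ℕ → Set ℝ := fun i => if i ∈ s then t i else Set.univ with ht'
  have hmt' : ∀ i, MeasurableSet (t' i) := fun i => by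
    simp only [ht']; split_ifs; exacts [ht i, .univ]
  have hset : consWait ⁻¹' (Set.pi (s : Set ℕ) t) =
      t' 0 ×ˢ Set.pi (Finset.range n : Set ℕ) (fun i => t' (i + 1)) := by
    ext ⟨a, w⟩
    simp only [Set.mem_preimage, Set.mem_pi, Finset.mem_coe, Set.mem_prod, ht']
    constructor
    · intro h
      refine ⟨?_, fun i _ => ?_⟩
      · split_ifs with h0
        exacts [h 0 h0, trivial]
      · split_ifs with h0
        exacts [h (i + 1) h0, trivial]
    · rintro ⟨h0, h1⟩ i hi
      cases i with
      | zero =>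
        rw [if_pos hi] at h0
        exact h0
      | succ i =>
        have := h1 i (Finset.mem_coe.2 (Finset.mem_range.2
          ((Nat.lt_succ_self i).trans (Finset.mem_range.1 (hn hi)))))
        rw [if_pos hi] at this
        exact this
  rw [Measure.map_apply measurable_consWait (.pi s.countable_toSet fun i _ => ht i), hset,
    Measure.prod_prod, waitLaw, Measure.infinitePi_pi _ (fun i _ => hmt' _), mul_comm,
    ← Finset.prod_range_succ' (fun i => expMeasure r (t' i))]
  have : ∀ i, expMeasure r (t' i) = if i ∈ s then expMeasure r (t i) else 1 := fun i => by
    simp only [ht']; split_ifs <;> simp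
  simp only [this]
  rw [Finset.prod_ite_mem, Finset.inter_eq_right.2 (hn.trans (Finset.range_subset_range.2
    (Nat.le_succ n)))]

/-- The integrand times the density is the constant `r * exp (-(r * h))` on `[0, h]`; this is the
probability of exactly one ring. -/
theorem lintegral_exp_Iic {r h : ℝ} (hr : 0 < r) :
    ∫⁻ a in Set.Iic h, ENNReal.ofReal (Real.exp (-(r * (h - a)))) ∂(expMeasure r) =
      ENNReal.ofReal (r * h * Real.exp (-(r * h))) := by
  have hd : expMeasure r = volume.withDensity (exponentialPDF r) := rfl
  have hme : Measurable fun a => ENNReal.ofReal (Real.exp (-(r * (h - a)))) := by fun_prop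
  rw [hd, ← lintegral_indicator measurableSet_Iic, lintegral_withDensity_eq_lintegral_mul _
    (show Measurable (exponentialPDF r) from
      (measurable_exponentialPDFReal r).ennreal_ofReal) (hme.indicator measurableSet_Iic)]
  have : (exponentialPDF r * (Set.Iic h).indicator
        fun a => ENNReal.ofReal (Real.exp (-(r * (h - a))))) =
      (Set.Icc 0 h).indicator fun _ => ENNReal.ofReal (r * Real.exp (-(r * h))) := by
    funext a
    by_cases h1 : a ≤ h
    · by_cases h0 : 0 ≤ a
      · rw [Pi.mul_apply, Set.indicator_of_mem (show a ∈ Set.Iic h from h1),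
          Set.indicator_of_mem (show a ∈ Set.Icc 0 h from ⟨h0, h1⟩),
          exponentialPDF_of_nonneg h0, ← ENNReal.ofReal_mul (by positivity), mul_assoc,
          ← Real.exp_add]
        congr 3; ring
      · rw [Pi.mul_apply, exponentialPDF_of_neg (not_le.1 h0), zero_mul,
          Set.indicator_of_notMem (fun hm => h0 hm.1)]
    · rw [Pi.mul_apply, Set.indicator_of_notMem (show a ∉ Set.Iic h from h1), mul_zero,
        Set.indicator_of_notMem (fun hm => h1 hm.2)]
  rw [this, lintegral_indicator measurableSet_Icc]
  simp only [lintegral_const, MeasurableSet.univ, Measure.restrict_apply, Set.univ_inter,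
    Real.volume_Icc, sub_zero]
  rw [← ENNReal.ofReal_mul (by positivity)]
  congr 1; ring

/-- Given the first ring at `a ≤ h`, the remaining sequence must have no ring up to `h - a`;
`waitLaw_no_ring` is applied to it and integrated over `a`. -/
theorem waitLaw_one_ring {r h : ℝ} (hr : 0 < r) :
    ((waitLaw r).restrict {w | w 0 ≤ h ∧ h < w 0 + w 1}).map (shiftWaits h 1) =
      ENNReal.ofReal (r * h * Real.exp (-(r * h))) • waitLaw r := by
  have := isProbabilityMeasure_expMeasure hr
  have := isProbabilityMeasure_waitLaw hr
  have hmS : MeasurableSet {w : ℕ → ℝ | w 0 ≤ h ∧ h < w 0 + w 1} :=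
    MeasurableSet.inter
      (measurableSet_le (f := fun w : ℕ → ℝ => w 0) (by fun_prop) measurable_const)
      (measurableSet_lt (g := fun w : ℕ → ℝ => w 0 + w 1) measurable_const (by fun_prop))
  ext B hB
  have hmB := measurable_shiftWaits h 1 hB
  rw [Measure.map_apply (measurable_shiftWaits h 1) hB, Measure.restrict_apply hmB,
    Measure.smul_apply, ← map_consWait hr, Measure.map_apply measurable_consWait
    (hmB.inter hmS), Measure.prod_apply (measurable_consWait (hmB.inter hmS)), map_consWait hr,
    ← lintegral_exp_Iic hr, smul_eq_mul, ← lintegral_mul_const _ (by fun_prop),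
    ← lintegral_indicator measurableSet_Iic]
  refine lintegral_congr fun a => ?_
  by_cases ha : a ≤ h
  · rw [Set.indicator_of_mem (show a ∈ Set.Iic h from ha)]
    have h1 := congrArg (fun m => m B) (waitLaw_no_ring hr (sub_nonneg.2 ha))
    rw [Measure.map_apply (measurable_shiftWaits _ 0) hB,
      Measure.restrict_apply (measurable_shiftWaits _ 0 hB)] at h1
    rw [Measure.smul_apply, smul_eq_mul] at h1
    rw [← h1]
    congr 1
    ext w
    have e : shiftWaits h 1 (consWait (a, w)) = shiftWaits (h - a) 0 w := by
      funext k
      simp only [shiftWaits]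
      split_ifs with hk
      · simp [Finset.sum_range_succ, consWait]; ring
      · rfl
    simp only [Set.mem_preimage, Set.mem_inter_iff, Set.mem_ofPred_eq, e]
    have e0 : consWait (a, w) 0 = a := rfl
    have e1 : consWait (a, w) 1 = w 0 := rfl
    rw [e0, e1, sub_lt_iff_lt_add']
    simp [ha]
  · rw [Set.indicator_of_notMem (show a ∉ Set.Iic h from ha)]
    refine measure_mono_null (t := ∅) (fun w hw => ?_) measure_empty
    exact ha hw.2.1

/-! ### Almost sure regularity and the law of large numbers for the clocks. -/

theorem ae_expMeasure_pos {r : ℝ} (hr : 0 < r) : ∀ᵐ x ∂(expMeasure r), 0 < x := by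
  have := isProbabilityMeasure_expMeasure hr
  have h : expMeasure r (Set.Ioi 0) = 1 := by rw [expMeasure_Ioi hr]; simp
  exact (prob_compl_eq_zero_iff measurableSet_Ioi).2 h

theorem integrable_id_expMeasure {r : ℝ} (hr : 0 < r) :
    Integrable (fun x => x) (expMeasure r) ∧ ∫ x, x ∂(expMeasure r) = 1 / r := by
  have := isProbabilityMeasure_expMeasure hr
  have hnn : 0 ≤ᵐ[expMeasure r] fun x => x := (ae_expMeasure_pos hr).mono fun x hx => hx.le
  have hint := integral_exp_mul_Ioi (neg_neg_of_pos hr) 0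
  have h1 : ∫⁻ x, ENNReal.ofReal x ∂(expMeasure r) = ENNReal.ofReal (1 / r) := by
    rw [lintegral_eq_lintegral_meas_lt _ hnn (by fun_prop)]
    have : ∀ t ∈ Set.Ioi (0 : ℝ), expMeasure r {a | t < a} =
        ENNReal.ofReal (Real.exp (-r * t)) := fun t ht => by
      have := expMeasure_Ioi hr t
      rw [max_eq_left (Set.mem_Ioi.1 ht).le] at this
      rw [neg_mul]
      exact this
    rw [setLIntegral_congr_fun measurableSet_Ioi this,
      ← ofReal_integral_eq_lintegral_ofReal (integrableOn_exp_mul_Ioi (neg_neg_of_pos hr) 0)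
        (ae_of_all _ fun _ => (Real.exp_pos _).le), hint]
    simp
  have hi : Integrable (fun x => x) (expMeasure r) := by
    refine ⟨by fun_prop, ?_⟩
    rw [hasFiniteIntegral_iff_ofReal hnn, h1]
    exact ENNReal.ofReal_lt_top
  refine ⟨hi, ?_⟩
  rw [integral_eq_lintegral_of_nonneg_ae hnn (by fun_prop), h1,
    ENNReal.toReal_ofReal (by positivity)]

theorem waitLaw_strong_law {r : ℝ} (hr : 0 < r) :
    ∀ᵐ w : ℕ → ℝ ∂(waitLaw r), Tendsto (fun n : ℕ => (∑ i ∈ Finset.range n, w i) / (n : ℝ)) atTop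
      (𝓝 (1 / r)) := by
  have := isProbabilityMeasure_expMeasure hr
  have := isProbabilityMeasure_waitLaw hr
  have hmp : ∀ i, MeasurePreserving (Function.eval i) (waitLaw r) (expMeasure r) := fun i =>
    measurePreserving_eval_infinitePi (fun _ : ℕ => expMeasure r) i
  have hmap : ∀ i, (waitLaw r).map (fun w => w i) = expMeasure r := fun i => (hmp i).map_eq
  have hE : ∫ w, w 0 ∂(waitLaw r) = 1 / r := by
    rw [← (integrable_id_expMeasure hr).2, ← hmap 0,
      integral_map (measurable_pi_apply 0).aemeasurable (by fun_prop)]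
  have hI : Integrable (fun w : ℕ → ℝ => w 0) (waitLaw r) :=
    (hmp 0).integrable_comp_of_integrable (integrable_id_expMeasure hr).1
  have hind : iIndepFun (fun (i : ℕ) (w : ℕ → ℝ) => w i) (waitLaw r) :=
    iIndepFun_infinitePi (P := fun _ : ℕ => expMeasure r) (X := fun _ x => x)
      (fun _ => measurable_id)
  have := strong_law_ae_real (μ := waitLaw r) (fun i w => w i) hI
    (fun i j hij => hind.indepFun hij)
    (fun i => ⟨(measurable_pi_apply i).aemeasurable, (measurable_pi_apply 0).aemeasurable,
      by rw [hmap, hmap]⟩)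
  rwa [hE] at this

theorem waitLaw_ae_pos {r : ℝ} (hr : 0 < r) : ∀ᵐ w ∂(waitLaw r), ∀ k, 0 < w k := by
  have := isProbabilityMeasure_expMeasure hr
  exact ae_all_iff.2 fun k => (measurePreserving_eval_infinitePi
    (fun _ : ℕ => expMeasure r) k).quasiMeasurePreserving.ae (ae_expMeasure_pos hr)

theorem measurePreserving_clock (p : Environment) (x : ℤ) :
    MeasurePreserving (fun τ : Clocks => τ x) (clockMeasure p) (waitLaw (p.rate x)) := by
  have : ∀ x, IsProbabilityMeasure (waitLaw (p.rate x)) := fun x =>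
    isProbabilityMeasure_waitLaw (p.rate_pos x)
  exact measurePreserving_eval_infinitePi (fun x => waitLaw (p.rate x)) x

theorem tendsto_sum_atTop {r : ℝ} (hr : 0 < r) {w : ℕ → ℝ}
    (h : Tendsto (fun n : ℕ => (∑ i ∈ Finset.range n, w i) / n) atTop (𝓝 (1 / r))) :
    Tendsto (fun k : ℕ => ∑ i ∈ Finset.range (k + 1), w i) atTop atTop := by
  have h1 := h.pos_mul_atTop (by positivity) (tendsto_natCast_atTop_atTop (R := ℝ))
  refine (tendsto_add_atTop_iff_nat (f := fun k : ℕ => ∑ i ∈ Finset.range k, w i) 1).2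
    (h1.congr' ?_)
  filter_upwards [eventually_gt_atTop 0] with n hn
  field_simp

theorem ae_regular (p : Environment) : ∀ᵐ τ ∂(clockMeasure p), Regular τ := by
  refine ae_all_iff.2 fun x => ?_
  filter_upwards [(measurePreserving_clock p x).quasiMeasurePreserving.ae
      (waitLaw_ae_pos (p.rate_pos x)), (measurePreserving_clock p x).quasiMeasurePreserving.ae
      (waitLaw_strong_law (p.rate_pos x))] with τ h1 h2
  exact ⟨h1, tendsto_sum_atTop (p.rate_pos x) h2⟩

/-- The number of rings up to time `t` of a clock with waiting times `w`. -/
noncomputable def count (w : ℕ → ℝ) (t : ℝ) : ℕ :=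
  {k : ℕ | ∑ i ∈ Finset.range (k + 1), w i ≤ t}.ncard

theorem measurable_count (t : ℝ) : Measurable fun w => count w t :=
  measurable_ncard.comp (measurable_set_iff.2 fun k =>
    measurableSet_setOfPred.1 (measurableSet_le
      (f := fun w : ℕ → ℝ => ∑ i ∈ Finset.range (k + 1), w i) (by fun_prop) measurable_const))

/-- Inversion of the strong law: `t` lies between the partial sums with `count w t` and `count w t +
1` terms, which squeezes `t / count w t`. -/
theorem tendsto_count_div {r : ℝ} (hr : 0 < r) {w : ℕ → ℝ} (hw : ∀ k, 0 < w k)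
    (h : Tendsto (fun n : ℕ => (∑ i ∈ Finset.range n, w i) / n) atTop (𝓝 (1 / r))) :
    Tendsto (fun t : ℝ => (count w t : ℝ) / t) atTop (𝓝 r) := by
  set u : ℕ → ℝ := fun n => ∑ i ∈ Finset.range n, w i with hu
  have hreg : Regular fun _ : ℤ => w := fun _ => ⟨hw, tendsto_sum_atTop hr h⟩
  have hlt : ∀ t k, k < count w t ↔ u (k + 1) ≤ t := fun t k => hreg.lt_rings_iff 0 t k
  have hcount : Tendsto (count w) atTop atTop := by
    refine tendsto_atTop.2 fun n => ?_
    filter_upwards [eventually_ge_atTop (u (n + 1))] with t ht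
    exact ((hlt t n).2 ht).le
  have hlow : ∀ t, 0 ≤ t → u (count w t) ≤ t := fun t ht => by
    rcases hc : count w t with _ | k
    · simpa [hu] using ht
    · exact (hlt t k).1 (by omega)
  have hupp : ∀ t, t < u (count w t + 1) := fun t =>
    not_le.1 fun hle => lt_irrefl _ ((hlt t (count w t)).2 hle)
  have hinv : Tendsto (fun t : ℝ => t / (count w t : ℝ)) atTop (𝓝 (1 / r)) := by
    have h1 : Tendsto (fun t => u (count w t) / (count w t : ℝ)) atTop (𝓝 (1 / r)) :=
      h.comp hcount
    have h2 : Tendsto (fun t => u (count w t + 1) / (count w t : ℝ)) atTop (𝓝 (1 / r)) := by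
      have h3 : Tendsto (fun n : ℕ => u (n + 1) / n) atTop (𝓝 (1 / r)) := by
        have h4 := ((tendsto_add_atTop_iff_nat 1).2 h).mul
          ((tendsto_one_div_atTop_nhds_zero_nat (𝕜 := ℝ)).const_add 1)
        rw [add_zero, mul_one] at h4
        refine h4.congr' ?_
        filter_upwards [eventually_gt_atTop 0] with n hn
        push_cast
        field_simp
        rfl
      exact h3.comp hcount
    refine tendsto_of_tendsto_of_tendsto_of_le_of_le' h1 h2 ?_ ?_
    · filter_upwards [eventually_ge_atTop 0] with t ht
      exact div_le_div_of_nonneg_right (hlow t ht) (Nat.cast_nonneg _)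
    · exact Eventually.of_forall fun t =>
        div_le_div_of_nonneg_right (hupp t).le (Nat.cast_nonneg _)
  have := hinv.inv₀ (by positivity)
  simpa using this

/-- The law of large numbers for the number of rings of a clock of rate `r`. -/
theorem waitLaw_count_lln {r : ℝ} (hr : 0 < r) {δ : ℝ} (hδ : 0 < δ) :
    Tendsto (fun t : ℝ => waitLaw r {w | δ * t ≤ |(count w t : ℝ) - r * t|}) atTop (𝓝 0) := by
  have := isProbabilityMeasure_waitLaw hr
  -- Along a sequence of times, almost sure convergence gives convergence in measure.
  refine tendsto_of_seq_tendsto fun t ht => ?_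
  have hm : TendstoInMeasure (waitLaw r) (fun (n : ℕ) w => (count w (t n) : ℝ) / t n) atTop
      (fun _ => r) := by
    refine tendstoInMeasure_of_tendsto_ae (fun n => ?_) ?_
    · exact ((measurable_from_top.comp (measurable_count (t n))).div_const
        (t n)).aestronglyMeasurable
    · filter_upwards [waitLaw_ae_pos hr, waitLaw_strong_law hr] with w h1 h2
      exact (tendsto_count_div hr h1 h2).comp ht
  refine (tendstoInMeasure_iff_dist.1 hm δ hδ).congr' ?_
  filter_upwards [ht.eventually_gt_atTop 0] with n hn
  congr 1
  ext w
  simp only [Set.mem_ofPred_eq, Real.dist_eq]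
  have : (count w (t n) : ℝ) / t n - r = (count w (t n) - r * t n) / t n := by field_simp
  rw [this, abs_div, abs_of_pos hn, le_div_iff₀ hn]

theorem clockMeasure_count (p : Environment) (x : ℤ) (δ t : ℝ) :
    clockMeasure p {τ | δ * t ≤ |(rings τ x t : ℝ) - p.rate x * t|} =
      waitLaw (p.rate x) {w | δ * t ≤ |(count w t : ℝ) - p.rate x * t|} :=
  (measurePreserving_clock p x).measure_preimage (s :=
      {w | δ * t ≤ |(count w t : ℝ) - p.rate x * t|}) (measurableSet_le measurable_const
    ((((measurable_from_top (f := fun n : ℕ => (n : ℝ))).comp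
      (measurable_count t)).sub_const _).abs)).nullMeasurableSet

/-! ### Joint measurability -/

theorem measurable_siteDepartures_of {Ω : Type*} [MeasurableSpace Ω] {q : Ω → ℕ} {T : Ω → ℕ → ℝ}
    {A : Ω → ℝ → ℕ} {n : Ω → ℕ} (hq : Measurable q)
    (hA : ∀ k, Measurable fun ω => A ω (T ω k)) (hn : Measurable n) :
    Measurable fun ω => siteDepartures (q ω) (T ω) (A ω) (n ω) := by
  have h : ∀ k : ℕ, Measurable fun ω => siteDepartures (q ω) (T ω) (A ω) k := by
    intro k
    induction k with
    | zero => exact measurable_const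
    | succ k ih =>
      simp only [siteDepartures]
      exact Measurable.ite (measurableSet_lt ih (hq.add (hA k))) (ih.add measurable_const) ih
  exact (measurable_from_prod_countable_right (f := fun r : ℕ × Ω =>
    siteDepartures (q r.2) (T r.2) (A r.2) r.1) h).comp (hn.prodMk measurable_id)

theorem measurable_ringsBefore_of {Ω : Type*} [MeasurableSpace Ω] {τ : Ω → Clocks} {s : Ω → ℝ}
    (hτ : Measurable τ) (x : ℤ) (hs : Measurable s) :
    Measurable fun ω => ringsBefore (τ ω) x (s ω) :=
  measurable_ncard.comp (measurable_set_iff.2 fun k =>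
    measurableSet_setOfPred.1 (measurableSet_lt ((measurable_ringTime x k).comp hτ) hs))

theorem measurable_tandem {Ω : Type*} [MeasurableSpace Ω] (b : ℕ → ℕ) {ξ : Ω → Config}
    {τ : Ω → Clocks} (hξ : Measurable ξ) (hτ : Measurable τ) (y : ℤ) (n : ℕ) {m : Ω → ℕ}
    (hm : Measurable m) : Measurable fun ω => tandem b (ξ ω) (τ ω) y n (m ω) := by
  induction n generalizing m with
  | zero => exact measurable_from_top.comp hm
  | succ n ih =>
    simp only [tandem]
    exact measurable_siteDepartures_of ((measurable_pi_apply _).comp hξ) (fun k =>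
      ih (measurable_ringsBefore_of hτ _ ((measurable_ringTime _ k).comp hτ))) hm

theorem measurable_current {Ω : Type*} [MeasurableSpace Ω] (b : ℕ → ℕ) {ξ : Ω → Config}
    {τ : Ω → Clocks} (hξ : Measurable ξ) (hτ : Measurable τ) (y x : ℤ) (t : ℝ) :
    Measurable fun ω => current b (ξ ω) (τ ω) y x t :=
  measurable_tandem b hξ hτ y _ ((measurable_rings x t).comp hτ)

theorem measurable_evolve {Ω : Type*} [MeasurableSpace Ω] {ξ : Ω → Config}
    {τ : Ω → Clocks} (hξ : Measurable ξ) (hτ : Measurable τ) (y : ℤ) (N : ℕ) (t : ℝ) :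
    Measurable fun ω => evolve y N t (ξ ω) (τ ω) := by
  have hc : Measurable (Nat.cast : ℕ → ℤ) := measurable_from_top
  refine measurable_pi_lambda _ fun z => ?_
  simp only [evolve, occupation]
  split_ifs
  · exact (measurable_from_top (f := Int.toNat)).comp
      (((hc.comp ((measurable_pi_apply z).comp hξ)).add
      (hc.comp (measurable_current id hξ hτ y (z - 1) t))).sub
      (hc.comp (measurable_current id hξ hτ y z t)))
  · exact (measurable_pi_apply z).comp hξ

theorem measurable_jump (y : ℤ) (N : ℕ) (x : ℤ) : Measurable (jump y N x) := by
  refine measurable_pi_lambda _ fun z => ?_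
  simp only [jump]
  by_cases h1 : z = x
  · simp only [h1, if_true]
    split_ifs
    · fun_prop
    · exact (measurable_from_top (f := fun n : ℕ => n - 1)).comp (measurable_pi_apply x)
  · simp only [h1, if_false]
    refine Measurable.ite ?_ (by fun_prop) (by fun_prop)
    by_cases h2 : z = x + 1 ∧ z ≤ y + N
    · simp only [h2, true_and]
      exact (MeasurableSet.const _).inter <| (MeasurableSet.const (x = y)).union
        (measurableSet_lt (f := fun _ : Config => 0) (g := fun ξ : Config => ξ x)
          measurable_const (measurable_pi_apply x))
    · have : {a : Config | z = x + 1 ∧ z ≤ y + N ∧ (x = y ∨ 0 < a x)} = ∅ := by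
        ext a; simp only [Set.mem_ofPred_eq, Set.mem_empty_iff_false]; tauto
      rw [this]; exact .empty

/-! ### The memoryless property -/

/-- Sequences of waiting times with exactly `j` rings up to time `h`. -/
def ringSet (h : ℝ) (j : ℕ) : Set (ℕ → ℝ) :=
  {w | (∀ i < j, ∑ l ∈ Finset.range (i + 1), w l ≤ h) ∧ h < ∑ l ∈ Finset.range (j + 1), w l}

theorem measurableSet_ringSet (h : ℝ) (j : ℕ) : MeasurableSet (ringSet h j) := by
  have e : ringSet h j = (⋂ i, ⋂ (_ : i < j), {w | ∑ l ∈ Finset.range (i + 1), w l ≤ h}) ∩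
      {w | h < ∑ l ∈ Finset.range (j + 1), w l} := by
    ext w; simp [ringSet]
  rw [e]
  refine .inter (.iInter fun i => .iInter fun _ => ?_) ?_
  · exact measurableSet_le (f := fun w : ℕ → ℝ => ∑ l ∈ Finset.range (i + 1), w l) (by fun_prop)
      measurable_const
  · exact measurableSet_lt (g := fun w : ℕ → ℝ => ∑ l ∈ Finset.range (j + 1), w l)
      measurable_const (by fun_prop)

/-- For `j ≤ 1` the Poisson weight has no factorial, which merges the two cases. -/
theorem waitLaw_ringSet {r h : ℝ} (hr : 0 < r) (hh : 0 ≤ h) {j : ℕ} (hj : j ≤ 1) :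
    ((waitLaw r).restrict (ringSet h j)).map (shiftWaits h j) =
      ENNReal.ofReal ((r * h) ^ j * Real.exp (-(r * h))) • waitLaw r := by
  interval_cases j
  · have : ringSet h 0 = {w | h < w 0} := by ext w; simp [ringSet]
    rw [this, waitLaw_no_ring hr hh]; simp
  · have : ringSet h 1 = {w | w 0 ≤ h ∧ h < w 0 + w 1} := by
      ext w; simp [ringSet, Finset.sum_range_succ]
    rw [this, waitLaw_one_ring hr]; simp

theorem measurableSet_ringsExactly (W : Finset ℤ) (h : ℝ) (j : ℤ → ℕ) :
    MeasurableSet {τ | RingsExactly W h j τ} :=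
  .pi W.countable_toSet fun _ _ => measurableSet_ringSet _ _

theorem measurable_shiftClocks (W : Finset ℤ) (h : ℝ) (j : ℤ → ℕ) :
    Measurable (shiftClocks W h j) := by
  refine measurable_pi_lambda _ fun x => ?_
  simp only [shiftClocks]
  split_ifs
  · exact (measurable_shiftWaits _ _).comp (measurable_pi_apply x)
  · exact measurable_pi_apply x

/-- Memoryless property: given the numbers of rings up to time `h`, the clocks seen from time `h`
have the same law as the original ones. -/
theorem clockMeasure_shift (p : Environment) (W : Finset ℤ) {h : ℝ} (hh : 0 < h) {j : ℤ → ℕ}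
    (hj : ∀ x, j x ≤ 1) :
    ((clockMeasure p).restrict {τ | RingsExactly W h j τ}).map (shiftClocks W h j) =
      (∏ x ∈ W, ENNReal.ofReal ((p.rate x * h) ^ j x * Real.exp (-(p.rate x * h)))) •
        clockMeasure p := by
  have : ∀ x, IsProbabilityMeasure (waitLaw (p.rate x)) := fun x =>
    isProbabilityMeasure_waitLaw (p.rate_pos x)
  have key := infinitePi_restrict_map (fun x => waitLaw (p.rate x)) (fun x => waitLaw (p.rate x)) W
    (S := fun x => ringSet h (j x)) (fun x => measurableSet_ringSet _ _)
    (g := fun x w => if x ∈ W then shiftWaits h (j x) w else w)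
    (fun x => by
      split_ifs
      · exact measurable_shiftWaits _ _
      · exact measurable_id)
    (c := fun x => ENNReal.ofReal ((p.rate x * h) ^ j x * Real.exp (-(p.rate x * h))))
    (fun x hx => by
      simp only [hx, if_true]
      exact waitLaw_ringSet (p.rate_pos x) hh.le (hj x))
    (fun x hx => by simp [hx])
    (fun x _ => by
      have := p.rate_pos x
      simp only [ne_eq, ENNReal.ofReal_eq_zero, not_le]
      positivity)
  exact key

/-! ### The geometric product measures -/

/-- Lack of memory of the geometric law, the source of the balance equations. -/
theorem geometricMeasure_restrict_map_pred {q : unitInterval} (hq : q ≠ 0) :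
    ((geometricMeasure q).restrict {k | 0 < k}).map (fun k => k - 1) =
      ENNReal.ofReal (1 - q) • geometricMeasure q := by
  refine Measure.ext_of_singleton fun m => ?_
  have hs : (fun k : ℕ => k - 1) ⁻¹' {m} ∩ {k | 0 < k} = {m + 1} := by
    ext k; simp only [Set.mem_inter_iff, Set.mem_preimage, Set.mem_singleton_iff,
      Set.mem_ofPred_eq]; omega
  rw [Measure.map_apply measurable_from_top (measurableSet_singleton m),
    Measure.restrict_apply (measurable_from_top (measurableSet_singleton m)), hs,
    Measure.smul_apply, geometricMeasure_singleton hq, geometricMeasure_singleton hq, smul_eq_mul,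
    ← ENNReal.ofReal_mul (sub_nonneg.2 q.2.2)]
  congr 1; ring

/-- The product measure of the geometric distributions of parameters `q x`. -/
noncomputable def geometricProduct (q : ℤ → unitInterval) : Measure Config :=
  Measure.infinitePi fun x => geometricMeasure (q x)

instance (q : ℤ → unitInterval) : IsProbabilityMeasure (geometricProduct q) := by
  unfold geometricProduct; infer_instance

/-- Remove a particle at `x`. -/
def removeAt (x : ℤ) (ξ : Config) : Config := fun z => if z = x then ξ z - 1 else ξ z

/-- Add a particle at `x`. -/
def addAt (x : ℤ) (ξ : Config) : Config := fun z => if z = x then ξ z + 1 else ξ z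

theorem measurable_removeAt (x : ℤ) : Measurable (removeAt x) := by
  refine measurable_pi_lambda _ fun z => ?_
  simp only [removeAt]
  split_ifs
  · exact (measurable_from_top (f := fun n : ℕ => n - 1)).comp (measurable_pi_apply z)
  · fun_prop

theorem measurable_addAt (x : ℤ) : Measurable (addAt x) := by
  refine measurable_pi_lambda _ fun z => ?_
  simp only [addAt]
  split_ifs <;> fun_prop

/-- The change of variables that removes a particle at `x` costs the ratio `1 - q x`, that is `v /
p_x` in the application. -/
theorem lintegral_removeAt {q : ℤ → unitInterval} {x : ℤ} (h0 : q x ≠ 0) (h1 : q x ≠ 1)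
    {f : Config → ℝ≥0∞} (hf : Measurable f) :
    ∫⁻ ξ in {ξ | 0 < ξ x}, f (removeAt x ξ) ∂(geometricProduct q) =
      ENNReal.ofReal (1 - q x) * ∫⁻ ξ, f ξ ∂(geometricProduct q) := by
  have key := infinitePi_restrict_map (fun x => geometricMeasure (q x))
    (fun x => geometricMeasure (q x)) {x} (S := fun _ => {k | 0 < k})
    (fun _ => .of_discrete) (g := fun z k => if z = x then k - 1 else k)
    (fun _ => measurable_from_top) (c := fun z => ENNReal.ofReal (1 - q z))
    (fun z hz => by
      have : z = x := by simpa using hz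
      subst this
      simpa using geometricMeasure_restrict_map_pred h0)
    (fun z hz => by
      have : z ≠ x := by simpa using hz
      simp [this])
    (fun z hz => by
      have : z = x := by simpa using hz
      subst this
      simp only [ne_eq, ENNReal.ofReal_eq_zero, not_le, sub_pos]
      exact lt_of_le_of_ne (q z).2.2 fun h => h1 (Subtype.ext h))
  have e : Set.pi (({x} : Finset ℤ) : Set ℤ) (fun _ => {k : ℕ | 0 < k}) =
      {ξ : Config | 0 < ξ x} := by
    ext ξ; simp
  rw [e, Finset.prod_singleton] at key
  rw [← lintegral_map hf (measurable_removeAt x)]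
  change ∫⁻ ξ, f ξ ∂(((geometricProduct q).restrict {ξ | 0 < ξ x}).map (removeAt x)) = _
  rw [show ((geometricProduct q).restrict {ξ : Config | 0 < ξ x}).map (removeAt x) =
    ENNReal.ofReal (1 - q x) • geometricProduct q from key, lintegral_smul_measure, smul_eq_mul]

theorem jump_of_pos {y x : ℤ} {N : ℕ} {ξ : Config} (hxy : x ≠ y) (hξ : 0 < ξ x) :
    jump y N x ξ = if x < y + N then addAt (x + 1) (removeAt x ξ) else removeAt x ξ := by
  split_ifs with h
  · funext z
    simp only [jump, addAt, removeAt]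
    split_ifs <;> omega
  · funext z
    simp only [jump, removeAt]
    split_ifs <;> omega

theorem jump_base (y : ℤ) (N : ℕ) (ξ : Config) :
    jump y N y ξ = if y < y + N then addAt (y + 1) ξ else ξ := by
  split_ifs with h
  · funext z
    by_cases h1 : z = y
    · simp [jump, addAt, h1]
    · by_cases h2 : z = y + 1
      · have : y + 1 ≤ y + (N : ℤ) := h
        simp [jump, addAt, h2, this]
      · simp [jump, addAt, h1, h2]
  · funext z
    have : ¬ (z = y + 1 ∧ z ≤ y + N ∧ (True ∨ 0 < ξ y)) := by omega
    simp only [jump, if_true, this, if_false, ite_self]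

section Balance

variable {r : ℤ → ℝ} {v : ℝ} {q : ℤ → unitInterval} {y : ℤ} {N : ℕ} {g : Config → ℝ≥0∞}

/-- Balance at one site. Jumps occur at rate `r x` on occupied configurations, and removing the
particle multiplies this by `v / r x`, so a flux `v` enters the next site. The `addAt x` term is the
flux `v` received from the previous one. -/
theorem rate_mul_lintegral_jump (hv : 0 < v) {x : ℤ} (hxr : v < r x)
    (hq : (1 - q x : ℝ) = v / r x) (hg : Measurable g) (hyx : y < x) (hxN : x ≤ y + N) :
    ENNReal.ofReal (r x) * ∫⁻ ξ, g (jump y N x ξ) ∂(geometricProduct q) +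
        ENNReal.ofReal v * ∫⁻ ξ, g (addAt x ξ) ∂(geometricProduct q) =
      ENNReal.ofReal v * ∫⁻ ξ, g (if x < y + N then addAt (x + 1) ξ else ξ)
          ∂(geometricProduct q) +
        ENNReal.ofReal (r x) * ∫⁻ ξ, g ξ ∂(geometricProduct q) := by
  have hr : 0 < r x := hv.trans hxr
  have hlt : v / r x < 1 := (div_lt_one hr).2 hxr
  have h0 : q x ≠ 0 := fun h => by rw [h] at hq; simp at hq; linarith
  have h1 : q x ≠ 1 := fun h => by
    have h2 : v / r x = 0 := by rw [← hq, h]; simp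
    exact absurd h2 (by positivity)
  have hmul : ∀ I : ℝ≥0∞, ENNReal.ofReal (r x) * (ENNReal.ofReal (1 - q x) * I) =
      ENNReal.ofReal v * I := fun I => by
    rw [← mul_assoc, hq, ← ENNReal.ofReal_mul hr.le, mul_div_cancel₀ _ hr.ne']
  have hmS : MeasurableSet {ξ : Config | 0 < ξ x} :=
    measurableSet_lt measurable_const (measurable_pi_apply x)
  have hmf : Measurable fun ξ : Config => g (if x < y + N then addAt (x + 1) ξ else ξ) := by
    split_ifs
    · exact hg.comp (measurable_addAt _)
    · exact hg
  have e1 := lintegral_removeAt h0 h1 hmf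
  have e2 := lintegral_removeAt h0 h1 (hg.comp (measurable_addAt x))
  have hj1 : ∀ ξ ∈ {ξ : Config | 0 < ξ x}, g (jump y N x ξ) =
      g (if x < y + N then addAt (x + 1) (removeAt x ξ) else removeAt x ξ) := fun ξ hξ => by
    have hξ : 0 < ξ x := hξ
    rw [jump_of_pos (by omega) hξ]
  have hj2 : ∀ ξ ∈ {ξ : Config | 0 < ξ x}ᶜ, g (jump y N x ξ) = g ξ := fun ξ hξ => by
    have hξ : ¬ 0 < ξ x := hξ
    congr 1
    funext z
    simp only [jump]
    split_ifs with a1 a2 a3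
    · rfl
    · subst a1; omega
    · omega
    · rfl
  have hj3 : ∀ ξ ∈ {ξ : Config | 0 < ξ x}, g ξ = g (addAt x (removeAt x ξ)) := fun ξ hξ => by
    have hξ : 0 < ξ x := hξ
    congr 1
    funext z
    simp only [addAt, removeAt]
    split_ifs with a1
    · subst a1; omega
    · rfl
  rw [← lintegral_add_compl (fun ξ => g (jump y N x ξ)) hmS,
    ← lintegral_add_compl g hmS, setLIntegral_congr_fun hmS hj1,
    setLIntegral_congr_fun hmS.compl hj2, setLIntegral_congr_fun hmS hj3]
  simp only [Function.comp_apply] at e2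
  rw [mul_add, mul_add, e1, e2, hmul, hmul]
  ring

/-- The product measure is invariant for the generator of the system with a source at `y`. -/
theorem sum_rate_mul_lintegral_jump (hv : 0 < v) (hry : r y = v)
    (hr : ∀ x, y < x → x ≤ y + N → v < r x)
    (hq : ∀ x, y < x → x ≤ y + N → (1 - q x : ℝ) = v / r x) (hg : Measurable g) :
    ∑ n ∈ Finset.range (N + 1), ENNReal.ofReal (r (y + n)) *
        ∫⁻ ξ, g (jump y N (y + n) ξ) ∂(geometricProduct q) =
      (∑ n ∈ Finset.range (N + 1), ENNReal.ofReal (r (y + n))) *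
        ∫⁻ ξ, g ξ ∂(geometricProduct q) := by
  -- The fluxes telescope: after `M` sites only the flux `v` into the next site is left over. At `M
  -- = N` the particle leaves the row, and `v = r y` accounts for the missing rate.
  have key : ∀ M ≤ N, ∑ n ∈ Finset.range (M + 1), ENNReal.ofReal (r (y + n)) *
        ∫⁻ ξ, g (jump y N (y + n) ξ) ∂(geometricProduct q) =
      ENNReal.ofReal v * ∫⁻ ξ, g (if y + M < y + N then addAt (y + M + 1) ξ else ξ)
          ∂(geometricProduct q) +
      (∑ n ∈ Finset.range M, ENNReal.ofReal (r (y + (n + 1 : ℕ)))) *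
        ∫⁻ ξ, g ξ ∂(geometricProduct q) := by
    intro M hM
    induction M with
    | zero =>
      simp only [zero_add, Finset.sum_range_one, Finset.range_zero, Finset.sum_empty, zero_mul,
        add_zero, Nat.cast_zero, hry]
      simp only [jump_base]
    | succ M ih =>
      have h1 := rate_mul_lintegral_jump (y := y) (N := N) hv
        (hr (y + (M + 1 : ℕ)) (by omega) (by omega))
        (hq (y + (M + 1 : ℕ)) (by omega) (by omega)) hg (by omega) (by omega)
      have e : y + (M : ℤ) + 1 = y + ((M + 1 : ℕ) : ℤ) := by push_cast; ring
      have ih := ih (by omega)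
      simp only [show y + (M : ℤ) < y + N by omega, if_true, e] at ih
      rw [Finset.sum_range_succ, ih, Finset.sum_range_succ _ M, add_mul]
      calc _ = (ENNReal.ofReal (r (y + (M + 1 : ℕ))) *
            ∫⁻ ξ, g (jump y N (y + (M + 1 : ℕ)) ξ) ∂(geometricProduct q) +
            ENNReal.ofReal v * ∫⁻ ξ, g (addAt (y + (M + 1 : ℕ)) ξ) ∂(geometricProduct q)) +
            (∑ n ∈ Finset.range M, ENNReal.ofReal (r (y + (n + 1 : ℕ)))) *
              ∫⁻ ξ, g ξ ∂(geometricProduct q) := by ring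
        _ = _ := by rw [h1]; ring
  rw [key N le_rfl, Finset.sum_range_succ' _ N, add_mul, add_comm]
  simp [hry]

end Balance

/-! ### Invariance of the geometric product measure. -/

theorem RingsExactly.unique {W : Finset ℤ} {h : ℝ} {j j' : ℤ → ℕ} {τ : Clocks}
    (h1 : RingsExactly W h j τ) (h2 : RingsExactly W h j' τ) {x : ℤ} (hx : x ∈ W) :
    j x = j' x := by
  rcases lt_trichotomy (j x) (j' x) with hlt | heq | hgt
  · exact absurd ((h2 x hx).1 _ hlt) (not_le.2 (h1 x hx).2)
  · exact heq
  · exact absurd ((h1 x hx).1 _ hgt) (not_le.2 (h2 x hx).2)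

/-- The sites `y, …, y + N`. -/
def sites (y : ℤ) (N : ℕ) : Finset ℤ := (Finset.range (N + 1)).image fun n : ℕ => y + (n : ℤ)

theorem mem_sites {y : ℤ} {N : ℕ} {x : ℤ} : x ∈ sites y N ↔ y ≤ x ∧ x ≤ y + N := by
  simp only [sites, Finset.mem_image, Finset.mem_range]
  constructor
  · rintro ⟨n, hn, rfl⟩; omega
  · rintro ⟨h1, h2⟩
    exact ⟨(x - y).toNat, by omega, by omega⟩

theorem sum_sites (y : ℤ) (N : ℕ) (f : ℤ → ℝ) :
    ∑ x ∈ sites y N, f x = ∑ n ∈ Finset.range (N + 1), f (y + n) :=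
  Finset.sum_image fun a _ b _ h => by simpa using h

section Invariance

variable (p : Environment) {q : ℤ → unitInterval} {y : ℤ} {N : ℕ}

theorem measurable_evolve_prob {A : Set Config} (hA : MeasurableSet A) (s : ℝ) :
    Measurable fun ξ => clockMeasure p {τ | evolve y N s ξ τ ∈ A} :=
  measurable_measure_prodMk_left (ν := clockMeasure p)
    (s := {ω : Config × Clocks | evolve y N s ω.1 ω.2 ∈ A})
    (measurable_evolve measurable_fst measurable_snd y N s hA)

theorem clockMeasure_ringsExactly_shift {h : ℝ} (hh : 0 < h) {j : ℤ → ℕ} (hj : ∀ x, j x ≤ 1)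
    {B : Set Clocks} (hB : MeasurableSet B) :
    clockMeasure p (shiftClocks (sites y N) h j ⁻¹' B ∩ {τ | RingsExactly (sites y N) h j τ}) =
      (∏ x ∈ sites y N, ENNReal.ofReal ((p.rate x * h) ^ j x * Real.exp (-(p.rate x * h)))) *
        clockMeasure p B := by
  have := congrArg (fun m => m B) (clockMeasure_shift p (sites y N) hh hj)
  rwa [Measure.map_apply (measurable_shiftClocks _ _ _) hB,
    Measure.restrict_apply (measurable_shiftClocks _ _ _ hB), Measure.smul_apply,
    smul_eq_mul] at this

theorem prod_weight (W : Finset ℤ) {h : ℝ} (hh : 0 < h) (j : ℤ → ℕ) :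
    ∏ x ∈ W, ENNReal.ofReal ((p.rate x * h) ^ j x * Real.exp (-(p.rate x * h))) =
      ENNReal.ofReal ((∏ x ∈ W, (p.rate x * h) ^ j x) *
        Real.exp (-((∑ x ∈ W, p.rate x) * h))) := by
  rw [← ENNReal.ofReal_prod_of_nonneg, Finset.prod_mul_distrib, ← Real.exp_sum, Finset.sum_mul,
    Finset.sum_neg_distrib]
  intro x _
  have := p.rate_pos x
  positivity

/-- One step of the evolution: lower bound from the events with at most one ring. -/
theorem evolve_prob_step {h s : ℝ} (hh : 0 < h) (hs : 0 ≤ s) {A : Set Config}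
    (hA : MeasurableSet A) (ξ : Config) :
    ENNReal.ofReal (Real.exp (-((∑ x ∈ sites y N, p.rate x) * h))) *
        (clockMeasure p {τ | evolve y N s ξ τ ∈ A} +
          ∑ n ∈ Finset.range (N + 1), ENNReal.ofReal (p.rate (y + n) * h) *
            clockMeasure p {τ | evolve y N s (jump y N (y + n) ξ) τ ∈ A}) ≤
      clockMeasure p {τ | evolve y N (s + h) ξ τ ∈ A} := by
  classical
  set E := Real.exp (-((∑ x ∈ sites y N, p.rate x) * h)) with hE
  -- Index `0` stands for no ring, index `n + 1` for a single ring at `y + n`.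
  set J : ℕ → ℤ → ℕ := fun n => Nat.casesOn n 0 fun n => Pi.single (y + n) 1 with hJ
  set X : ℕ → Config := fun n => Nat.casesOn n ξ fun n => jump y N (y + n) ξ with hX
  have hJ1 : ∀ n x, J n x ≤ 1 := by
    rintro (_ | n) x
    · simp [hJ]
    · simp only [hJ, Pi.single_apply]; split_ifs <;> simp
  have hmB : ∀ n, MeasurableSet {τ | evolve y N s (X n) τ ∈ A} := fun n =>
    measurable_evolve measurable_const measurable_id y N s hA
  set B : ℕ → Set Clocks := fun n => shiftClocks (sites y N) h (J n) ⁻¹'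
    {τ | evolve y N s (X n) τ ∈ A} ∩ {τ | RingsExactly (sites y N) h (J n) τ} with hB
  have hw : ∀ n ∈ Finset.range (N + 2), clockMeasure p (B n) =
      ENNReal.ofReal E * ((Nat.casesOn n 1 fun n => ENNReal.ofReal (p.rate (y + n) * h)) *
        clockMeasure p {τ | evolve y N s (X n) τ ∈ A}) := by
    intro n hn
    rw [hB, clockMeasure_ringsExactly_shift p hh (hJ1 n) (hmB n), prod_weight p _ hh, ← mul_assoc]
    congr 1
    rcases n with _ | n
    · simp [hJ, hE]
    · have hmem : y + (n : ℤ) ∈ sites y N := mem_sites.2 ⟨by omega, by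
        have := Finset.mem_range.1 hn; omega⟩
      have : ∏ x ∈ sites y N, (p.rate x * h) ^ J (n + 1) x = p.rate (y + n) * h := by
        rw [Finset.prod_eq_single_of_mem _ hmem]
        · simp [hJ]
        · intro x _ hx; simp [hJ, hx]
      rw [this, mul_comm, ENNReal.ofReal_mul (Real.exp_nonneg _)]
  have hdisj : Set.PairwiseDisjoint ((Finset.range (N + 2) : Finset ℕ) : Set ℕ) B := by
    intro n hn m hm hnm
    refine Set.disjoint_left.2 fun τ h1 h2 => hnm ?_
    have hu := fun x hx => h1.2.unique h2.2 (x := x) hx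
    have hn' := Finset.mem_range.1 (Finset.mem_coe.1 hn)
    have hm' := Finset.mem_range.1 (Finset.mem_coe.1 hm)
    rcases n with _ | n <;> rcases m with _ | m
    · rfl
    · have := hu (y + m) (mem_sites.2 ⟨by omega, by omega⟩)
      simp [hJ] at this
    · have := hu (y + n) (mem_sites.2 ⟨by omega, by omega⟩)
      simp [hJ] at this
    · have := hu (y + n) (mem_sites.2 ⟨by omega, by omega⟩)
      simp only [hJ, Pi.single_eq_same, Pi.single_apply] at this
      split_ifs at this with h3
      omega
  have hsub : clockMeasure p (⋃ n ∈ Finset.range (N + 2), B n) ≤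
      clockMeasure p {τ | evolve y N (s + h) ξ τ ∈ A} := by
    refine measure_mono_ae ?_
    filter_upwards [ae_regular p] with τ hτ hmem
    obtain ⟨n, hn, h1, h2⟩ := Set.mem_iUnion₂.1 hmem
    have hn' := Finset.mem_range.1 hn
    change evolve y N (s + h) ξ τ ∈ A
    rcases n with _ | n
    · rw [evolve_shift_no_ring hτ (fun _ => mem_sites) h2 hs]
      exact h1
    · rw [evolve_shift_one_ring hτ (fun _ => mem_sites)
        (mem_sites.2 ⟨by omega, by omega⟩) h2 hs]
      exact h1
  rw [measure_biUnion_finset hdisj fun n _ =>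
    (measurable_shiftClocks _ _ _ (hmB n)).inter (measurableSet_ringsExactly _ _ _),
    Finset.sum_congr rfl hw, ← Finset.mul_sum, Finset.sum_range_succ'] at hsub
  refine le_of_eq_of_le ?_ hsub
  rw [add_comm]
  simp [hX]

/-- The balance equation turns the jump terms into `Λ h` times the integral, with `Λ` the total
rate. The factor `exp (-Λ h) (1 + Λ h)` is `1 - O(h ^ 2)`, so iteration over steps of size `t / K`
loses nothing in the limit. -/
theorem lintegral_evolve_step (hr : ∀ x, y < x → x ≤ y + N → p.rate y < p.rate x)
    (hq : ∀ x, y < x → x ≤ y + N → (1 - q x : ℝ) = p.rate y / p.rate x) {h s : ℝ} (hh : 0 < h)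
    (hs : 0 ≤ s) {A : Set Config} (hA : MeasurableSet A) :
    ENNReal.ofReal (Real.exp (-((∑ x ∈ sites y N, p.rate x) * h)) *
        (1 + (∑ x ∈ sites y N, p.rate x) * h)) *
        ∫⁻ ξ, clockMeasure p {τ | evolve y N s ξ τ ∈ A} ∂(geometricProduct q) ≤
      ∫⁻ ξ, clockMeasure p {τ | evolve y N (s + h) ξ τ ∈ A} ∂(geometricProduct q) := by
  set Λ := ∑ x ∈ sites y N, p.rate x with hΛ
  set g : Config → ℝ≥0∞ := fun ξ => clockMeasure p {τ | evolve y N s ξ τ ∈ A} with hg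
  have hgm : Measurable g := measurable_evolve_prob p hA s
  have hbal := sum_rate_mul_lintegral_jump (N := N) (p.rate_pos y) rfl hr hq hgm
  have hΛ0 : 0 ≤ Λ := Finset.sum_nonneg fun x _ => (p.rate_pos x).le
  have hsum : ∑ n ∈ Finset.range (N + 1), ENNReal.ofReal (p.rate (y + n)) = ENNReal.ofReal Λ := by
    rw [← ENNReal.ofReal_sum_of_nonneg fun x _ => (p.rate_pos _).le, hΛ, sum_sites]
  rw [hsum] at hbal
  refine le_trans (le_of_eq ?_) (lintegral_mono (evolve_prob_step p (y := y) (N := N) hh hs hA))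
  have hmj : ∀ n : ℕ, Measurable fun ξ => g (jump y N (y + n) ξ) := fun n =>
    hgm.comp (measurable_jump y N _)
  have hm2 : Measurable fun ξ => ∑ n ∈ Finset.range (N + 1),
      ENNReal.ofReal (p.rate (y + n) * h) * g (jump y N (y + n) ξ) :=
    Finset.measurable_fun_sum _ fun n _ => (hmj n).const_mul _
  have hm3 : Measurable fun ξ => g ξ + ∑ n ∈ Finset.range (N + 1),
      ENNReal.ofReal (p.rate (y + n) * h) * g (jump y N (y + n) ξ) := hgm.add hm2
  change _ = ∫⁻ ξ, ENNReal.ofReal (Real.exp (-(Λ * h))) * (g ξ + ∑ n ∈ Finset.range (N + 1),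
    ENNReal.ofReal (p.rate (y + n) * h) * g (jump y N (y + n) ξ)) ∂(geometricProduct q)
  rw [lintegral_const_mul _ hm3, lintegral_add_left hgm,
    lintegral_finsetSum _ fun n _ => (hmj n).const_mul _,
    ENNReal.ofReal_mul (Real.exp_nonneg _), mul_assoc]
  congr 1
  have : ∀ n ∈ Finset.range (N + 1),
      ∫⁻ ξ, ENNReal.ofReal (p.rate (y + n) * h) * g (jump y N (y + n) ξ) ∂(geometricProduct q) =
      ENNReal.ofReal h * (ENNReal.ofReal (p.rate (y + n)) *
        ∫⁻ ξ, g (jump y N (y + n) ξ) ∂(geometricProduct q)) := fun n _ => by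
    rw [lintegral_const_mul _ (hmj n), mul_comm (p.rate _) h, ENNReal.ofReal_mul hh.le, mul_assoc]
  rw [Finset.sum_congr rfl this, ← Finset.mul_sum, hbal,
    ENNReal.ofReal_add zero_le_one (by positivity), ENNReal.ofReal_one, add_mul, one_mul,
    mul_comm Λ h, ENNReal.ofReal_mul hh.le, mul_assoc]

theorem pow_mul_le_lintegral_evolve (hr : ∀ x, y < x → x ≤ y + N → p.rate y < p.rate x)
    (hq : ∀ x, y < x → x ≤ y + N → (1 - q x : ℝ) = p.rate y / p.rate x) {h : ℝ} (hh : 0 < h)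
    {A : Set Config} (hA : MeasurableSet A) (K : ℕ) :
    ENNReal.ofReal (Real.exp (-((∑ x ∈ sites y N, p.rate x) * h)) *
        (1 + (∑ x ∈ sites y N, p.rate x) * h)) ^ K * geometricProduct q A ≤
      ∫⁻ ξ, clockMeasure p {τ | evolve y N (K * h) ξ τ ∈ A} ∂(geometricProduct q) := by
  induction K with
  | zero =>
    have : ∀ ξ, clockMeasure p {τ | evolve y N 0 ξ τ ∈ A} = A.indicator 1 ξ := fun ξ => by
      by_cases hξ : ξ ∈ A
      · rw [Set.indicator_of_mem hξ, Pi.one_apply, ← measure_univ (μ := clockMeasure p)]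
        refine measure_congr ?_
        filter_upwards [ae_regular p] with τ hτ
        refine propext ?_
        change evolve y N 0 ξ τ ∈ A ↔ True
        rw [evolve_zero hτ]
        exact iff_true_intro hξ
      · rw [Set.indicator_of_notMem hξ, ← measure_empty (μ := clockMeasure p)]
        refine measure_congr ?_
        filter_upwards [ae_regular p] with τ hτ
        refine propext ?_
        change evolve y N 0 ξ τ ∈ A ↔ False
        rw [evolve_zero hτ]
        exact iff_false_intro hξ
    simp [this, lintegral_indicator_one hA]
  | succ K ih =>
    have := lintegral_evolve_step p (y := y) (N := N) hr hq hh
      (show 0 ≤ (K : ℝ) * h by positivity) hA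
    rw [show ((K + 1 : ℕ) : ℝ) * h = K * h + h by push_cast; ring, pow_succ', mul_assoc]
    exact (mul_le_mul_right ih _).trans this

/-- The product of geometric measures is invariant for the system with a source at `y`. -/
theorem map_evolve (hr : ∀ x, y < x → x ≤ y + N → p.rate y < p.rate x)
    (hq : ∀ x, y < x → x ≤ y + N → (1 - q x : ℝ) = p.rate y / p.rate x) {t : ℝ} (ht : 0 < t) :
    ((clockMeasure p).prod (geometricProduct q)).map (fun ω => evolve y N t ω.2 ω.1) =
      geometricProduct q := by
  have hm : Measurable fun ω : Clocks × Config => evolve y N t ω.2 ω.1 :=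
    measurable_evolve measurable_snd measurable_fst y N t
  have := Measure.isProbabilityMeasure_map (μ := (clockMeasure p).prod (geometricProduct q))
    hm.aemeasurable
  -- Both sides are probability measures, so one inequality suffices; this is why lower bounds from
  -- at most one ring are enough.
  refine (Measure.eq_of_le_of_measure_univ_eq ?_ (by simp)).symm
  refine Measure.le_iff.2 fun A hA => ?_
  rw [Measure.map_apply hm hA, Measure.prod_apply_symm (hm hA)]
  set Λ := ∑ x ∈ sites y N, p.rate x with hΛ
  have hΛ0 : 0 ≤ Λ := Finset.sum_nonneg fun x _ => (p.rate_pos x).le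
  have hlim : Tendsto (fun K : ℕ => ENNReal.ofReal ((Real.exp (-(Λ * (t / K))) *
      (1 + Λ * (t / K))) ^ K) * geometricProduct q A) atTop (𝓝 (geometricProduct q A)) := by
    have h1 : Tendsto (fun K : ℕ => (Real.exp (-(Λ * (t / K))) * (1 + Λ * (t / K))) ^ K) atTop
        (𝓝 1) := by
      have h2 := (Real.tendsto_one_add_div_pow_exp (Λ * t)).const_mul (Real.exp (-(Λ * t)))
      rw [← Real.exp_add, neg_add_cancel, Real.exp_zero] at h2
      refine h2.congr' ?_
      filter_upwards [eventually_gt_atTop 0] with K hK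
      have hK' : (K : ℝ) ≠ 0 := by positivity
      rw [mul_pow, ← Real.exp_nat_mul]
      congr 2
      · field_simp
      · field_simp
    have h3 := ENNReal.Tendsto.mul_const (ENNReal.tendsto_ofReal h1)
      (b := geometricProduct q A) (Or.inr (measure_ne_top _ _))
    simpa using h3
  refine le_of_tendsto hlim ?_
  filter_upwards [eventually_gt_atTop 0] with K hK
  have hK' : (0 : ℝ) < K := by positivity
  have h4 := pow_mul_le_lintegral_evolve p (y := y) (N := N) hr hq (div_pos ht hK') hA K
  rw [mul_div_cancel₀ _ hK'.ne', ← ENNReal.ofReal_pow (by positivity)] at h4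
  exact h4

end Invariance

/-! ### Events of probability tending to one -/

/-- `P t` holds with probability tending to one as `t → ∞`. -/
def WHP {Ω : Type*} [MeasurableSpace Ω] (μ : Measure Ω) (P : ℝ → Ω → Prop) : Prop :=
  Tendsto (fun t => μ {ω | ¬ P t ω}) atTop (𝓝 0)

section WHP

variable {Ω Ω' : Type*} [MeasurableSpace Ω] [MeasurableSpace Ω'] {μ : Measure Ω}
  {P Q : ℝ → Ω → Prop}

theorem WHP.mono_ae (h : WHP μ P) (hPQ : ∀ᶠ t in atTop, ∀ᵐ ω ∂μ, P t ω → Q t ω) : WHP μ Q := by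
  refine tendsto_of_tendsto_of_tendsto_of_le_of_le' tendsto_const_nhds h
    (Eventually.of_forall fun _ => zero_le) ?_
  filter_upwards [hPQ] with t ht
  refine measure_mono_ae ?_
  filter_upwards [ht] with ω hω hQ
  exact fun hP => hQ (hω hP)

theorem WHP.mono (h : WHP μ P) (hPQ : ∀ᶠ t in atTop, ∀ ω, P t ω → Q t ω) : WHP μ Q :=
  h.mono_ae (hPQ.mono fun _ ht => ae_of_all _ ht)

theorem WHP.and (h : WHP μ P) (h' : WHP μ Q) : WHP μ fun t ω => P t ω ∧ Q t ω := by
  have h2 := Tendsto.add h h'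
  rw [add_zero] at h2
  refine tendsto_of_tendsto_of_tendsto_of_le_of_le tendsto_const_nhds h2 (fun _ => zero_le)
    fun t => (measure_mono ?_).trans (measure_union_le _ _)
  intro ω (hω : ¬ (P t ω ∧ Q t ω))
  by_cases hP : P t ω
  · exact Or.inr fun hQ => hω ⟨hP, hQ⟩
  · exact Or.inl hP

theorem WHP.of_ae (h : ∀ᶠ t in atTop, ∀ᵐ ω ∂μ, P t ω) : WHP μ P := by
  refine (tendsto_const_nhds (x := (0 : ℝ≥0∞))).congr' ?_
  filter_upwards [h] with t ht
  exact (ae_iff.1 ht).symm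

theorem WHP.forall_mem_finset {ι : Type*} (s : Finset ι) {P : ι → ℝ → Ω → Prop}
    (h : ∀ i ∈ s, WHP μ (P i)) : WHP μ fun t ω => ∀ i ∈ s, P i t ω := by
  classical
  induction s using Finset.induction_on with
  | empty => exact WHP.of_ae (by simp)
  | insert a s _ ih =>
    refine ((h a (Finset.mem_insert_self a s)).and
      (ih fun i hi => h i (Finset.mem_insert_of_mem hi))).mono (Eventually.of_forall ?_)
    rintro t ω ⟨h1, h2⟩ i hi
    rcases Finset.mem_insert.1 hi with rfl | hi
    · exact h1
    · exact h2 i hi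

theorem WHP.fst [SFinite μ] (h : WHP μ P) (ν : Measure Ω') [IsProbabilityMeasure ν] :
    WHP (μ.prod ν) fun t ω => P t ω.1 := by
  refine h.congr fun t => ?_
  have : {ω : Ω × Ω' | ¬ P t ω.1} = {ω | ¬ P t ω} ×ˢ Set.univ := by ext; simp
  rw [this, Measure.prod_prod, measure_univ, mul_one]

/-- Discards the independent stationary configuration once it has served for comparison. -/
theorem WHP.of_fst [SFinite μ] {ν : Measure Ω'} [IsProbabilityMeasure ν]
    (h : WHP (μ.prod ν) fun t ω => P t ω.1) : WHP μ P := by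
  refine h.congr fun t => ?_
  have : {ω : Ω × Ω' | ¬ P t ω.1} = {ω | ¬ P t ω} ×ˢ Set.univ := by ext; simp
  rw [this, Measure.prod_prod, measure_univ, mul_one]

theorem WHP.snd [SFinite μ] {ν : Measure Ω'} [SFinite ν] (h : WHP μ P) [IsProbabilityMeasure ν] :
    WHP (ν.prod μ) fun t ω => P t ω.2 := by
  refine h.congr fun t => ?_
  have : {ω : Ω' × Ω | ¬ P t ω.2} = Set.univ ×ˢ {ω | ¬ P t ω} := by ext; simp
  rw [this, Measure.prod_prod, measure_univ, one_mul]

end WHP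

/-! ### Law of large numbers for independent geometric variables -/

section GeometricSums

variable {s : unitInterval}

theorem memLp_geometricMeasure (hs : s ≠ 0) :
    MemLp (fun n : ℕ => (n : ℝ)) 2 (geometricMeasure s) := by
  have h0 : 0 < (s : ℝ) := lt_of_le_of_ne s.2.1 fun h => hs (Subtype.ext h.symm)
  rw [memLp_two_iff_integrable_sq (by fun_prop), integrable_geometricMeasure_iff hs]
  have h1 : ‖(1 - s : ℝ)‖ < 1 := by
    rw [Real.norm_eq_abs, abs_of_nonneg (sub_nonneg.2 s.2.2)]; linarith
  refine ((summable_pow_mul_geometric_of_norm_lt_one 2 h1).mul_right (s : ℝ)).congr fun n => ?_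
  rw [Real.norm_eq_abs, abs_of_nonneg (by positivity)]
  ring

theorem integral_id_geometricMeasure (hs : s ≠ 0) :
    ∫ n, (n : ℝ) ∂(geometricMeasure s) = (1 - s) / s := by
  have h0 : 0 < (s : ℝ) := lt_of_le_of_ne s.2.1 fun h => hs (Subtype.ext h.symm)
  have h1 : ‖(1 - s : ℝ)‖ < 1 := by
    rw [Real.norm_eq_abs, abs_of_nonneg (sub_nonneg.2 s.2.2)]; linarith
  rw [integral_geometricMeasure hs]
  have h2 := (hasSum_coe_mul_geometric_of_norm_lt_one h1).mul_right (s : ℝ)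
  rw [show (1 - s : ℝ) / (1 - (1 - s)) ^ 2 * s = (1 - s) / s by
    rw [sub_sub_cancel]; field_simp] at h2
  rw [← h2.tsum_eq]
  refine tsum_congr fun n => ?_
  rw [smul_eq_mul]; ring

/-- The bound depends only on `b`, which makes the Chebyshev estimate uniform over the sites. -/
theorem variance_id_geometricMeasure_le (hs : s ≠ 0) {b : ℝ} (hb : b < 1) (hsb : (1 - s : ℝ) ≤ b) :
    variance (fun n : ℕ => (n : ℝ)) (geometricMeasure s) ≤ ∑' n : ℕ, (n : ℝ) ^ 2 * b ^ n := by
  have h0 : 0 ≤ (1 - s : ℝ) := sub_nonneg.2 s.2.2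
  have h0' : 0 < (s : ℝ) := lt_of_le_of_ne s.2.1 fun h => hs (Subtype.ext h.symm)
  have hsum : ∀ r : ℝ, 0 ≤ r → r < 1 → Summable fun n : ℕ => (n : ℝ) ^ 2 * r ^ n := fun r h h' =>
    summable_pow_mul_geometric_of_norm_lt_one 2 (by rwa [Real.norm_eq_abs, abs_of_nonneg h])
  refine (variance_le_expectation_sq (by fun_prop)).trans ?_
  rw [integral_geometricMeasure hs]
  have hle : ∀ n : ℕ, ((1 - s : ℝ) ^ n * s) • ((fun n : ℕ => (n : ℝ)) ^ 2) n ≤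
      (n : ℝ) ^ 2 * b ^ n := fun n => by
    simp only [Pi.pow_apply, smul_eq_mul]
    have h2 : (1 - s : ℝ) ^ n ≤ b ^ n := pow_le_pow_left₀ h0 hsb n
    have h3 : (1 - s : ℝ) ^ n * s ≤ b ^ n :=
      (mul_le_of_le_one_right (pow_nonneg h0 n) s.2.2).trans h2
    nlinarith [sq_nonneg (n : ℝ)]
  refine Summable.tsum_le_tsum hle ?_ (hsum b (h0.trans hsb) hb)
  refine Summable.of_nonneg_of_le (fun n => ?_) hle (hsum b (h0.trans hsb) hb)
  simp only [Pi.pow_apply, smul_eq_mul]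
  have := pow_nonneg h0 n
  positivity

theorem geometricProduct_sum_deviation (q : ℤ → unitInterval) {b : ℝ} (hb : b < 1)
    {S : Finset ℤ} (hq : ∀ x ∈ S, (1 - q x : ℝ) ≤ b) {ε : ℝ} (hε : 0 < ε) :
    geometricProduct q {ξ | ε ≤ |(∑ x ∈ S, (ξ x : ℝ)) - ∑ x ∈ S, (1 - q x : ℝ) / q x|} ≤
      ENNReal.ofReal (S.card * (∑' n : ℕ, (n : ℝ) ^ 2 * b ^ n) / ε ^ 2) := by
  set V := ∑' n : ℕ, (n : ℝ) ^ 2 * b ^ n with hV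
  have hq0 : ∀ x ∈ S, q x ≠ 0 := fun x hx h0 => by
    have := hq x hx; rw [h0] at this; norm_num at this; linarith
  have hmp : ∀ x, MeasurePreserving (fun ξ : Config => ξ x) (geometricProduct q)
      (geometricMeasure (q x)) := fun x =>
    measurePreserving_eval_infinitePi (fun x => geometricMeasure (q x)) x
  have hL : ∀ x ∈ S, MemLp (fun ξ : Config => (ξ x : ℝ)) 2 (geometricProduct q) := fun x hx =>
    (memLp_geometricMeasure (hq0 x hx)).comp_measurePreserving (hmp x)
  have hmean : ∀ x ∈ S, ∫ ξ, (ξ x : ℝ) ∂(geometricProduct q) = (1 - q x : ℝ) / q x :=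
    fun x hx => by
      rw [← integral_id_geometricMeasure (hq0 x hx), ← (hmp x).map_eq,
        integral_map (hmp x).measurable.aemeasurable (by fun_prop)]
  have hvar : ∀ x ∈ S, variance (fun ξ : Config => (ξ x : ℝ)) (geometricProduct q) ≤ V :=
    fun x hx => by
      refine le_of_eq_of_le ?_ (variance_id_geometricMeasure_le (hq0 x hx) hb (hq x hx))
      rw [← (hmp x).map_eq, variance_map (by fun_prop) (hmp x).measurable.aemeasurable]
      rfl
  have hind : iIndepFun (fun x (ξ : Config) => (ξ x : ℝ)) (geometricProduct q) :=
    iIndepFun_infinitePi (X := fun _ (n : ℕ) => (n : ℝ)) fun _ => by fun_prop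
  have hE : ∫ ξ, (∑ x ∈ S, (ξ x : ℝ)) ∂(geometricProduct q) = ∑ x ∈ S, (1 - q x : ℝ) / q x := by
    rw [integral_finsetSum _ fun x hx => (hL x hx).integrable one_le_two]
    exact Finset.sum_congr rfl hmean
  have hvs := IndepFun.variance_sum (s := S) hL fun i _ j _ hij => hind.indepFun hij
  have hch := meas_ge_le_variance_div_sq
    (X := fun ξ : Config => ∑ x ∈ S, (ξ x : ℝ)) (memLp_finsetSum _ hL) hε
  rw [hE] at hch
  refine hch.trans (ENNReal.ofReal_le_ofReal ?_)
  refine div_le_div_of_nonneg_right ?_ (sq_nonneg ε)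
  have e : (fun ξ : Config => ∑ x ∈ S, (ξ x : ℝ)) = ∑ x ∈ S, fun ξ : Config => (ξ x : ℝ) := by
    ext ξ; simp
  rw [e, hvs]
  refine (Finset.sum_le_sum hvar).trans (le_of_eq ?_)
  rw [Finset.sum_const, nsmul_eq_mul]

/-- Sums over sets of size `O(t)` of independent geometric variables are within `o(t)` of their
means. -/
theorem whp_geometricProduct_sum (q : ℤ → unitInterval) {b : ℝ} (hb : b < 1) {S : ℝ → Finset ℤ}
    (hq : ∀ᶠ t in atTop, ∀ x ∈ S t, (1 - q x : ℝ) ≤ b) {K : ℝ}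
    (hS : ∀ᶠ t in atTop, ((S t).card : ℝ) ≤ K * t) {δ : ℝ} (hδ : 0 < δ) :
    WHP (geometricProduct q) fun t ξ =>
      |(∑ x ∈ S t, (ξ x : ℝ)) - ∑ x ∈ S t, (1 - q x : ℝ) / q x| < δ * t := by
  by_cases hb0 : 0 ≤ b
  · set V := ∑' n : ℕ, (n : ℝ) ^ 2 * b ^ n with hV
    have hV0 : 0 ≤ V := tsum_nonneg fun n => by positivity
    have hlim : Tendsto (fun t : ℝ => ENNReal.ofReal (K * V / δ ^ 2 * t⁻¹)) atTop (𝓝 0) := by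
      have := ENNReal.tendsto_ofReal (tendsto_inv_atTop_zero.const_mul (K * V / δ ^ 2))
      simpa using this
    refine tendsto_of_tendsto_of_tendsto_of_le_of_le' tendsto_const_nhds hlim
      (Eventually.of_forall fun _ => zero_le) ?_
    filter_upwards [hq, hS, eventually_gt_atTop 0] with t h1 h2 ht
    simp only [not_lt]
    refine (geometricProduct_sum_deviation q hb h1 (mul_pos hδ ht)).trans
      (ENNReal.ofReal_le_ofReal ?_)
    rw [show K * V / δ ^ 2 * t⁻¹ = K * t * V / (δ * t) ^ 2 by field_simp]
    gcongr
  · refine WHP.of_ae ?_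
    filter_upwards [hq, eventually_gt_atTop 0] with t h1 ht
    have : S t = ∅ := by
      refine Finset.eq_empty_of_forall_notMem fun x hx => hb0 ?_
      exact (sub_nonneg.2 (q x).2.2).trans (h1 x hx)
    simp [this]
    positivity

theorem card_Ioc_le {y x : ℤ} {r : ℝ} (hr : 0 ≤ r) (h : (x - y : ℝ) ≤ r) :
    ((Finset.Ioc y x).card : ℝ) ≤ r := by
  rw [Int.card_Ioc]
  rcases le_total x y with hxy | hxy
  · rw [Int.toNat_of_nonpos (by omega)]; simpa using hr
  · have : (((x - y).toNat : ℤ) : ℝ) = x - y := by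
      rw [Int.toNat_of_nonneg (by omega)]; push_cast; ring
    rw [← Int.cast_natCast, this]; exact h

theorem Ioc_subset_union (a b c : ℤ) :
    Finset.Ioc a c ⊆ Finset.Ioc a b ∪ Finset.Ioc b c := by
  intro x hx
  simp only [Finset.mem_union, Finset.mem_Ioc] at hx ⊢
  omega

/-- Uniform upper bound for the sums over the intervals `(-n, w]`, `n ≤ K t`. -/
theorem whp_forall_sum_le (q : ℤ → unitInterval) {b : ℝ} (hb : b < 1)
    (hq : ∀ x, (1 - q x : ℝ) ≤ b) (w : ℤ) {K δ : ℝ} (hδ : 0 < δ) :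
    WHP (geometricProduct q) fun t ξ => ∀ n : ℕ, (n : ℝ) ≤ K * t →
      ∑ x ∈ Finset.Ioc (-(n : ℤ)) w, (ξ x : ℝ) ≤
        ∑ x ∈ Finset.Ioc (-(n : ℤ)) w, (1 - q x : ℝ) / q x + δ * t := by
  have hb0 : 0 ≤ b := (sub_nonneg.2 (q 0).2.2).trans (hq 0)
  set m := b / (1 - b) with hm
  have hb1 : 0 < 1 - b := sub_pos.2 hb
  have hm0 : 0 ≤ m := div_nonneg hb0 hb1.le
  have hmean0 : ∀ x, 0 ≤ (1 - q x : ℝ) / q x := fun x =>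
    div_nonneg (sub_nonneg.2 (q x).2.2) (q x).2.1
  have hmean : ∀ x, (1 - q x : ℝ) / q x ≤ m := fun x =>
    div_le_div₀ hb0 (hq x) hb1 (by linarith [hq x])
  -- Grid spacing `κ t`: between neighbouring grid points the means add up to at most about `δ t /
  -- 4`. The grid has `J + 1` points, a number independent of `t`, and sums of nonnegative terms are
  -- monotone in the interval.
  set κ := δ / (4 * (m + 1)) with hκ
  have hκ0 : 0 < κ := by positivity
  set J := ⌈K / κ⌉₊ with hJ
  have hgrid : ∀ j ∈ Finset.range (J + 1), WHP (geometricProduct q) fun t ξ =>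
      |(∑ x ∈ Finset.Ioc (-(⌈j * κ * t⌉₊ : ℤ)) w, (ξ x : ℝ)) -
        ∑ x ∈ Finset.Ioc (-(⌈j * κ * t⌉₊ : ℤ)) w, (1 - q x : ℝ) / q x| < δ / 2 * t := by
    intro j _
    refine whp_geometricProduct_sum q hb (Eventually.of_forall fun t x _ => hq x)
      (K := j * κ + 1 + |(w : ℝ)|) ?_ (by positivity)
    filter_upwards [eventually_ge_atTop 1] with t ht
    have h1 : (⌈j * κ * t⌉₊ : ℝ) < j * κ * t + 1 := Nat.ceil_lt_add_one (by positivity)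
    refine card_Ioc_le (by positivity) ?_
    push_cast
    have h2 := le_abs_self (w : ℝ)
    nlinarith [abs_nonneg (w : ℝ)]
  refine (WHP.forall_mem_finset _ hgrid).mono ?_
  filter_upwards [eventually_ge_atTop (4 * m / δ), eventually_gt_atTop 0] with t ht ht0 ξ hξ n hn
  set j := ⌈(n : ℝ) / (κ * t)⌉₊ with hj
  have hκt : 0 < κ * t := mul_pos hκ0 ht0
  have hjJ : j ≤ J := Nat.ceil_le_ceil (by
    rw [div_le_div_iff₀ hκt hκ0]; nlinarith)
  set N := ⌈j * κ * t⌉₊ with hN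
  have hj1 : (n : ℝ) / (κ * t) ≤ j := Nat.le_ceil _
  have hj2 : (j : ℝ) < n / (κ * t) + 1 := Nat.ceil_lt_add_one (by positivity)
  rw [div_le_iff₀ hκt] at hj1
  have hj3 : j * (κ * t) < n + κ * t := by
    have := mul_lt_mul_of_pos_right hj2 hκt
    rwa [add_mul, div_mul_cancel₀ _ hκt.ne', one_mul] at this
  have hN1 : j * κ * t ≤ N := Nat.le_ceil _
  have hN2 : (N : ℝ) < j * κ * t + 1 := Nat.ceil_lt_add_one (by positivity)
  have hnN : n ≤ N := by exact_mod_cast (by linarith : (n : ℝ) ≤ N)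
  have h1 := (abs_lt.1 (hξ j (Finset.mem_range.2 (by omega)))).2
  have h2 : ∑ x ∈ Finset.Ioc (-(n : ℤ)) w, (ξ x : ℝ) ≤ ∑ x ∈ Finset.Ioc (-(N : ℤ)) w, (ξ x : ℝ) :=
    Finset.sum_le_sum_of_subset_of_nonneg (Finset.Ioc_subset_Ioc_left (by omega))
      fun _ _ _ => Nat.cast_nonneg _
  have h3 : ∑ x ∈ Finset.Ioc (-(N : ℤ)) w, (1 - q x : ℝ) / q x ≤
      ∑ x ∈ Finset.Ioc (-(N : ℤ)) (-(n : ℤ)), (1 - q x : ℝ) / q x +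
        ∑ x ∈ Finset.Ioc (-(n : ℤ)) w, (1 - q x : ℝ) / q x := by
    refine (Finset.sum_le_sum_of_subset_of_nonneg (Ioc_subset_union _ (-(n : ℤ)) _)
      fun x _ _ => hmean0 x).trans (le_of_eq (Finset.sum_union ?_))
    rw [Finset.disjoint_left]
    intro x hx; simp only [Finset.mem_Ioc] at hx ⊢; omega
  have h4 : ∑ x ∈ Finset.Ioc (-(N : ℤ)) (-(n : ℤ)), (1 - q x : ℝ) / q x ≤ (κ * t + 1) * m := by
    refine (Finset.sum_le_card_nsmul _ _ m fun x _ => hmean x).trans ?_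
    rw [nsmul_eq_mul]
    refine mul_le_mul_of_nonneg_right (card_Ioc_le (by positivity) ?_) hm0
    push_cast
    nlinarith
  have h5 : κ * t * m ≤ δ / 4 * t := by
    have : κ * m ≤ δ / 4 := by
      rw [hκ, div_mul_eq_mul_div, div_le_iff₀ (by positivity)]; nlinarith
    nlinarith
  have h6 : m ≤ δ / 4 * t := by
    rw [div_le_iff₀ hδ] at ht; linarith
  linarith

end GeometricSums

/-! ### Changing the rate of one clock -/

theorem waitLaw_map_mul {r s : ℝ} (hr : 0 < r) (hs : 0 < s) :
    (waitLaw r).map (fun w k => r / s * w k) = waitLaw s := by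
  have := isProbabilityMeasure_expMeasure hr
  refine (Measure.infinitePi_map_pi (μ := fun _ : ℕ => expMeasure r) (f := fun _ u => r / s * u)
    fun _ => by fun_prop).trans ?_
  simp only [expMeasure_map_mul hr hs]
  rfl

/-- The environment with the rate at `y` replaced by `v`. -/
noncomputable def Environment.update (p : Environment) (y : ℤ) {v : ℝ} (hv0 : 0 < v) (hv1 : v ≤ 1) :
    Environment where
  rate := Function.update p.rate y v
  c := sInf (Set.range (Function.update p.rate y v))
  c_pos := by
    refine lt_of_lt_of_le (lt_min p.c_pos hv0) (le_csInf (Set.range_nonempty _) ?_)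
    rintro _ ⟨x, rfl⟩
    rcases eq_or_ne x y with rfl | hx
    · simp
    · simp [hx, p.c_le_rate x]
  rate_le_one x := by
    rcases eq_or_ne x y with rfl | hx
    · simpa using hv1
    · simpa [hx] using p.rate_le_one x
  isGLB_c := by
    refine isGLB_csInf (Set.range_nonempty _) ⟨0, ?_⟩
    rintro _ ⟨x, rfl⟩
    rcases eq_or_ne x y with rfl | hx
    · simpa using hv0.le
    · simpa [hx] using (p.rate_pos x).le

/-- Multiplication of the waiting times at `y` by `r`. -/
def scaleClock (y : ℤ) (r : ℝ) (τ : Clocks) : Clocks :=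
  fun x => if x = y then fun k => r * τ x k else τ x

theorem scaleClock_of_ne {y x : ℤ} (h : x ≠ y) (r : ℝ) (τ : Clocks) :
    scaleClock y r τ x = τ x := if_neg h

theorem measurable_scaleClock (y : ℤ) (r : ℝ) : Measurable (scaleClock y r) := by
  refine measurable_pi_lambda _ fun x => ?_
  simp only [scaleClock]
  split_ifs
  · fun_prop
  · fun_prop

theorem clockMeasure_map_scaleClock (p : Environment) (y : ℤ) {v : ℝ} (hv0 : 0 < v) (hv1 : v ≤ 1) :
    (clockMeasure p).map (scaleClock y (p.rate y / v)) = clockMeasure (p.update y hv0 hv1) := by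
  have hf : ∀ x : ℤ, Measurable fun w : ℕ → ℝ =>
      if x = y then fun k => p.rate y / v * w k else w := fun x => by
    split_ifs <;> fun_prop
  refine (Measure.infinitePi_map_pi (μ := fun x => Measure.infinitePi fun _ : ℕ =>
    expMeasure (p.rate x)) hf).trans ?_
  simp only [clockMeasure]
  congr 1
  funext x
  rcases eq_or_ne x y with rfl | hx
  · simp only [if_true]
    refine (waitLaw_map_mul (p.rate_pos x) hv0).trans ?_
    simp [waitLaw, Environment.update]
  · simp only [hx, if_false, Environment.update, ne_eq, not_false_eq_true, Function.update_of_ne]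
    exact Measure.map_id

/-! ### Stationary systems -/

/-- The parameter of the geometric law with ratio `v / p_x`. -/
noncomputable def geomParam (p : Environment) (v : ℝ) (x : ℤ) : unitInterval :=
  Set.projIcc 0 1 zero_le_one (1 - v / p.rate x)

theorem one_sub_geomParam (p : Environment) {v : ℝ} (hv : 0 ≤ v) {x : ℤ} (hx : v ≤ p.rate x) :
    (1 - geomParam p v x : ℝ) = v / p.rate x := by
  have h1 : v / p.rate x ≤ 1 := (div_le_one (p.rate_pos x)).2 hx
  have h2 : 0 ≤ v / p.rate x := div_nonneg hv (p.rate_pos x).le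
  rw [geomParam, Set.projIcc_of_mem zero_le_one ⟨by linarith, by linarith⟩]
  simp

section Stationary

variable (p : Environment) {v : ℝ} (hv0 : 0 < v) (hv1 : v ≤ 1)

/-- The clocks for which the rate at `y` is `v`. -/
noncomputable def sourceClock (p : Environment) (v : ℝ) (y : ℤ) (τ : Clocks) : Clocks :=
  scaleClock y (p.rate y / v) τ

theorem measurable_sourceClock (y : ℤ) : Measurable (sourceClock p v y) := measurable_scaleClock _ _

theorem sourceClock_of_ne {y x : ℤ} (h : x ≠ y) (τ : Clocks) : sourceClock p v y τ x = τ x :=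
  scaleClock_of_ne h _ _

include hv0 hv1 in
theorem ae_regular_sourceClock (y : ℤ) : ∀ᵐ τ ∂(clockMeasure p), Regular (sourceClock p v y τ) := by
  have h := ae_regular (p.update y hv0 hv1)
  rw [← clockMeasure_map_scaleClock] at h
  exact ae_of_ae_map (measurable_scaleClock _ _).aemeasurable h

-- Invariance expressed with the original clocks, only the one at `y` being rescaled. This couples
-- the stationary systems of all parameters `v` with the process.
include hv0 hv1 in
theorem map_evolve_sourceClock {y : ℤ} {N : ℕ} (hr : ∀ x, y < x → x ≤ y + N → v < p.rate x)
    {t : ℝ} (ht : 0 < t) :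
    ((clockMeasure p).prod (geometricProduct (geomParam p v))).map
      (fun ω => evolve y N t ω.2 (sourceClock p v y ω.1)) = geometricProduct (geomParam p v) := by
  have hne : ∀ x, y < x → (p.update y hv0 hv1).rate x = p.rate x := fun x hx => by
    simp [Environment.update, hx.ne']
  have hy : (p.update y hv0 hv1).rate y = v := by simp [Environment.update]
  have h := map_evolve (p.update y hv0 hv1) (y := y) (N := N) (q := geomParam p v)
    (fun x h1 h2 => by rw [hy, hne x h1]; exact hr x h1 h2)
    (fun x h1 h2 => by rw [hy, hne x h1]; exact one_sub_geomParam p hv0.le (hr x h1 h2).le) ht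
  rw [← clockMeasure_map_scaleClock p y hv0 hv1] at h
  have h2 := Measure.map_prod_map (clockMeasure p) (geometricProduct (geomParam p v))
    (measurable_scaleClock y (p.rate y / v)) measurable_id
  rw [Measure.map_id] at h2
  rw [h2, Measure.map_map (measurable_evolve measurable_snd measurable_fst _ _ _)
    ((measurable_scaleClock _ _).prodMap measurable_id)] at h
  exact h

include hv0 hv1 in
theorem whp_source_rings (y : ℝ → ℤ) {δ : ℝ} (hδ : 0 < δ) :
    WHP (clockMeasure p) fun t τ =>
      |(rings (sourceClock p v (y t) τ) (y t) t : ℝ) - v * t| < δ * t := by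
  refine (waitLaw_count_lln hv0 hδ).congr fun t => ?_
  have h := clockMeasure_count (p.update (y t) hv0 hv1) (y t) δ t
  have hy : (p.update (y t) hv0 hv1).rate (y t) = v := by simp [Environment.update]
  rw [hy, ← clockMeasure_map_scaleClock, Measure.map_apply (measurable_scaleClock _ _)] at h
  · rw [← h]
    simp only [not_lt]
    rfl
  · exact measurableSet_le measurable_const ((((measurable_from_top (f := fun n : ℕ => (n : ℝ))).comp
      (measurable_rings _ _)).sub_const _).abs)

include hv0 hv1 in
/-- In the stationary system the flux through a site is `v t + o(t)`. -/
theorem whp_current {b : ℝ} (hb : b < 1) {y : ℝ → ℤ} {x : ℤ} (hyx : ∀ᶠ t in atTop, y t ≤ x)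
    (hr : ∀ t z, y t < z → z ≤ x → v ≤ b * p.rate z) {K : ℝ} (hK : 0 ≤ K)
    (hyK : ∀ᶠ t in atTop, (x - y t : ℝ) ≤ K * t) {δ : ℝ} (hδ : 0 < δ) :
    WHP ((clockMeasure p).prod (geometricProduct (geomParam p v))) fun t ω =>
      |(current id ω.2 (sourceClock p v (y t) ω.1) (y t) x t : ℝ) - v * t| < δ * t := by
  set μ := (clockMeasure p).prod (geometricProduct (geomParam p v)) with hμ
  have hr' : ∀ t z, y t < z → z ≤ x → v < p.rate z := fun t z h1 h2 => by
    nlinarith [hr t z h1 h2, p.rate_pos z]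
  have hsum := whp_geometricProduct_sum (geomParam p v) hb (S := fun t => Finset.Ioc (y t) x)
    (K := K) (δ := δ / 3) (Eventually.of_forall fun t z hz => by
      rw [Finset.mem_Ioc] at hz
      rw [one_sub_geomParam p hv0.le (hr' t z hz.1 hz.2).le, div_le_iff₀ (p.rate_pos z)]
      exact hr t z hz.1 hz.2) (by
      filter_upwards [hyK, eventually_ge_atTop 0] with t ht ht0
      exact card_Ioc_le (mul_nonneg hK ht0) ht) (by positivity)
  -- By stationarity the configuration at time `t` concentrates around the same mean as the initial
  -- one.
  have hevo : WHP μ fun t ω =>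
      |(∑ z ∈ Finset.Ioc (y t) x, (evolve (y t) (x - y t).toNat t ω.2
        (sourceClock p v (y t) ω.1) z : ℝ)) -
        ∑ z ∈ Finset.Ioc (y t) x, (1 - geomParam p v z : ℝ) / geomParam p v z| < δ / 3 * t := by
    refine Tendsto.congr' ?_ hsum
    filter_upwards [eventually_gt_atTop 0, hyx] with t ht hyx
    have h1 := map_evolve_sourceClock p hv0 hv1 (y := y t) (N := (x - y t).toNat)
      (fun z h1 h2 => hr' t z h1 (by omega)) ht
    have hmeas : Measurable fun ξ : Config => |(∑ z ∈ Finset.Ioc (y t) x, (ξ z : ℝ)) -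
        ∑ z ∈ Finset.Ioc (y t) x, (1 - geomParam p v z : ℝ) / geomParam p v z| :=
      ((Finset.measurable_fun_sum _ fun z _ => (measurable_from_top (f := fun n : ℕ => (n : ℝ))).comp
        (measurable_pi_apply z)).sub_const _).abs
    have hm2 : Measurable fun ω : Clocks × Config =>
        evolve (y t) (x - y t).toNat t ω.2 (sourceClock p v (y t) ω.1) :=
      measurable_evolve measurable_snd ((measurable_sourceClock p _).comp measurable_fst) _ _ _
    rw [← h1]
    exact Measure.map_apply hm2 (measurableSet_lt hmeas measurable_const).compl
  have hreg : WHP μ fun t ω => Regular (sourceClock p v (y t) ω.1) := by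
    refine WHP.fst (P := fun t τ => Regular (sourceClock p v (y t) τ))
      (WHP.of_ae (Eventually.of_forall fun t => ?_)) _
    exact ae_regular_sourceClock p hv0 hv1 (y t)
  refine ((((whp_source_rings p hv0 hv1 y (δ := δ / 3) (by positivity)).fst _).and
    (hsum.snd (ν := clockMeasure p))).and (hevo.and hreg)).mono ?_
  filter_upwards [hyx] with t hyx
  rintro ω ⟨⟨h1, h2⟩, h3, h4⟩
  -- By conservation, the current is the number of source rings plus the initial mass minus the
  -- final mass, and the two means cancel.
  have h5 := current_add_sum_evolve (y := y t) (N := (x - y t).toNat) (s := t) (ξ := ω.2) h4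
    (n := (x - y t).toNat) le_rfl
  have e : y t + ((x - y t).toNat : ℤ) = x := by omega
  rw [e] at h5
  have h6 := congrArg (Nat.cast : ℕ → ℝ) h5
  push_cast at h6
  rw [abs_lt] at h1 h2 h3 ⊢
  constructor <;> linarith [h1.1, h1.2, h2.1, h2.2, h3.1, h3.2]

end Stationary

/-! ### Densities -/

theorem Icc_add_one_eq_Ioc (n : ℕ) (w : ℤ) :
    Finset.Icc (-(n : ℤ) + 1) w = Finset.Ioc (-(n : ℤ)) w := by
  ext x; simp only [Finset.mem_Icc, Finset.mem_Ioc]; omega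

theorem sum_Ioc_le_add (f : ℤ → ℝ) (hf : ∀ x, 0 ≤ f x) (a b c : ℤ) :
    ∑ x ∈ Finset.Ioc a c, f x ≤ ∑ x ∈ Finset.Ioc a b, f x + ∑ x ∈ Finset.Ioc b c, f x := by
  refine (Finset.sum_le_sum_of_subset_of_nonneg (Ioc_subset_union a b c)
    fun x _ _ => hf x).trans (le_of_eq (Finset.sum_union ?_))
  rw [Finset.disjoint_left]
  intro x hx; simp only [Finset.mem_Ioc] at hx ⊢; omega

/-- A real `d` fits strictly between `ρ` and the lower density even when the latter is `∞`. The
constant `C` absorbs small `n` and the change of endpoint from `0` to `w`. -/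
theorem exists_lower_density {η : Config} {ρ : ℝ} (h : (ρ : EReal) < lowerLeftDensity η) :
    ∃ d > ρ, ∀ w : ℤ, ∃ C : ℝ, ∀ n : ℕ,
      d * n - C ≤ ∑ x ∈ Finset.Ioc (-(n : ℤ)) w, (η x : ℝ) := by
  obtain ⟨d, hd1, hd2⟩ := EReal.lt_iff_exists_real_btwn.1 h
  refine ⟨d, EReal.coe_lt_coe_iff.1 hd1, fun w => ?_⟩
  obtain ⟨n₀, hn₀⟩ := eventually_atTop.1 (eventually_lt_of_lt_liminf hd2)
  have h0 : ∀ f : Finset ℤ, 0 ≤ ∑ x ∈ f, (η x : ℝ) := fun f => Finset.sum_nonneg fun _ _ =>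
    Nat.cast_nonneg _
  refine ⟨|d| * n₀ + ∑ x ∈ Finset.Ioc w 0, (η x : ℝ), fun n => ?_⟩
  have h1 := sum_Ioc_le_add (fun x => (η x : ℝ)) (fun _ => Nat.cast_nonneg _) (-(n : ℤ)) w 0
  suffices d * n - |d| * n₀ ≤ ∑ x ∈ Finset.Ioc (-(n : ℤ)) 0, (η x : ℝ) by linarith
  rcases lt_or_ge n n₀ with hn | hn
  · have h2 : (n : ℝ) ≤ n₀ := by exact_mod_cast hn.le
    have h3 := h0 (Finset.Ioc (-(n : ℤ)) 0)
    have h4 : d * n ≤ |d| * n := mul_le_mul_of_nonneg_right (le_abs_self d) (Nat.cast_nonneg n)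
    nlinarith [abs_nonneg d]
  · have h2 := EReal.coe_lt_coe_iff.1 (hn₀ n hn)
    rw [Icc_add_one_eq_Ioc] at h2
    have h3 : 0 ≤ |d| * n₀ := by positivity
    rcases Nat.eq_zero_or_pos n with rfl | hn'
    · simp at h2 ⊢; linarith
    · have hn'' : (0 : ℝ) < n := by exact_mod_cast hn'
      rw [one_div, inv_mul_eq_div, lt_div_iff₀ hn''] at h2
      linarith

/-- The mean number of particles in `(-n, w]` under the product of geometric measures with
parameter `v < p.c` is at most `(ρ + δ) n + O(1)`. -/
def MeanBound (p : Environment) (ρ : ℝ) : Prop :=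
  ∀ v, 0 < v → v < p.c → ∀ δ > 0, ∀ w : ℤ, ∃ C : ℝ, ∀ n : ℕ,
    ∑ x ∈ Finset.Ioc (-(n : ℤ)) w, (1 - geomParam p v x : ℝ) / geomParam p v x ≤ (ρ + δ) * n + C

/-- `R` is nondecreasing on `[0, c)`, hence at most its limit `ρ`. The averages are below `ρ + δ`
for large `n`, and `C` covers the remaining `n` and the sites between `0` and `w`. -/
theorem limit_nonneg_and_meanBound {p : Environment} {R : ℝ → ℝ}
    (hR : ∀ v : ℝ, 0 ≤ v → v < p.c → HasMeanLeftDensity p v (R v)) {ρ : ℝ}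
    (hρ : Tendsto R (𝓝[<] p.c) (𝓝 ρ)) : 0 ≤ ρ ∧ MeanBound p ρ := by
  have hpos : ∀ v, v < p.c → ∀ x, 0 < p.rate x - v := fun v hv x =>
    sub_pos.2 (hv.trans_le (p.c_le_rate x))
  have hR0 : ∀ v, 0 ≤ v → v < p.c → 0 ≤ R v := fun v h0 h1 =>
    ge_of_tendsto' (hR v h0 h1) fun n => mul_nonneg (by positivity)
      (Finset.sum_nonneg fun x _ => div_nonneg h0 (hpos v h1 x).le)
  have hmono : ∀ u v, 0 ≤ u → u ≤ v → v < p.c → R u ≤ R v := fun u v h0 huv h1 =>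
    le_of_tendsto_of_tendsto' (hR u h0 (huv.trans_lt h1)) (hR v (h0.trans huv) h1) fun n =>
      mul_le_mul_of_nonneg_left (Finset.sum_le_sum fun x _ =>
        div_le_div₀ (h0.trans huv) huv (hpos v h1 x) (by linarith)) (by positivity)
  have hle : ∀ v, 0 ≤ v → v < p.c → R v ≤ ρ := fun v h0 h1 =>
    ge_of_tendsto hρ (by
      filter_upwards [Ioo_mem_nhdsLT h1] with u hu
      exact hmono v u h0 hu.1.le hu.2)
  have hρ0 : 0 ≤ ρ := (hR0 0 le_rfl p.c_pos).trans (hle 0 le_rfl p.c_pos)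
  refine ⟨hρ0, fun v h0 h1 δ hδ w => ?_⟩
  have hmean : ∀ x, (1 - geomParam p v x : ℝ) / geomParam p v x = v / (p.rate x - v) := fun x => by
    have h2 := one_sub_geomParam p h0.le (h1.le.trans (p.c_le_rate x))
    have h3 : (geomParam p v x : ℝ) = 1 - v / p.rate x := by linarith
    have h4 := p.rate_pos x
    have h5 := (hpos v h1 x).ne'
    rw [h2, h3]
    have h6 : 1 - v / p.rate x ≠ 0 := by
      rw [one_sub_div h4.ne']; exact div_ne_zero h5 h4.ne'
    field_simp
  simp only [hmean]
  have hf0 : ∀ x, 0 ≤ v / (p.rate x - v) := fun x => div_nonneg h0.le (hpos v h1 x).le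
  obtain ⟨n₀, hn₀⟩ := eventually_atTop.1 ((hR v h0.le h1).eventually_lt_const
    (show R v < ρ + δ by linarith [hle v h0.le h1]))
  refine ⟨∑ x ∈ Finset.Ioc (-(n₀ : ℤ)) 0, v / (p.rate x - v) +
    ∑ x ∈ Finset.Ioc 0 w, v / (p.rate x - v), fun n => ?_⟩
  have h2 := sum_Ioc_le_add _ hf0 (-(n : ℤ)) 0 w
  have h3 : 0 ≤ ∑ x ∈ Finset.Ioc (-(n₀ : ℤ)) 0, v / (p.rate x - v) :=
    Finset.sum_nonneg fun x _ => hf0 x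
  have h6 : 0 ≤ (ρ + δ) * n := by positivity
  suffices ∑ x ∈ Finset.Ioc (-(n : ℤ)) 0, v / (p.rate x - v) ≤
      (ρ + δ) * n + ∑ x ∈ Finset.Ioc (-(n₀ : ℤ)) 0, v / (p.rate x - v) by linarith
  rcases lt_or_ge n n₀ with hn | hn
  · have h4 : ∑ x ∈ Finset.Ioc (-(n : ℤ)) 0, v / (p.rate x - v) ≤
        ∑ x ∈ Finset.Ioc (-(n₀ : ℤ)) 0, v / (p.rate x - v) :=
      Finset.sum_le_sum_of_subset_of_nonneg (Finset.Ioc_subset_Ioc_left (by omega))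
        fun x _ _ => hf0 x
    linarith
  · have h5 := hn₀ n hn
    rw [Icc_add_one_eq_Ioc] at h5
    rcases Nat.eq_zero_or_pos n with rfl | hn'
    · simp at h3 ⊢; linarith
    · have hn'' : (0 : ℝ) < n := by exact_mod_cast hn'
      rw [one_div, inv_mul_eq_div, div_lt_iff₀ hn''] at h5
      linarith

/-! ### Lower bounds for currents -/

theorem whp_rings (p : Environment) (x : ℤ) {δ : ℝ} (hδ : 0 < δ) :
    WHP (clockMeasure p) fun t τ => |(rings τ x t : ℝ) - p.rate x * t| < δ * t := by
  refine (waitLaw_count_lln (p.rate_pos x) hδ).congr fun t => ?_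
  rw [← clockMeasure_count]
  simp only [not_lt]

/-- The current through `x` created by a source at `y t + 1` exceeds `v t` if the mean number of
particles in `(y t, x]` for a stationary system with parameter `v'` is less than `(v' - v) t`. -/
theorem whp_lt_source_current (p : Environment) {v v' m : ℝ} (hv0 : 0 < v') (hv1 : v' ≤ 1)
    (hm : v + m < v') {b : ℝ} (hb : b < 1) {y : ℝ → ℤ} {x : ℤ} (hyx : ∀ᶠ t in atTop, y t + 1 ≤ x)
    (hr : ∀ t z, y t < z → z ≤ x → v' ≤ b * p.rate z) {K : ℝ} (hK : 0 ≤ K)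
    (hyK : ∀ᶠ t in atTop, (x - y t : ℝ) ≤ K * t)
    (hmean : ∀ᶠ t in atTop, ∑ z ∈ Finset.Ioc (y t) x,
      (1 - geomParam p v' z : ℝ) / geomParam p v' z ≤ m * t) :
    WHP (clockMeasure p) fun t τ => v * t < current id 0 τ (y t + 1) x t := by
  set δ := (v' - v - m) / 2 with hδ
  have hδ0 : 0 < δ := by rw [hδ]; linarith
  have hr' : ∀ t z, y t < z → z ≤ x → v' < p.rate z := fun t z h1 h2 => by
    nlinarith [hr t z h1 h2, p.rate_pos z]
  have hcur := whp_current p hv0 hv1 hb (hyx.mono fun t h => by omega) hr hK hyK hδ0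
  have hsum := whp_geometricProduct_sum (geomParam p v') hb (S := fun t => Finset.Ioc (y t) x)
    (K := K) (δ := δ) (Eventually.of_forall fun t z hz => by
      rw [Finset.mem_Ioc] at hz
      rw [one_sub_geomParam p hv0.le (hr' t z hz.1 hz.2).le, div_le_iff₀ (p.rate_pos z)]
      exact hr t z hz.1 hz.2) (by
      filter_upwards [hyK, eventually_ge_atTop 0] with t ht ht0
      exact card_Ioc_le (mul_nonneg hK ht0) ht) hδ0
  have hreg : WHP (clockMeasure p) fun t τ => Regular (sourceClock p v' (y t) τ) :=
    WHP.of_ae (Eventually.of_forall fun t => ae_regular_sourceClock p hv0 hv1 (y t))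
  refine WHP.of_fst (ν := geometricProduct (geomParam p v')) ?_
  refine ((hcur.and (hsum.snd (ν := clockMeasure p))).and
    (hreg.fst (geometricProduct (geomParam p v')))).mono ?_
  filter_upwards [hmean, eventually_gt_atTop 0, hyx] with t ht ht0 hyx'
  rintro ω ⟨⟨h1, h2⟩, h3⟩
  -- The source is moved from `y` to `y + 1` because only the clock at `y` was rescaled. Emptying
  -- the sites then costs at most the initial mass.
  have h4 := current_le_source (t := t) (η := ω.2) h3 isCount_id (y := y t) (Y := y t + 1) (x := x)
    (by omega) hyx'
  have h5 := current_le_add_sum (t := t) (η := ω.2) h3 isCount_id hyx' 0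
  have h6 : current id 0 (sourceClock p v' (y t) ω.1) (y t + 1) x t =
      current id 0 ω.1 (y t + 1) x t :=
    current_congr hyx' (fun _ _ _ => rfl) (fun z hz _ => sourceClock_of_ne p (by omega) _) t
  have h7 : ∑ z ∈ Finset.Ioc (y t + 1) x, ω.2 z ≤ ∑ z ∈ Finset.Ioc (y t) x, ω.2 z :=
    Finset.sum_le_sum_of_subset (Finset.Ioc_subset_Ioc_left (by omega))
  rw [h6] at h5
  have h8 : (current id ω.2 (sourceClock p v' (y t) ω.1) (y t) x t : ℝ) ≤
      current id 0 ω.1 (y t + 1) x t + ∑ z ∈ Finset.Ioc (y t) x, (ω.2 z : ℝ) := by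
    exact_mod_cast h4.trans (h5.trans (Nat.add_le_add_left h7 _))
  rw [abs_lt] at h1 h2
  have h9 : v' * t - v * t - m * t = 2 * (δ * t) := by rw [hδ]; ring
  linarith [h1.1, h2.2]

theorem tendsto_neg_ceil {a : ℝ} (ha : 0 < a) :
    Tendsto (fun t : ℝ => -(⌈a * t⌉₊ : ℤ)) atTop atBot :=
  tendsto_neg_atTop_atBot.comp (tendsto_natCast_atTop_atTop.comp
    (tendsto_nat_ceil_atTop.comp (tendsto_id.const_mul_atTop ha)))

theorem exists_slow_site {p : Environment} (h : liminf p.rate atBot = p.c) {ε : ℝ} (hε : 0 < ε)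
    (w : ℤ) : ∃ y < w, p.rate y < p.c + ε := by
  have h1 : ∃ᶠ y in atBot, p.rate y < p.c + ε := by
    refine frequently_lt_of_liminf_lt ?_ (by rw [h]; linarith)
    exact IsBoundedUnder.isCoboundedUnder_ge ⟨1, eventually_map.2
      (Eventually.of_forall p.rate_le_one)⟩
  obtain ⟨y, h2, h3⟩ := (h1.and_eventually (eventually_lt_atBot w)).exists
  exact ⟨y, h3, h2⟩

theorem neg_ceil_bounds {a t : ℝ} (h : 0 ≤ a * t) :
    a * t ≤ (⌈a * t⌉₊ : ℝ) ∧ (⌈a * t⌉₊ : ℝ) ≤ a * t + 1 :=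
  ⟨Nat.le_ceil _, (Nat.ceil_lt_add_one h).le⟩

/-- The level `A` separates: the slow site `y₁` keeps the current below it, and both arguments of
the minimum in `le_truncate_current` reach it. -/
theorem current_lt_truncate_of_bounds {τ σ : Clocks} (hτ : Regular τ) (hσ : Regular σ)
    {η ζ : Config} {y y₁ Y w z : ℤ} {t A : ℝ} {M : ℕ}
    (h1 : ∑ u ∈ Finset.Ioc y₁ w, (η u : ℝ) + rings τ y₁ t < A)
    (h2 : A ≤ ∑ u ∈ Finset.Ioc y w, (η u : ℝ)) (h3 : A ≤ current id ζ σ y w t + M)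
    (hyY : y < Y) (hYw : Y ≤ w) (hy₁w : y₁ ≤ w) (hστ : ∀ u, y < u → σ u = τ u)
    (h : ∀ u, y < u → u ≤ Y → ∑ v ∈ Finset.Ioc u w, ζ v + M ≤ ∑ v ∈ Finset.Ioc u w, η v)
    (hz : z ≤ min y y₁) : current 0 η τ z w t <
      current 0 (truncate η Y) τ z w t + ∑ u ∈ Finset.Ioc Y w, η u := by
  have h4 := current_le_sum_add (t := t) (η := η) hτ isCount_zero (hz.trans (min_le_right _ _)) hy₁w
  have h5 : (current 0 η τ z w t : ℝ) < A :=
    lt_of_le_of_lt (by exact_mod_cast h4) h1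
  refine lt_of_lt_of_le (lt_min ?_ ?_) (le_truncate_current (t := t) hτ hσ isCount_zero
    (hz.trans (min_le_left _ _)) hyY hYw hστ h)
  · exact_mod_cast h5.trans_le h2
  · exact_mod_cast h5.trans_le h3

/-- The process started from `η` is not affected by particles to the right of `-a t - 1`, in
the sense that its current is smaller than the bound these particles alone would impose. -/
theorem whp_current_lt_truncate {p : Environment} (hslow : liminf p.rate atBot = p.c) {η : Config}
    {ρ d : ℝ} (hρ : 0 ≤ ρ) (hM : MeanBound p ρ) (hd : ρ < d)
    (hη : ∀ w : ℤ, ∃ C : ℝ, ∀ n : ℕ, d * n - C ≤ ∑ x ∈ Finset.Ioc (-(n : ℤ)) w, (η x : ℝ))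
    {a : ℝ} (ha : 0 < a) (w : ℤ) :
    WHP (clockMeasure p) fun t τ => ∃ z₀ : ℤ, ∀ z ≤ z₀, current 0 η τ z w t <
      current 0 (truncate η (-(⌈a * t⌉₊ : ℤ) - 1)) τ z w t +
        ∑ u ∈ Finset.Ioc (-(⌈a * t⌉₊ : ℤ) - 1) w, η u := by
  have hc := p.c_pos
  have hc1 : p.c ≤ 1 := (p.c_le_rate 0).trans (p.rate_le_one 0)
  set γ := (d - ρ) / 2 with hγ
  have hγ0 : 0 < γ := by rw [hγ]; linarith
  -- On `(-n, w]` with `n ≥ a t`, the mean surplus of `η` over the stationary configuration is at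
  -- least `γ n - O(1) ≥ 10 ε t - O(1)`. This leaves room for fluctuations and for a guaranteed
  -- surplus `M` of about `5 ε t`.
  obtain ⟨ε, hε0, hεa, hεc⟩ : ∃ ε, 0 < ε ∧ 10 * ε ≤ γ * a ∧ 2 * ε ≤ p.c :=
    ⟨min (γ * a / 10) (p.c / 2), by positivity,
      by linarith [min_le_left (γ * a / 10) (p.c / 2)],
      by linarith [min_le_right (γ * a / 10) (p.c / 2)]⟩
  set v := p.c - ε with hv
  have hv0 : 0 < v := by rw [hv]; linarith
  have hvc : v < p.c := by rw [hv]; linarith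
  have hv1 : v ≤ 1 := by linarith
  have hd0 : 0 < d := by linarith
  -- The last term makes `η` have at least `(c + 5 ε) t - C₁` particles on `(-K t, w]`, more than a
  -- slow site lets through; `a + 1` places `-K t` to the left of the cut near `-a t`.
  set K := a + 1 + (p.c + 5 * ε) / d with hK
  have hK0 : 0 < K := by positivity
  have hdK : p.c + 5 * ε ≤ d * K := by
    rw [hK, mul_add, mul_div_cancel₀ _ hd0.ne']; nlinarith
  have hKa : a + 1 ≤ K := by
    rw [hK]; have : 0 ≤ (p.c + 5 * ε) / d := by positivity
    linarith
  set q := geomParam p v with hq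
  obtain ⟨y₁, hy₁w, hy₁⟩ := exists_slow_site hslow hε0 w
  obtain ⟨C₁, hC₁⟩ := hη w
  obtain ⟨C₂, hC₂⟩ := hM v hv0 hvc γ hγ0 w
  set C₃ : ℝ := ∑ u ∈ Finset.Ioc y₁ w, (η u : ℝ) with hC₃
  have hvr : ∀ z, v ≤ v / p.c * p.rate z := fun z => by
    rw [div_mul_eq_mul_div, le_div_iff₀ hc]
    exact mul_le_mul_of_nonneg_left (p.c_le_rate z) hv0.le
  have hb : v / p.c < 1 := (div_lt_one hc).2 hvc
  have hq1 : ∀ z, (1 - q z : ℝ) ≤ v / p.c := fun z => by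
    rw [hq, one_sub_geomParam p hv0.le (hvc.le.trans (p.c_le_rate z)),
      div_le_iff₀ (p.rate_pos z)]
    exact hvr z
  have hev : ∀ᶠ t in atTop, -(⌈K * t⌉₊ : ℤ) ≤ w :=
    (tendsto_neg_ceil hK0).eventually_le_atBot w
  have hcur := whp_current p hv0 hv1 hb (y := fun t => -(⌈K * t⌉₊ : ℤ)) (x := w) hev
    (fun _ z _ _ => hvr z) (K := K + 1 + |(w : ℝ)|) (by positivity) (by
      filter_upwards [eventually_ge_atTop 1] with t ht
      have h1 := (neg_ceil_bounds (a := K) (t := t) (by positivity)).2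
      push_cast
      nlinarith [le_abs_self (w : ℝ), abs_nonneg (w : ℝ)]) hε0
  have hsum := whp_forall_sum_le q hb hq1 w (K := K + 1) hε0
  have hreg : WHP (clockMeasure p) fun t τ =>
      Regular τ ∧ Regular (sourceClock p v (-(⌈K * t⌉₊ : ℤ)) τ) :=
    WHP.of_ae (Eventually.of_forall fun t =>
      (ae_regular p).and (ae_regular_sourceClock p hv0 hv1 _))
  refine WHP.of_fst (ν := geometricProduct q) ?_
  refine ((hcur.and (hsum.snd (ν := clockMeasure p))).and
    ((hreg.and (whp_rings p y₁ hε0)).fst (geometricProduct q))).mono ?_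
  filter_upwards [eventually_gt_atTop 2, (tendsto_neg_ceil ha).eventually_le_atBot w,
    eventually_ge_atTop ((C₁ + C₂ + 1) / (4 * ε)), eventually_gt_atTop ((C₁ + C₃) / (3 * ε)),
    eventually_gt_atTop (C₃ / ε)] with t ht haw ht1 ht2 ht3
  rintro ω ⟨⟨h1, h2⟩, ⟨hreg1, hreg2⟩, h3⟩
  have ht0 : 0 < t := by linarith
  rw [div_le_iff₀ (by positivity)] at ht1
  rw [div_lt_iff₀ (by positivity)] at ht2 ht3
  obtain ⟨ha1, ha2⟩ := neg_ceil_bounds (a := a) (t := t) (by positivity)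
  obtain ⟨hK1, hK2⟩ := neg_ceil_bounds (a := K) (t := t) (by positivity)
  set Na := ⌈a * t⌉₊ with hNa
  set NK := ⌈K * t⌉₊ with hNK
  set y : ℤ := -(NK : ℤ) with hy
  have hNN : Na + 1 < NK := by
    have h4 := mul_le_mul_of_nonneg_right hKa ht0.le
    have : ((Na + 1 : ℕ) : ℝ) < NK := by push_cast; linarith
    exact_mod_cast this
  set M := ⌈5 * ε * t⌉₊ with hMdef
  obtain ⟨hM1, hM2⟩ := neg_ceil_bounds (a := 5 * ε) (t := t) (by positivity)
  have hcomp : ∀ u, y < u → u ≤ -(Na : ℤ) - 1 →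
      ∑ z ∈ Finset.Ioc u w, ω.2 z + M ≤ ∑ z ∈ Finset.Ioc u w, η z := by
    intro u hu1 hu2
    obtain ⟨n, rfl⟩ : ∃ n : ℕ, u = -(n : ℤ) := ⟨(-u).toNat, by omega⟩
    have hn1 : (Na : ℝ) ≤ n := by exact_mod_cast (by omega : Na ≤ n)
    have hn2 : (n : ℝ) ≤ NK := by exact_mod_cast (by omega : n ≤ NK)
    have h4 := h2 n (by linarith)
    have h5 := hC₁ n
    have h6 := hC₂ n
    have h7 : γ * (a * t) ≤ γ * n := mul_le_mul_of_nonneg_left (ha1.trans hn1) hγ0.le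
    have h8 : 10 * ε * t ≤ γ * a * t := mul_le_mul_of_nonneg_right hεa ht0.le
    have h9 : (ρ + γ) * n + γ * n = d * n := by rw [hγ]; ring
    have h10 : (∑ z ∈ Finset.Ioc (-(n : ℤ)) w, (ω.2 z : ℝ)) + M ≤
        ∑ z ∈ Finset.Ioc (-(n : ℤ)) w, (η z : ℝ) := by linarith
    exact_mod_cast h10
  refine ⟨min y y₁, fun z hz => ?_⟩
  rw [abs_lt] at h1 h3
  have h5 : p.rate y₁ * t ≤ (p.c + ε) * t := mul_le_mul_of_nonneg_right hy₁.le ht0.le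
  have h6 : v * t = p.c * t - ε * t := by rw [hv]; ring
  have h7 := hC₁ NK
  have h8 : d * (K * t) ≤ d * NK := mul_le_mul_of_nonneg_left hK1 hd0.le
  have h9 : (p.c + 5 * ε) * t ≤ d * K * t := mul_le_mul_of_nonneg_right hdK ht0.le
  -- The slow site gives a current below `(c + 2 ε) t + C₃`. The stationary flux is at least `(c - 2
  -- ε) t`, and adding `M ≥ 5 ε t` gives `(c + 3 ε) t`, which is above that level for large `t`.
  exact current_lt_truncate_of_bounds hreg1 hreg2 (A := (p.c + 2 * ε) * t + C₃)
    (by linarith [h3.2]) (by linarith) (by linarith [h1.1]) (by omega) (by omega) hy₁w.le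
    (fun u hu => sourceClock_of_ne p hu.ne' _) hcomp hz

/-- The process dominates the stationary systems of parameter `v < p.c`. -/
theorem whp_evolve_le_process {p : Environment} (hslow : liminf p.rate atBot = p.c) {η : Config}
    {ρ d : ℝ} (hρ : 0 ≤ ρ) (hM : MeanBound p ρ) (hd : ρ < d)
    (hη : ∀ w : ℤ, ∃ C : ℝ, ∀ n : ℕ, d * n - C ≤ ∑ x ∈ Finset.Ioc (-(n : ℤ)) w, (η x : ℝ))
    {v : ℝ} (hv0 : 0 < v) (hvc : v < p.c) {x m : ℤ} (hxm : x ≤ m) :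
    WHP ((clockMeasure p).prod (geometricProduct (geomParam p v))) fun t ω =>
      evolve (-(⌈t⌉₊ : ℤ)) (m + ⌈t⌉₊).toNat t ω.2 (sourceClock p v (-(⌈t⌉₊ : ℤ)) ω.1) x ≤
        process η ω.1 t x := by
  have hc := p.c_pos
  have hc1 : p.c ≤ 1 := (p.c_le_rate 0).trans (p.rate_le_one 0)
  -- The gap `c - v = 8 δ` leaves room for `v' = v + 4 δ < c`. The stationary flux of parameter `v`
  -- stays below `(v + δ) t`, and a source near `-a t` exceeds this, since at most `2 δ t` is lost
  -- in filling the sites.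
  set δ := (p.c - v) / 8 with hδ
  have hδ0 : 0 < δ := by rw [hδ]; linarith
  set v' := v + 4 * δ with hv'
  have hv'c : v' < p.c := by rw [hv', hδ]; linarith
  have hv'0 : 0 < v' := by linarith
  -- `2 a ≤ 1` keeps the cut to the right of the stationary source at `-⌈t⌉₊`; the bound on `a (ρ +
  -- 1)` controls the mean mass between the cut and `x`.
  obtain ⟨a, ha0, ha1, haρ⟩ : ∃ a, 0 < a ∧ 2 * a ≤ 1 ∧ a * (ρ + 1) ≤ δ :=
    ⟨min (1 / 2) (δ / (ρ + 1)), by positivity, by linarith [min_le_left (1 / 2) (δ / (ρ + 1))], by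
      rw [← le_div_iff₀ (by positivity)]; exact min_le_right _ _⟩
  have hvr : ∀ u, 0 < u → ∀ z, u ≤ u / p.c * p.rate z := fun u hu z => by
    rw [div_mul_eq_mul_div, le_div_iff₀ hc]
    exact mul_le_mul_of_nonneg_left (p.c_le_rate z) hu.le
  have hyK : ∀ a' : ℝ, 0 < a' → ∀ᶠ t : ℝ in atTop,
      (x - (-(⌈a' * t⌉₊ : ℤ) : ℤ) : ℝ) ≤ (a' + 1 + |(x : ℝ)|) * t := fun a' ha' => by
    filter_upwards [eventually_ge_atTop 1] with t ht
    have h1 := (neg_ceil_bounds (a := a') (t := t) (by positivity)).2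
    push_cast
    nlinarith [le_abs_self (x : ℝ), abs_nonneg (x : ℝ)]
  have hev : ∀ a' : ℝ, 0 < a' → ∀ k : ℤ, ∀ᶠ t in atTop, -(⌈a' * t⌉₊ : ℤ) ≤ k := fun a' ha' k =>
    (tendsto_neg_ceil ha').eventually_le_atBot k
  have hcur := whp_current p hv0 (hvc.le.trans hc1) ((div_lt_one hc).2 hvc)
    (y := fun t => -(⌈1 * t⌉₊ : ℤ)) (x := x) (hev 1 one_pos x) (fun _ z _ _ => hvr v hv0 z)
    (K := 1 + 1 + |(x : ℝ)|) (by positivity) (hyK 1 one_pos) hδ0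
  obtain ⟨C, hC⟩ := hM v' hv'0 hv'c (1 / 2) (by norm_num) x
  have hsrc := whp_lt_source_current p (v := v + δ) (m := 2 * δ) hv'0 (hv'c.le.trans hc1)
    (by rw [hv']; linarith) ((div_lt_one hc).2 hv'c) (y := fun t => -(⌈a * t⌉₊ : ℤ)) (x := x)
    ((hev a ha0 (x - 1)).mono fun t h => by omega) (fun _ z _ _ => hvr v' hv'0 z)
    (K := a + 1 + |(x : ℝ)|) (by positivity) (hyK a ha0) (by
      filter_upwards [eventually_ge_atTop 0, eventually_ge_atTop ((C + ρ + 1) / δ)] with t ht ht1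
      rw [div_le_iff₀ hδ0] at ht1
      have h1 := hC ⌈a * t⌉₊
      have h2 := (neg_ceil_bounds (a := a) (t := t) (by positivity)).2
      have h3 : (ρ + 1 / 2) * (⌈a * t⌉₊ : ℝ) ≤ (ρ + 1 / 2) * (a * t + 1) :=
        mul_le_mul_of_nonneg_left h2 (by positivity)
      have h4 : a * (ρ + 1) * t ≤ δ * t := mul_le_mul_of_nonneg_right haρ ht
      have h5 : 0 ≤ a * t := by positivity
      linarith)
  have htr := whp_current_lt_truncate hslow hρ hM hd hη ha0 (x - 1)
  have hreg : WHP (clockMeasure p) fun t τ =>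
      Regular τ ∧ Regular (sourceClock p v (-(⌈t⌉₊ : ℤ)) τ) :=
    WHP.of_ae (Eventually.of_forall fun t =>
      (ae_regular p).and (ae_regular_sourceClock p hv0 (hvc.le.trans hc1) _))
  refine (hcur.and ((hsrc.and (htr.and hreg)).fst _)).mono ?_
  filter_upwards [eventually_gt_atTop 4, hev a ha0 (x - 1), hev 1 one_pos (x - 1)]
    with t ht hax hx1
  rintro ω ⟨h1, h2, ⟨z₀, h3⟩, hreg1, hreg2⟩
  simp only [one_mul] at h1 hx1
  have hNN : ⌈a * t⌉₊ < ⌈t⌉₊ := by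
    have h4 := (neg_ceil_bounds (a := a) (t := t) (by nlinarith)).2
    have : (⌈a * t⌉₊ : ℝ) < ⌈t⌉₊ := by nlinarith [Nat.le_ceil t]
    exact_mod_cast this
  obtain ⟨z₁, _, h4⟩ := process_eq hreg1 η x t
  set z := min (min z₀ z₁) (-(⌈a * t⌉₊ : ℤ) - 1) with hz
  have hz0 : z ≤ z₀ := (min_le_left _ _).trans (min_le_left _ _)
  have hz1 : z ≤ z₁ := (min_le_left _ _).trans (min_le_right _ _)
  have hz2 : z ≤ -(⌈a * t⌉₊ : ℤ) - 1 := min_le_right _ _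
  -- The system started from `η` with a source at `-⌈a * t⌉₊` is the intermediary: it is below the
  -- process by `h5` and above the stationary system by `h7`.
  have h5 := source_occupation_le (Y := -(⌈a * t⌉₊ : ℤ)) hreg1 isCount_zero (by omega) (by omega)
    (h3 z hz0)
  have h6 : current id ω.2 (sourceClock p v (-(⌈t⌉₊ : ℤ)) ω.1) (-(⌈t⌉₊ : ℤ)) x t <
      current id 0 ω.1 (-(⌈a * t⌉₊ : ℤ) + 1) x t := by
    rw [abs_lt] at h1
    have h7 : (current id ω.2 (sourceClock p v (-(⌈t⌉₊ : ℤ)) ω.1) (-(⌈t⌉₊ : ℤ)) x t : ℝ) <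
      current id 0 ω.1 (-(⌈a * t⌉₊ : ℤ) + 1) x t := by linarith [h1.2]
    exact_mod_cast h7
  have h7 := occupation_le_source (η := η) hreg1 hreg2 isCount_id (by omega) (by omega)
    (fun u hu => sourceClock_of_ne p (by omega) _) h6
  have h8 := occupation_eq_evolve (s := t) (ξ := ω.2) (N := (m + ⌈t⌉₊).toNat) (z := x) hreg2
    (y := -(⌈t⌉₊ : ℤ)) (by omega) (by omega)
  have h9 := h4 z hz1
  omega

/-- The process is dominated by the stationary system with a source at a slow site. -/
theorem whp_process_le_evolve {p : Environment} (η : Config) {y m x : ℤ} (hyx : y < x) (hxm : x ≤ m)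
    (hy : ∀ z, y < z → z ≤ m → p.rate y < p.rate z) :
    WHP ((clockMeasure p).prod (geometricProduct (geomParam p (p.rate y)))) fun t ω =>
      process η ω.1 t x ≤ evolve y (m - y).toNat t ω.2 ω.1 x := by
  set u := p.rate y with hu
  have hu0 : 0 < u := p.rate_pos y
  -- `r` is the smallest rate on `(y, x]`. It exceeds `u` strictly, which leaves room for a
  -- stationary flux `v` with `u < v < r`.
  obtain ⟨r, hr1, hr2⟩ : ∃ r, u < r ∧ ∀ z, y < z → z ≤ x → r ≤ p.rate z := by
    obtain ⟨z, hz, hz'⟩ := (Finset.Ioc y x).exists_min_image p.rate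
      ⟨x, Finset.mem_Ioc.2 ⟨hyx, le_rfl⟩⟩
    rw [Finset.mem_Ioc] at hz
    exact ⟨p.rate z, hy z hz.1 (hz.2.trans hxm), fun w h1 h2 => hz' w (Finset.mem_Ioc.2 ⟨h1, h2⟩)⟩
  have hr0 : 0 < r := hu0.trans hr1
  have hr3 : r ≤ 1 := (hr2 x hyx le_rfl).trans (p.rate_le_one x)
  set v := (u + r) / 2 with hv
  have hv0 : 0 < v := by rw [hv]; linarith
  have hvr : v < r := by rw [hv]; linarith
  set δ := (v - u) / 4 with hδ
  have hδ0 : 0 < δ := by rw [hδ, hv]; linarith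
  have hsrc := whp_lt_source_current p (v := u + 2 * δ) (m := δ) hv0 (hvr.le.trans hr3)
    (by linarith) ((div_lt_one hr0).2 hvr) (y := fun _ => y) (x := x)
    (Eventually.of_forall fun _ => by omega) (fun _ z h1 h2 => by
      rw [div_mul_eq_mul_div, le_div_iff₀ hr0]
      exact mul_le_mul_of_nonneg_left (hr2 z h1 h2) hv0.le)
    (K := |(x - y : ℝ)|) (by positivity) (by
      filter_upwards [eventually_ge_atTop 1] with t ht
      nlinarith [le_abs_self (x - y : ℝ), abs_nonneg (x - y : ℝ)])
    ((tendsto_id.const_mul_atTop hδ0).eventually_ge_atTop _)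
  have hreg : WHP (clockMeasure p) fun _ τ => Regular τ :=
    WHP.of_ae (Eventually.of_forall fun t => ae_regular p)
  refine ((hsrc.and (hreg.and (whp_rings p y hδ0))).fst _).mono ?_
  filter_upwards [eventually_gt_atTop ((∑ z ∈ Finset.Ioc y x, (η z : ℝ)) / δ)] with t ht
  rintro ω ⟨h1, hreg, h2⟩
  rw [div_lt_iff₀ hδ0] at ht
  rw [abs_lt] at h2
  obtain ⟨z₁, hz₁, h4⟩ := process_eq hreg η x t
  have h5 := current_le_sum_add (t := t) (η := η) (y := min z₁ y) hreg isCount_zero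
    (min_le_right _ _) hyx.le
  have h5' : (current 0 η ω.1 (min z₁ y) x t : ℝ) ≤
      ∑ z ∈ Finset.Ioc y x, (η z : ℝ) + rings ω.1 y t := by exact_mod_cast h5
  have h6 : current 0 η ω.1 (min z₁ y) x t < current id 0 ω.1 (y + 1) x t := by
    have : (current 0 η ω.1 (min z₁ y) x t : ℝ) < current id 0 ω.1 (y + 1) x t := by linarith [h2.2]
    exact_mod_cast this
  have h7 := occupation_le_source (η := ω.2) hreg hreg isCount_zero (min_le_right _ _) hyx
    (fun _ _ => rfl) h6
  have h8 := occupation_eq_evolve (s := t) (ξ := ω.2) (N := (m - y).toNat) (z := x) hreg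
    (y := y) (by omega) (by omega)
  have h9 := h4 _ (min_le_left z₁ y)
  omega

/-! ### Weak convergence -/

/-- Configurations with at least `k x` particles at each `x ∈ F`. -/
def atLeast (F : Finset ℤ) (k : Config) : Set Config := {ξ | ∀ x ∈ F, k x ≤ ξ x}

theorem measurableSet_atLeast (F : Finset ℤ) (k : Config) : MeasurableSet (atLeast F k) := by
  have : atLeast F k = ⋂ x ∈ F, {ξ : Config | k x ≤ ξ x} := by ext; simp [atLeast]
  rw [this]
  exact F.measurableSet_biInter fun x _ =>
    measurableSet_le measurable_const (measurable_pi_apply x)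

/-- Pathwise order controls only increasing events. Cylinder events are successive differences of
these, one coordinate at a time, and form a π-system containing a neighbourhood basis at each point.
-/
theorem tendsto_of_tendsto_atLeast {μ : ℝ → ProbabilityMeasure Config}
    {ν : ProbabilityMeasure Config}
    (h : ∀ F k, Tendsto (fun t => (μ t : Measure Config) (atLeast F k)) atTop
      (𝓝 ((ν : Measure Config) (atLeast F k)))) : Tendsto μ atTop (𝓝 ν) := by
  set W : Finset ℤ → Finset ℤ → Config → Set Config := fun F G k =>
    {ξ | (∀ x ∈ F, ξ x = k x) ∧ ∀ x ∈ G, k x ≤ ξ x} with hW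
  have hmW : ∀ F G k, MeasurableSet (W F G k) := fun F G k => by
    have : W F G k = (⋂ x ∈ F, {ξ : Config | ξ x = k x}) ∩ atLeast G k := by
      ext; simp [hW, atLeast]
    rw [this]
    exact (F.measurableSet_biInter fun x _ =>
      measurableSet_eq_fun (measurable_pi_apply x) measurable_const).inter
      (measurableSet_atLeast G k)
  -- Mixed events, equality on `F` and lower bounds on `G`, are closed under the induction: `ξ a = k
  -- a` is `k a ≤ ξ a` minus `k a + 1 ≤ ξ a`.
  have key : ∀ F G k, Disjoint F G → Tendsto (fun t => (μ t : Measure Config) (W F G k)) atTop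
      (𝓝 ((ν : Measure Config) (W F G k))) := by
    intro F
    induction F using Finset.induction_on with
    | empty =>
      intro G k _
      have : W ∅ G k = atLeast G k := by ext; simp [hW, atLeast]
      rw [this]; exact h G k
    | insert a F haF ih =>
      intro G k hd
      rw [Finset.disjoint_insert_left] at hd
      have hd' : Disjoint F (insert a G) := Finset.disjoint_insert_right.2 ⟨haF, hd.2⟩
      set k' := Function.update k a (k a + 1) with hk'
      have hne : ∀ x, x ≠ a → k' x = k x := fun x hx => by simp [hk', hx]
      have hka : k' a = k a + 1 := by simp [hk']
      have hsub : W F (insert a G) k' ⊆ W F (insert a G) k := by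
        rintro ξ ⟨h1, h2⟩
        refine ⟨fun x hx => ?_, fun x hx => ?_⟩
        · rw [h1 x hx, hne x (ne_of_mem_of_not_mem hx haF)]
        · rcases eq_or_ne x a with rfl | hxa
          · have := h2 x hx; omega
          · rw [← hne x hxa]; exact h2 x hx
      have heq : W (insert a F) G k = W F (insert a G) k \ W F (insert a G) k' := by
        ext ξ
        simp only [hW, Set.mem_sdiff, Set.mem_ofPred_eq, Finset.forall_mem_insert, hka]
        have e1 : (∀ x ∈ F, ξ x = k' x) ↔ ∀ x ∈ F, ξ x = k x :=
          forall₂_congr fun x hx => by rw [hne x (ne_of_mem_of_not_mem hx haF)]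
        have e2 : (∀ x ∈ G, k' x ≤ ξ x) ↔ ∀ x ∈ G, k x ≤ ξ x :=
          forall₂_congr fun x hx => by rw [hne x (ne_of_mem_of_not_mem hx hd.1)]
        rw [e1, e2]
        constructor
        · rintro ⟨⟨h1, h2⟩, h3⟩
          exact ⟨⟨h2, h1.ge, h3⟩, fun h4 => by have := h4.2.1; omega⟩
        · rintro ⟨⟨h2, h1, h3⟩, h4⟩
          refine ⟨⟨?_, h2⟩, h3⟩
          by_contra h5
          exact h4 ⟨h2, by omega, h3⟩
      have hdiff : ∀ m : ProbabilityMeasure Config, (m : Measure Config) (W (insert a F) G k) =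
          (m : Measure Config) (W F (insert a G) k) - (m : Measure Config) (W F (insert a G) k') :=
        fun m => by
          rw [heq, measure_sdiff hsub (hmW _ _ _).nullMeasurableSet (measure_ne_top _ _)]
      simp only [hdiff]
      exact ENNReal.Tendsto.sub (ih _ _ hd') (ih _ _ hd') (Or.inl (measure_ne_top _ _))
  have hWk : ∀ F k, W F ∅ k = {ξ : Config | ∀ x ∈ F, ξ x = k x} := fun F k => by ext; simp [hW]
  refine IsPiSystem.tendsto_probabilityMeasure_of_tendsto_of_mem
    (S := {s | ∃ F k, s = W F ∅ k}) ?_ ?_ ?_ ?_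
  · rintro _ ⟨F, k, rfl⟩ _ ⟨F', k', rfl⟩ ⟨ξ, h1, h2⟩
    rw [hWk] at h1 h2
    refine ⟨F ∪ F', ξ, ?_⟩
    ext ζ
    simp only [hWk, Set.mem_inter_iff, Set.mem_ofPred_eq, Finset.mem_union]
    constructor
    · rintro ⟨h3, h4⟩ x (hx | hx)
      · rw [h3 x hx, h1 x hx]
      · rw [h4 x hx, h2 x hx]
    · intro h3
      exact ⟨fun x hx => by rw [h3 x (Or.inl hx), h1 x hx],
        fun x hx => by rw [h3 x (Or.inr hx), h2 x hx]⟩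
  · rintro _ ⟨F, k, rfl⟩
    exact hmW _ _ _
  · intro u hu ξ hξ
    obtain ⟨F, v, hv, hFu⟩ := isOpen_pi_iff.1 hu ξ hξ
    refine ⟨W F ∅ ξ, ⟨F, ξ, rfl⟩, ?_, fun ζ hζ => hFu fun x hx => ?_⟩
    · rw [hWk]
      have : {ζ : Config | ∀ x ∈ F, ζ x = ξ x} = (F : Set ℤ).pi fun x => {ξ x} := by
        ext; simp [Set.mem_pi]
      rw [this]
      exact (isOpen_set_pi F.finite_toSet fun _ _ => isOpen_discrete _).mem_nhds fun _ _ => rfl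
    · rw [hWk] at hζ
      rw [hζ x hx]; exact (hv x hx).2
  · rintro _ ⟨F, k, rfl⟩
    simp only [ProbabilityMeasure.coeFn_def]
    exact (ENNReal.tendsto_toNNReal (measure_ne_top _ _)).comp (key F ∅ k (by simp))

theorem geometricMeasure_le {q : unitInterval} (hq : q ≠ 0) (k : ℕ) :
    geometricMeasure q {n | k ≤ n} = ENNReal.ofReal ((1 - q) ^ k) := by
  have h0 : 0 ≤ (1 - q : ℝ) := sub_nonneg.2 q.2.2
  induction k with
  | zero => simp [Set.ofPred_true]
  | succ k ih =>
    have h := congrArg (fun m => m {n | k ≤ n}) (geometricMeasure_restrict_map_pred hq)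
    rw [Measure.map_apply measurable_from_top .of_discrete, Measure.restrict_apply .of_discrete,
      Measure.smul_apply, ih, smul_eq_mul, ← ENNReal.ofReal_mul h0, ← pow_succ'] at h
    rw [← h]
    congr 1
    ext n
    simp only [Set.mem_inter_iff, Set.mem_preimage, Set.mem_ofPred_eq]
    omega

theorem geometricProduct_atLeast (p : Environment) {v : ℝ} (hv : 0 ≤ v) {F : Finset ℤ}
    (hF : ∀ x ∈ F, v < p.rate x) (k : Config) :
    geometricProduct (geomParam p v) (atLeast F k) =
      ENNReal.ofReal (∏ x ∈ F, (v / p.rate x) ^ k x) := by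
  have : atLeast F k = (F : Set ℤ).pi fun x => {n | k x ≤ n} := by
    ext; simp [atLeast, Set.mem_pi]
  rw [this, geometricProduct, Measure.infinitePi_pi (X := fun _ : ℤ => ℕ)
    (μ := fun x => geometricMeasure (geomParam p v x)) (t := fun x => {n | k x ≤ n})
    fun _ _ => .of_discrete,
    ENNReal.ofReal_prod_of_nonneg fun x _ => pow_nonneg (div_nonneg hv (p.rate_pos x).le) _]
  refine Finset.prod_congr rfl fun x hx => ?_
  have h1 := one_sub_geomParam p hv (hF x hx).le
  rw [geometricMeasure_le, h1]
  intro h0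
  rw [h0, Set.Icc.coe_zero, sub_zero, eq_comm, div_eq_one_iff_eq (p.rate_pos x).ne'] at h1
  exact (hF x hx).ne h1

theorem productGeometric_eq (p : Environment) {v : ℝ} (hv0 : 0 ≤ v) (hv : ∀ x, v < p.rate x) :
    (productGeometric p v hv0 hv : Measure Config) = geometricProduct (geomParam p v) := by
  simp only [productGeometric, geometricProduct, ProbabilityMeasure.coe_mk]
  congr 1
  funext x
  congr 1
  refine Subtype.ext ?_
  have := one_sub_geomParam p hv0 (hv x).le
  simp only
  linarith

/-- Since `p_x > c`, the rates on `[a, m]` stay above some `c + δ`. The rightmost site before `a`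
with rate below `c + δ`, which exists by the liminf condition, is slower than all sites after it up
to `m`. -/
theorem exists_slow_site_record {p : Environment} (hp : ∀ x, p.c < p.rate x)
    (h : liminf p.rate atBot = p.c) {ε : ℝ} (hε : 0 < ε) (a m : ℤ) :
    ∃ y < a, p.rate y < p.c + ε ∧ ∀ z, y < z → z ≤ m → p.rate y < p.rate z := by
  obtain ⟨δ, hδ0, hδε, hδ⟩ : ∃ δ > 0, δ ≤ ε ∧ ∀ z ∈ Finset.Icc a m, p.c + δ ≤ p.rate z := by
    rcases (Finset.Icc a m).eq_empty_or_nonempty with he | hne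
    · exact ⟨ε, hε, le_rfl, by simp [he]⟩
    · obtain ⟨z, _, hz⟩ := (Finset.Icc a m).exists_min_image p.rate hne
      refine ⟨min ε (p.rate z - p.c), lt_min hε (sub_pos.2 (hp z)), min_le_left _ _, fun w hw => ?_⟩
      linarith [hz w hw, min_le_right ε (p.rate z - p.c)]
  obtain ⟨y', hy'a, hy'⟩ := exists_slow_site h hδ0 a
  obtain ⟨y, hy, hmax⟩ := ((Finset.Ico y' a).filter fun z => p.rate z < p.c + δ).exists_max_image id
    ⟨y', by simp [hy'a, hy']⟩
  simp only [Finset.mem_filter, Finset.mem_Ico, id] at hy hmax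
  refine ⟨y, hy.1.2, by linarith [hy.2], fun z hyz hzm => hy.2.trans_le ?_⟩
  rcases lt_or_ge z a with hza | hza
  · by_contra hlt
    exact absurd (hmax z ⟨⟨by omega, hza⟩, not_le.1 hlt⟩) (by omega)
  · exact hδ z (Finset.mem_Icc.2 ⟨hza, hzm⟩)

/-- An independent initial configuration is adjoined so that the process and a stationary system
live on one probability space. -/
theorem law_atLeast (p : Environment) (η : Config) (t : ℝ) (F : Finset ℤ) (k : Config)
    (ν : Measure Config) [IsProbabilityMeasure ν] :
    (law p η t : Measure Config) (atLeast F k) =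
      (clockMeasure p).prod ν {ω | process η ω.1 t ∈ atLeast F k} := by
  have h : {ω : Clocks × Config | process η ω.1 t ∈ atLeast F k} =
      {τ | process η τ t ∈ atLeast F k} ×ˢ Set.univ := by ext; simp
  rw [h, Measure.prod_prod, measure_univ, mul_one]
  exact Measure.map_apply (measurable_process η t) (measurableSet_atLeast F k)

section

variable {p : Environment} {η : Config} {F : Finset ℤ} {k : Config} {a : ℝ≥0∞}

/-- A lower bound for the law of the process from a system of constant law below it. -/
theorem eventually_lt_law {ν : Measure Config} [IsProbabilityMeasure ν]
    {X : ℝ → Clocks × Config → Config}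
    (hX : ∀ᶠ t in atTop, Measurable (X t) ∧ ((clockMeasure p).prod ν).map (X t) = ν)
    (hle : ∀ x ∈ F, WHP ((clockMeasure p).prod ν) fun t ω => X t ω x ≤ process η ω.1 t x)
    (ha : a < ν (atLeast F k)) : ∀ᶠ t in atTop, a < (law p η t : Measure Config) (atLeast F k) := by
  have h1 := WHP.forall_mem_finset F hle
  have h2 := ENNReal.Tendsto.sub (tendsto_const_nhds (x := ν (atLeast F k)) (f := atTop)) h1
    (Or.inl (measure_ne_top _ _))
  rw [tsub_zero] at h2
  filter_upwards [h2.eventually_const_lt ha, hX] with t ht hXt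
  refine ht.trans_le (tsub_le_iff_right.2 ?_)
  rw [law_atLeast p η t F k ν]
  conv_lhs => rw [← hXt.2, Measure.map_apply hXt.1 (measurableSet_atLeast F k)]
  refine (measure_mono fun ω hω => ?_).trans (measure_union_le _ _)
  by_cases h3 : ∀ x ∈ F, X t ω x ≤ process η ω.1 t x
  · exact Or.inl fun x hx => (hω x hx).trans (h3 x hx)
  · exact Or.inr h3

/-- An upper bound for the law of the process from a system of constant law above it. -/
theorem eventually_law_lt {ν : Measure Config} [IsProbabilityMeasure ν]
    {X : ℝ → Clocks × Config → Config}
    (hX : ∀ᶠ t in atTop, Measurable (X t) ∧ ((clockMeasure p).prod ν).map (X t) = ν)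
    (hle : ∀ x ∈ F, WHP ((clockMeasure p).prod ν) fun t ω => process η ω.1 t x ≤ X t ω x)
    (ha : ν (atLeast F k) < a) : ∀ᶠ t in atTop, (law p η t : Measure Config) (atLeast F k) < a := by
  have h1 := WHP.forall_mem_finset F hle
  have h2 := Tendsto.add (tendsto_const_nhds (x := ν (atLeast F k)) (f := atTop)) h1
  rw [add_zero] at h2
  filter_upwards [h2.eventually_lt_const ha, hX] with t ht hXt
  refine lt_of_le_of_lt ?_ ht
  rw [law_atLeast p η t F k ν]
  conv_rhs => rw [← hXt.2, Measure.map_apply hXt.1 (measurableSet_atLeast F k)]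
  rw [hXt.2]
  refine (measure_mono fun ω hω => ?_).trans (measure_union_le _ _)
  by_cases h3 : ∀ x ∈ F, process η ω.1 t x ≤ X t ω x
  · exact Or.inl fun x hx => (hω x hx).trans (h3 x hx)
  · exact Or.inr h3

end

end ZeroRange

/-! ### Conclusion: squeezing between stationary systems. -/

open ZeroRange

theorem theorem2p3 (p : ZeroRange.Environment)
    (hp : ∀ x : ℤ, p.c < p.rate x)
    (hliminf : liminf p.rate atBot = p.c)
    (R : ℝ → ℝ)
    (hR : ∀ v : ℝ, 0 ≤ v → v < p.c → ZeroRange.HasMeanLeftDensity p v (R v))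
    (ρ : ℝ)
    (hρ : Tendsto R (𝓝[<] p.c) (𝓝 ρ))
    (η : ZeroRange.Config)
    (hη : (ρ : EReal) < ZeroRange.lowerLeftDensity η) :
    Tendsto (fun t : ℝ => ZeroRange.law p η t) atTop
      (𝓝 (ZeroRange.productGeometric p p.c p.c_pos.le hp)) := by
  have hc := p.c_pos
  have hc1 : p.c ≤ 1 := (p.c_le_rate 0).trans (p.rate_le_one 0)
  obtain ⟨hρ0, hM⟩ := limit_nonneg_and_meanBound hR hρ
  obtain ⟨d, hd, hdens⟩ := exists_lower_density hη
  refine tendsto_of_tendsto_atLeast fun F k => ?_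
  obtain ⟨a, m, ham⟩ : ∃ a m : ℤ, ∀ x ∈ F, a ≤ x ∧ x ≤ m := by
    obtain ⟨a, ha⟩ := F.bddBelow
    obtain ⟨m, hm⟩ := F.bddAbove
    exact ⟨a, m, fun x hx => ⟨ha hx, hm hx⟩⟩
  -- Both bounds are for parameters different from `c`; continuity of the probability of `atLeast F
  -- k` in the parameter closes the gap.
  have hcont : Continuous fun v : ℝ => ENNReal.ofReal (∏ x ∈ F, (v / p.rate x) ^ k x) :=
    ENNReal.continuous_ofReal.comp (continuous_finsetProd _ fun x _ => by fun_prop)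
  rw [productGeometric_eq, geometricProduct_atLeast p hc.le fun x _ => hp x]
  refine tendsto_order.2 ⟨fun l hl => ?_, fun l hl => ?_⟩
  · obtain ⟨v, hvl, hv0, hvc⟩ : ∃ v, l < ENNReal.ofReal (∏ x ∈ F, (v / p.rate x) ^ k x) ∧
        0 < v ∧ v < p.c :=
      ((((hcont.tendsto p.c).mono_left nhdsWithin_le_nhds).eventually_const_lt hl).and
        (Ioo_mem_nhdsLT hc)).exists
    have hr : ∀ x, v < p.rate x := fun x => hvc.trans (hp x)
    rw [← geometricProduct_atLeast p hv0.le fun x _ => hr x] at hvl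
    refine eventually_lt_law (Eventually.mono (eventually_gt_atTop 0) fun t ht => ⟨?_, ?_⟩)
      (fun x hx => whp_evolve_le_process hliminf hρ0 hM hd hdens hv0 hvc (ham x hx).2) hvl
    · exact measurable_evolve measurable_snd ((measurable_sourceClock p _).comp measurable_fst) _ _ _
    · exact map_evolve_sourceClock p hv0 (hvc.le.trans hc1) (fun x _ _ => hr x) ht
  · obtain ⟨ε, hε, hεl⟩ := Metric.eventually_nhds_iff.1
      ((hcont.tendsto p.c).eventually_lt_const hl)
    -- The parameter above `c` is the rate of an actual site, so the source at `y` uses its own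
    -- unscaled clock. Parameters above `c` need only be admissible on the window `(y, m]`.
    obtain ⟨y, hya, hyε, hy⟩ := exists_slow_site_record hp hliminf hε a m
    have hyl : geometricProduct (geomParam p (p.rate y)) (atLeast F k) < l := by
      rw [geometricProduct_atLeast p (p.rate_pos y).le fun x hx =>
        hy x (hya.trans_le (ham x hx).1) (ham x hx).2]
      refine hεl ?_
      rw [Real.dist_eq, abs_of_pos (sub_pos.2 (hp y))]
      linarith
    refine eventually_law_lt (Eventually.mono (eventually_gt_atTop 0) fun t ht => ⟨?_, ?_⟩)
      (fun x hx => whp_process_le_evolve η (hya.trans_le (ham x hx).1) (ham x hx).2 hy) hyl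
    · exact measurable_evolve measurable_snd measurable_fst _ _ _
    · have hy' : ∀ x, y < x → x ≤ y + (m - y).toNat → p.rate y < p.rate x := fun x h1 h2 => by
        rcases le_or_gt x m with h3 | h3
        · exact hy x h1 h3
        · omega
      exact map_evolve p hy' (fun x h1 h2 => one_sub_geomParam p (p.rate_pos y).le
        (hy' x h1 h2).le) ht
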